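/- All manifolds, maps and fields are $C^\infty$; manifolds are Hausdorff and second countable. **Setting.** Let $f\colon M^n\to\mathbb{R}^{n+p}$ be an isometric immersion with second fundamental form $\alpha_f$ and normal connection $\nabla^\perp$. A Dupin principal normal of multiplicity $s\ge 1$ is a smooth normal vector field $\eta$ such that the subspaces $\mathcal{E}_\eta(x)=\{Z\in T_xM:\alpha_f(Z,X)=\langle Z,X\rangle\eta \text{ for all } X\in T_xM\}$ have constant dimension $s$ and $\nabla^\perp_Z\eta=0$ for all $Z\in\mathcal{E}_\eta$. Its conullity is $\mathcal{E}_\eta^\perp\subset TM$; it is integrable if through each point of $M$ there passes an $(n-s)$-dimensional integral manifold of it. **Notation.** Let $h\colon L^{n-s}\to\mathbb{R}^{n+p}$ be an immersion with a normal subbundle $\mathcal{N}$ of rank $s$ that is parallel (invariant under the normal connection) and flat ($R^\perp_h|_{\mathcal N}=0$). Let $\mathcal{N}^{\|}$ be the vector space of parallel sections of $\mathcal N$, and $\mathcal{N}^\perp$ the orthogonal complement of $\mathcal{N}$ in the normal bundle of $h$. Let $\mathcal{S}(h)$ be the set of pairs $(\varphi,\beta)$, with $\varphi\in C^\infty(L)$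 and $\beta$ a smooth normal vector field of $h$, such that $\alpha_h(\nabla\varphi,X)+\nabla^\perp_X\beta=0$ for all $X\in TL$, and $\varphi$ and $\mathcal{F}=h_*\nabla\varphi+\beta$ vanish nowhere. Let $\mathcal{S}_{\mathcal N}(h)$ be the set of equivalence classes of such pairs, where $(\varphi,\beta)\sim(\varphi',\beta')$ if and only if $\varphi'=\lambda\varphi$ and $\beta'-\lambda\beta\in\mathcal{N}^{\|}$ for some real $\lambda\neq0$. For $w=[(\varphi,\beta)]$ set $\bar\beta=-\varphi^{-1}\beta_{\mathcal{N}^\perp}$ and $\mathcal{E}(w)(u)=\{Z\in T_uL:\alpha_h(Z,X)_{\mathcal{N}^\perp}=\langle Z,X\rangle\bar\beta\text{ for all }X\in T_uL\}$, where a subscript denotes orthogonal projection. When $L$ is simply connected, the $\mathcal{N}$-Ribaucour transform of $h$ determined by $w$ is the submanifold parametrized, at regular points, by $$(u,t)\in L\times\mathcal{N}^{\|}\ \longmapsto\ h_t(u)=h(u)-2\varphi(u)\,\frac{\mathcal{F}_t(u)}{\|\mathcal{F}_t(u)\|^{2}},\qquad \mathcal{F}_t=h_*\nabla\varphi+\beta+t,$$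 with $h=\lim_{\|t\|\to\infty}h_t$ as its leaf at infinity. Given an immersion $j\colon L\to M$ with $h=f\circ j$, we say that $f$ is, near $L$, the $\mathcal{N}$-Ribaucour transform of $h$ determined by $w$ if, for some representative $(\varphi,\beta)$ of $w$ and some parallel orthonormal frame of $\mathcal{N}$ (which identifies $\mathcal{N}^{\|}$ with $\mathbb{R}^s$), there is a local diffeomorphism $\Psi\colon W\to M$, defined on an open neighbourhood $W$ of $L\times\{0\}$ in $L\times\mathbb{R}^s$, such that $\Psi(u,0)=j(u)$ for all $u\in L$ and, for all $(u,z)\in W$ with $z\ne0$, setting $t=z/\|z\|^2$, one has $\mathcal{F}_t(u)\neq0$ and $f(\Psi(u,z))=h_t(u)$. **Theorem.** Let $f\colon M^n\to\mathbb{R}^{n+p}$ be an isometric immersion carrying a Dupin principal normal $\eta$ of multiplicity $s\geq 1$ with integrable conullity. Let $j\colon L^{n-s}\to M^n$ be an immersed integral manifold of the conullity (for example, a leaf), and put $h=f\circ j$. Then $\mathcal{N}=\mathcal{E}_\eta|_L$, that is, $\mathcal{N}(u)=f_*\mathcal{E}_\eta(j(u))$, is a normal subbundle of $h$ of rank $s$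 that is parallel and flat. Moreover, if $L$ is simply connected, there is $w\in\mathcal{S}_{\mathcal N}(h)$ with $\mathcal{E}(w)=0$ such that $f$ is, near $L$, the $\mathcal{N}$-Ribaucour transform of $h$ determined by $w$; and $w$ is the only element of $\mathcal{S}_{\mathcal N}(h)$ by which $f$ is so determined. -/

import Mathlib

open scoped Manifold ContDiff RealInnerProductSpace

noncomputable section

/-- Euclidean space `ℝᵏ`, used both as a model space for manifolds and as the ambient space. -/
abbrev Euc (k : ℕ) : Type := EuclideanSpace ℝ (Fin k)

namespace Submfd

/-! Throughout, a `k`-dimensional manifold is a smooth manifold without boundary modelled on `Euc k`,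
so that each tangent space `TangentSpace 𝓘(ℝ, Euc k) x` is by definition `Euc k` (the tangent space
being read in the preferred chart at `x`). A submanifold of `Euc q` is an immersion
`f : M → Euc q`; `M` carries the metric induced by `f`, so that `f` is an isometric immersion. -/

section Immersions

variable {k q : ℕ} {M : Type*} [TopologicalSpace M] [ChartedSpace (Euc k) M]

variable (k) in
/-- The differential `f_* : T_x M → ℝ^q`. -/
def differential (f : M → Euc q) (x : M) : Euc k →L[ℝ] Euc q :=
  mfderiv 𝓘(ℝ, Euc k) 𝓘(ℝ, Euc q) f x

variable (k) in
/-- `f` is a smooth immersion. -/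
structure IsSmoothImmersion (f : M → Euc q) : Prop where
  smooth : ContMDiff 𝓘(ℝ, Euc k) 𝓘(ℝ, Euc q) ∞ f
  injective : ∀ x, Function.Injective (differential k f x)

/-- The induced metric `⟨X, Y⟩` on `T_x M`. -/
def metric (f : M → Euc q) (x : M) (X Y : Euc k) : ℝ :=
  ⟪differential k f x X, differential k f x Y⟫

variable (k) in
/-- The normal space of `f` at `x`, the orthogonal complement of `f_* T_x M` in `ℝ^q`. -/
def normalSpace (f : M → Euc q) (x : M) : Submodule ℝ (Euc q) :=
  (LinearMap.range (differential k f x).toLinearMap)ᗮ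

/-- The second fundamental form `α_f(X, Y)` at `x`: the normal component of the second derivative
of `f` in the chart in which `T_x M` is identified with `Euc k`. -/
def secondFundamentalForm (f : M → Euc q) (x : M) (X Y : Euc k) : Euc q :=
  (normalSpace k f x).starProjection
    (fderiv ℝ (fderiv ℝ (f ∘ (extChartAt 𝓘(ℝ, Euc k) x).symm))
      (extChartAt 𝓘(ℝ, Euc k) x x) X Y)

/-- The normal connection `∇^⊥_X ξ` at `x`: the normal component of the derivative of `ξ`. -/
def normalDeriv (f ξ : M → Euc q) (x : M) (X : Euc k) : Euc q :=
  (normalSpace k f x).starProjection (differential k ξ x X)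

variable (k) in
/-- The gradient at `x` of a function `φ` for the induced metric,
`(f_*ᵀ f_*)⁻¹ (dφ)ᵀ`; see `metric_gradient`. -/
def gradient (f : M → Euc q) (φ : M → ℝ) (x : M) : Euc k :=
  ((differential k f x).adjoint ∘L differential k f x).inverse
    ((InnerProductSpace.toDual ℝ (Euc k)).symm (mfderiv 𝓘(ℝ, Euc k) 𝓘(ℝ, ℝ) φ x))

theorem metric_gradient (f : M → Euc q) (φ : M → ℝ) (x : M)
    (h : Function.Injective (differential k f x)) (X : Euc k) :
    metric f x (gradient k f φ x) X = (mfderiv 𝓘(ℝ, Euc k) 𝓘(ℝ, ℝ) φ x : Euc k →L[ℝ] ℝ) X := by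
  set A := differential k f x with hA
  have hinj : Function.Injective (A.adjoint ∘L A) := by
    rw [injective_iff_map_eq_zero]
    intro v hv
    have h0 : ⟪(A.adjoint ∘L A) v, v⟫ = 0 := by rw [hv, inner_zero_left]
    rw [ContinuousLinearMap.comp_apply, ContinuousLinearMap.adjoint_inner_left,
      inner_self_eq_zero] at h0
    exact (injective_iff_map_eq_zero A).1 h v h0
  let e : Euc k ≃L[ℝ] Euc k :=
    (LinearEquiv.ofInjectiveEndo (A.adjoint ∘L A).toLinearMap hinj).toContinuousLinearEquiv
  have he : (A.adjoint ∘L A) = (e : Euc k →L[ℝ] Euc k) := by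
    ext1 v; rfl
  have key : (A.adjoint ∘L A) (gradient k f φ x) =
      (InnerProductSpace.toDual ℝ (Euc k)).symm (mfderiv 𝓘(ℝ, Euc k) 𝓘(ℝ, ℝ) φ x) := by
    rw [gradient, ← hA, he, ContinuousLinearMap.inverse_equiv]
    exact e.apply_symm_apply _
  rw [metric, ← hA, ← ContinuousLinearMap.adjoint_inner_left, ← ContinuousLinearMap.comp_apply,
    key]
  exact InnerProductSpace.toDual_symm_apply

/-- The curvature `R^⊥(X, Y) ξ = ∇^⊥_X ∇^⊥_Y ξ - ∇^⊥_Y ∇^⊥_X ξ - ∇^⊥_{[X,Y]} ξ` of the normal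
connection, at `x`. -/
def normalCurvature (f : M → Euc q) (X Y : Π x : M, TangentSpace 𝓘(ℝ, Euc k) x) (ξ : M → Euc q)
    (x : M) : Euc q :=
  normalDeriv f (fun y => normalDeriv f ξ y (Y y)) x (X x)
    - normalDeriv f (fun y => normalDeriv f ξ y (X y)) x (Y x)
    - normalDeriv f ξ x (VectorField.mlieBracket 𝓘(ℝ, Euc k) X Y x)

/-- `X` is a smooth vector field. -/
def IsSmoothVectorField [IsManifold 𝓘(ℝ, Euc k) ∞ M]
    (X : Π x : M, TangentSpace 𝓘(ℝ, Euc k) x) : Prop :=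
  ContMDiff 𝓘(ℝ, Euc k) 𝓘(ℝ, Euc k).tangent ∞
    (fun x => (⟨x, X x⟩ : TangentBundle 𝓘(ℝ, Euc k) M))

/-! ### Normal subbundles -/

variable (k) in
/-- `ξ` is a smooth section of the family `V` of subspaces of `ℝ^q`. -/
structure IsSection (V : M → Submodule ℝ (Euc q)) (ξ : M → Euc q) : Prop where
  smooth : ContMDiff 𝓘(ℝ, Euc k) 𝓘(ℝ, Euc q) ∞ ξ
  mem : ∀ x, ξ x ∈ V x

variable (k) in
/-- `V` is a smooth subbundle of rank `s` of the normal bundle of `f`. Smoothness is smoothness of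
the orthogonal projection. -/
structure IsNormalSubbundle (f : M → Euc q) (V : M → Submodule ℝ (Euc q)) (s : ℕ) : Prop where
  le_normal : ∀ x, V x ≤ normalSpace k f x
  rank : ∀ x, Module.finrank ℝ (V x) = s
  smooth : ContMDiff 𝓘(ℝ, Euc k) 𝓘(ℝ, Euc q →L[ℝ] Euc q) ∞ (fun x => (V x).starProjection)

variable (k) in
/-- `V` is parallel with respect to the normal connection of `f`. -/
def IsParallel (f : M → Euc q) (V : M → Submodule ℝ (Euc q)) : Prop :=
  ∀ ξ, IsSection k V ξ → ∀ (x : M) (X : Euc k), normalDeriv f ξ x X ∈ V x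

variable (k) in
/-- `V` is flat: `R^⊥|_V = 0`. -/
def IsFlat [IsManifold 𝓘(ℝ, Euc k) ∞ M] (f : M → Euc q) (V : M → Submodule ℝ (Euc q)) : Prop :=
  ∀ X Y : Π x : M, TangentSpace 𝓘(ℝ, Euc k) x, IsSmoothVectorField X → IsSmoothVectorField Y →
    ∀ ξ, IsSection k V ξ → ∀ x, normalCurvature f X Y ξ x = 0

variable (k) in
/-- The orthogonal complement of `V` in the normal bundle of `f`. -/
def normalCompl (f : M → Euc q) (V : M → Submodule ℝ (Euc q)) (x : M) : Submodule ℝ (Euc q) :=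
  (V x)ᗮ ⊓ normalSpace k f x

variable (k) in
/-- The vector space of parallel sections of `V`. -/
def parallelSections (f : M → Euc q) (V : M → Submodule ℝ (Euc q)) :
    Submodule ℝ (M → Euc q) where
  carrier := {t | IsSection k V t ∧ ∀ (x : M) (X : Euc k), normalDeriv f t x X = 0}
  add_mem' := by
    rintro a b ⟨ha, ha'⟩ ⟨hb, hb'⟩
    refine ⟨⟨ha.smooth.add hb.smooth, fun x => (V x).add_mem (ha.mem x) (hb.mem x)⟩, fun x X => ?_⟩
    have h1 : differential k (a + b) x = differential k a x + differential k b x :=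
      mfderiv_add (ha.smooth.mdifferentiable (by simp) x) (hb.smooth.mdifferentiable (by simp) x)
    have h2 := ha' x X
    have h3 := hb' x X
    simp only [normalDeriv] at h2 h3 ⊢
    rw [h1, add_apply, map_add, h2, h3, add_zero]
  zero_mem' := by
    refine ⟨⟨contMDiff_const, fun x => (V x).zero_mem⟩, fun x X => ?_⟩
    have h1 : differential k (0 : M → Euc q) x = 0 := mfderiv_const
    simp [normalDeriv, h1]
  smul_mem' := by
    rintro c a ⟨ha, ha'⟩
    refine ⟨⟨(contDiff_const_smul c).contMDiff.comp ha.smooth, fun x => (V x).smul_mem c (ha.mem x)⟩, fun x X => ?_⟩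
    have h1 : differential k (c • a) x = c • differential k a x :=
      const_smul_mfderiv (ha.smooth.mdifferentiable (by simp) x) c
    have h2 := ha' x X
    simp only [normalDeriv] at h2 ⊢
    rw [h1, smul_apply, map_smul, h2, smul_zero]

variable (k) in
/-- `ξ₁, …, ξ_s` is a parallel orthonormal family of sections of `V`; when `V` has rank `s` it is a
parallel orthonormal frame of `V`. -/
structure IsParallelFrame (f : M → Euc q) (V : M → Submodule ℝ (Euc q)) {s : ℕ}
    (ξ : Fin s → M → Euc q) : Prop where
  parallel : ∀ i, ξ i ∈ parallelSections k f V
  orthonormal : ∀ x, Orthonormal ℝ (fun i => ξ i x)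

/-! ### Principal normals -/

variable (k) in
/-- The nullity `E_η(x) = ker (α_f - ⟨ , ⟩ η)` at `x`. -/
def nullity (f η : M → Euc q) (x : M) : Submodule ℝ (Euc k) where
  carrier := {Z | ∀ X, secondFundamentalForm f x Z X = metric f x Z X • η x}
  add_mem' := by
    intro a b ha hb X
    have ha := ha X
    have hb := hb X
    simp only [secondFundamentalForm, metric, map_add, add_apply,
      inner_add_left, add_smul] at ha hb ⊢
    rw [ha, hb]
  zero_mem' := by
    intro X
    simp [secondFundamentalForm, metric]
  smul_mem' := by
    intro c a ha X
    have ha := ha X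
    simp only [secondFundamentalForm, metric, map_smul, smul_apply,
      inner_smul_left, mul_smul] at ha ⊢
    rw [ha]; simp

variable (k) in
/-- The conullity: the orthogonal complement of `E_η(x)` in `T_x M` for the induced metric. -/
def conullity (f η : M → Euc q) (x : M) : Submodule ℝ (Euc k) where
  carrier := {Y | ∀ Z ∈ nullity k f η x, metric f x Y Z = 0}
  add_mem' := by
    intro a b ha hb Z hZ
    have ha := ha Z hZ
    have hb := hb Z hZ
    simp only [metric, map_add, inner_add_left] at ha hb ⊢
    rw [ha, hb, add_zero]
  zero_mem' := by
    intro Z _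
    simp [metric]
  smul_mem' := by
    intro c a ha Z hZ
    have ha := ha Z hZ
    simp only [metric, map_smul, inner_smul_left] at ha ⊢
    rw [ha, mul_zero]

variable (k) in
/-- `η` is a Dupin principal normal of `f` with multiplicity `s`: a smooth normal vector field whose
nullity has constant dimension `s ≥ 1` and which is parallel, in the normal connection, along its
nullity. -/
structure IsDupinPrincipalNormal (f η : M → Euc q) (s : ℕ) : Prop where
  one_le : 1 ≤ s
  isSection : IsSection k (normalSpace k f) η
  multiplicity : ∀ x, Module.finrank ℝ (nullity k f η x) = s
  parallel : ∀ x, ∀ Z ∈ nullity k f η x, normalDeriv f η x Z = 0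

/-- The smooth immersion `j : L → M` is an integral manifold of the distribution `Δ` on `M`. -/
structure IsIntegralManifold (m : ℕ) {L : Type*} [TopologicalSpace L] [ChartedSpace (Euc m) L]
    (Δ : M → Submodule ℝ (Euc k)) (j : L → M) : Prop where
  smooth : ContMDiff 𝓘(ℝ, Euc m) 𝓘(ℝ, Euc k) ∞ j
  injective : ∀ u, Function.Injective (mfderiv 𝓘(ℝ, Euc m) 𝓘(ℝ, Euc k) j u)
  range_eq : ∀ u, LinearMap.range
    (mfderiv 𝓘(ℝ, Euc m) 𝓘(ℝ, Euc k) j u : Euc m →L[ℝ] Euc k).toLinearMap = Δ (j u)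

/-- The distribution `Δ` of rank `m` on `M` is integrable: through every point there passes an
integral manifold of `Δ`, parametrized by an open subset of `ℝ^m`. -/
def IsIntegrable (m : ℕ) (Δ : M → Submodule ℝ (Euc k)) : Prop :=
  ∀ x : M, ∃ (U : TopologicalSpace.Opens (Euc m)) (g : U → M),
    IsIntegralManifold m Δ g ∧ x ∈ Set.range g

end Immersions

/-! ### The `N`-Ribaucour transformation -/

section Ribaucour

variable {m q : ℕ} {L : Type*} [TopologicalSpace L] [ChartedSpace (Euc m) L]

variable (m) in
/-- The Combescure transform `F = h_* ∇φ + β`. -/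
def combescure (h : L → Euc q) (φ : L → ℝ) (β : L → Euc q) (u : L) : Euc q :=
  differential m h u (gradient m h φ u) + β u

variable (m) in
/-- The set `S(h)` of pairs `(φ, β)`, with `φ` a smooth function and `β` a smooth normal vector
field, such that `α_h(∇φ, X) + ∇^⊥_X β = 0` and `φ F ≠ 0` everywhere, where `F = h_* ∇φ + β`. -/
structure RibaucourPair (h : L → Euc q) where
  φ : L → ℝ
  β : L → Euc q
  smooth_φ : ContMDiff 𝓘(ℝ, Euc m) 𝓘(ℝ, ℝ) ∞ φ
  isSection_β : IsSection m (normalSpace m h) β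
  eqn : ∀ (u : L) (X : Euc m),
    secondFundamentalForm h u (gradient m h φ u) X + normalDeriv h β u X = 0
  φ_ne_zero : ∀ u, φ u ≠ 0
  combescure_ne_zero : ∀ u, combescure m h φ β u ≠ 0

variable (m) in
/-- `(φ, β) ∼ (φ', β')` when `φ' = c φ` and `β' - c β` is a parallel section of `N`, for some real
`c ≠ 0`. -/
def ribaucourSetoid (h : L → Euc q) (N : L → Submodule ℝ (Euc q)) :
    Setoid (RibaucourPair m h) where
  r a b := ∃ c : ℝ, c ≠ 0 ∧ b.φ = c • a.φ ∧ b.β - c • a.β ∈ parallelSections m h N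
  iseqv := by
    refine ⟨fun a => ⟨1, one_ne_zero, by simp, by simp⟩, ?_, ?_⟩
    · rintro a b ⟨c, hc, h1, h2⟩
      refine ⟨c⁻¹, inv_ne_zero hc, by rw [h1, smul_smul, inv_mul_cancel₀ hc, one_smul], ?_⟩
      have := Submodule.smul_mem _ (-c⁻¹) h2
      rw [smul_sub, smul_smul, neg_mul, inv_mul_cancel₀ hc] at this
      convert this using 1
      module
    · rintro a b d ⟨c, hc, h1, h2⟩ ⟨e, he, h3, h4⟩
      refine ⟨e * c, mul_ne_zero he hc, by rw [h3, h1, smul_smul], ?_⟩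
      have := Submodule.add_mem _ h4 (Submodule.smul_mem _ e h2)
      convert this using 1
      module

variable (m) in
/-- The set `S_N(h)` of equivalence classes. -/
def RibaucourClass (h : L → Euc q) (N : L → Submodule ℝ (Euc q)) : Type _ :=
  Quotient (ribaucourSetoid m h N)

variable (m) in
/-- `E^V_δ(u) = {Z : α_h(Z, X)_V = ⟨Z, X⟩ δ for all X}` for a subspace `V` of `ℝ^q`. -/
def relativeNullity (h : L → Euc q) (u : L) (V : Submodule ℝ (Euc q)) (δ : Euc q) : Set (Euc m) :=
  {Z | ∀ X, V.starProjection (secondFundamentalForm h u Z X) = metric h u Z X • δ}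

/-- `β̄ = -φ⁻¹ β_{N^⊥}`, where `N^⊥` is the complement of `N` in the normal bundle. -/
def betaBar {h : L → Euc q} (N : L → Submodule ℝ (Euc q)) (r : RibaucourPair m h) (u : L) : Euc q :=
  -((r.φ u)⁻¹ • (normalCompl m h N u).starProjection (r.β u))

theorem betaBar_eq {h : L → Euc q} (N : L → Submodule ℝ (Euc q)) (a b : RibaucourPair m h)
    (hab : (ribaucourSetoid m h N).r a b) : betaBar N a = betaBar N b := by
  obtain ⟨c, hc, h1, h2⟩ := hab
  funext u
  have h3 : b.β u - c • a.β u ∈ N u := h2.1.mem u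
  have h4 : (normalCompl m h N u).starProjection (b.β u - c • a.β u) = 0 := by
    rw [Submodule.starProjection_apply_eq_zero_iff]
    exact fun v hv => Submodule.inner_left_of_mem_orthogonal h3 hv.1
  rw [map_sub, map_smul, sub_eq_zero] at h4
  have ha := a.φ_ne_zero u
  simp only [betaBar, h1, h4, Pi.smul_apply, smul_eq_mul, smul_smul]
  congr 2
  field_simp

/-- `E(w) = E^{N^⊥}_{β̄}` for a class `w = [(φ, β)]`. -/
def classNullity {h : L → Euc q} {N : L → Submodule ℝ (Euc q)} (w : RibaucourClass m h N) (u : L) :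
    Set (Euc m) :=
  Quotient.lift (fun r : RibaucourPair m h =>
    relativeNullity m h u (normalCompl m h N u) (betaBar N r u))
    (fun a b hab => by simp only [betaBar_eq N a b hab]) w

/-- `F_t = h_* ∇φ + β + t` for the parallel section `t = ∑ yᵢ ξᵢ` of `N`. -/
def shiftedCombescure {h : L → Euc q} (r : RibaucourPair m h) {s : ℕ} (ξ : Fin s → L → Euc q)
    (u : L) (y : Euc s) : Euc q :=
  combescure m h r.φ r.β u + ∑ i, y i • ξ i u

/-- The map `(u, y) ↦ h(u) - 2 φ(u) ‖F_t(u)‖⁻² F_t(u)`, where `t = ∑ yᵢ ξᵢ`, which parametrizes the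
`N`-Ribaucour transform of `h`, given a parallel orthonormal frame `ξ` of `N`. -/
def ribaucourMap {h : L → Euc q} (r : RibaucourPair m h) {s : ℕ} (ξ : Fin s → L → Euc q)
    (u : L) (y : Euc s) : Euc q :=
  h u - (2 * r.φ u * (‖shiftedCombescure r ξ u y‖ ^ 2)⁻¹) • shiftedCombescure r ξ u y

variable (m) in
/-- `f` is, in a neighbourhood of the submanifold `j : L → M`, the `N`-Ribaucour transform of
`h = f ∘ j` determined by `w`, with `h` as the leaf at infinity.

In terms of the inverted parameter `z = y / ‖y‖²`, so that `z = 0` corresponds to `y = ∞`: there is a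
local diffeomorphism `Ψ` from an open neighbourhood `W` of `L × {0}` in `L × ℝ^s` onto an open subset
of `M` with `Ψ(u, 0) = j(u)`, such that `f (Ψ (u, z))` is the value at `(u, z / ‖z‖²)` of the map
parametrizing the `N`-Ribaucour transform, for all `(u, z) ∈ W` with `z ≠ 0`. -/
def IsRibaucourTransformNear (n s : ℕ) {M : Type*} [TopologicalSpace M]
    [ChartedSpace (Euc n) M] (f : M → Euc q) (j : L → M) (N : L → Submodule ℝ (Euc q))
    (w : RibaucourClass m (f ∘ j) N) : Prop :=
  ∃ (r : RibaucourPair m (f ∘ j)) (ξ : Fin s → L → Euc q) (W : Set (L × Euc s)) (Ψ : L × Euc s → M),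
    (Quotient.mk (ribaucourSetoid m (f ∘ j) N) r : RibaucourClass m (f ∘ j) N) = w ∧
    IsParallelFrame m (f ∘ j) N ξ ∧
    IsOpen W ∧
    (∀ u, (u, 0) ∈ W ∧ Ψ (u, 0) = j u) ∧
    IsLocalDiffeomorphOn (𝓘(ℝ, Euc m).prod 𝓘(ℝ, Euc s)) 𝓘(ℝ, Euc n) ∞ Ψ W ∧
    ∀ u z, (u, z) ∈ W → z ≠ 0 →
      shiftedCombescure r ξ u ((‖z‖ ^ 2)⁻¹ • z) ≠ 0 ∧
      f (Ψ (u, z)) = ribaucourMap r ξ u ((‖z‖ ^ 2)⁻¹ • z)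

end Ribaucour

end Submfd

end

/-! Let `τ` be the projection onto the tangent spaces of `f` and `π` the projection onto `f_* E_η`,
both as maps into endomorphisms of Euclidean space. The second fundamental form is then `dτ(X)`
applied to tangent vectors, and everything becomes calculus of vector-valued functions.

The Codazzi equation and the Dupin condition make `E_η` a spherical distribution. Let `H` be the
mean curvature vector of `E_η` in Euclidean space, whose part normal to `f` is `η`. For `Z` in `E_η`
one has `dπ(Z)w = ⟨Z,w⟩H + ⟨H,w⟩Z` and `dH(Z) = -|H|²Z` (`LocalDupin.fderiv_π_eq`,
`LocalDupin.fderiv_meanCurv`). Hence the leaves of `E_η` are open in round spheres or affine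
subspaces, and near `L` the submanifold is the tube `h + 2W/|W|²`, where `W = H + v/|v|²` and `v`
lies in `N` (`DupinFields.exists_lift`, `DupinFields.exists_tube`).

Integrability of the conullity supplies further leaves near `L`. Such a leaf cuts the spheres of the
tube in a section `v` of `N`. Since it is orthogonal to them, `ζ = v/|v|²` satisfies the affine
system `π(dζ(X) + dH(X)) = ⟨H,X⟩ζ` (`DupinFields.exists_leaf_section`). Take `s+1` leaves in general
position. Differences of the `ζ`'s, scaled by `φ = |ζ₁ - ζ₀|⁻¹`, form a local parallel orthonormal
frame of `N`, and `b = -φζ₀` satisfies `dφ = -φ⟨H,·⟩` and `π db = φ π dH`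
(`LeafFields.exists_localFrame`). Flatness of `N` follows, and over a simply connected `L` the
solutions of this linear system are global (`exists_global_frame`).

For `β = b - φη` one finds `F = b - φH`. The pair `(φ, β)` satisfies the Ribaucour equation, has `β̄
= η` and hence `E(w) = 0`, and `h_t` is the inverted parametrization of the tube. `F` vanishes only
where `b` and `H` both do. Subtracting a multiple of a parallel section from `b`, chosen by Sard's
theorem, removes these zeros (`LeafFields.exists_ne_zero`).

For uniqueness, let `(φ, β)` be any pair determining `f`. The second derivative at `z = 0` of a line
in the fibre shows that the part of `β` normal to `f` is `-φη` (`DupinFields.normal_combescure`).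
Because no nonzero vector of the conullity lies in `E_η`, the pair must then come from the linear
system (`LeafFields.isSolAt_of_pair`), whose solutions with `φ ≠ 0` form one class. -/

noncomputable section
namespace Submfd
open Filter Topology Set

/-! ### Smooth dependence of orthogonal projections on ranges and kernels. -/

section LinearAlgebra

variable {A V W X : Type*} [NormedAddCommGroup A] [InnerProductSpace ℝ A] [FiniteDimensional ℝ A] [CompleteSpace A]
  [NormedAddCommGroup V] [InnerProductSpace ℝ V] [FiniteDimensional ℝ V] [CompleteSpace V]
  [NormedAddCommGroup W] [NormedSpace ℝ W] [FiniteDimensional ℝ W] [NormedAddCommGroup X] [NormedSpace ℝ X]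

/-- The Moore–Penrose left inverse `(T† T)⁻¹ T†` of an injective linear map `T`. -/
def pinv (T : A →L[ℝ] V) : V →L[ℝ] A :=
  (T.adjoint ∘L T).inverse ∘L T.adjoint

omit [FiniteDimensional ℝ V] in
theorem exists_equiv_adjoint_comp (T : A →L[ℝ] V) (hT : Function.Injective T) :
    ∃ e : A ≃L[ℝ] A, (e : A →L[ℝ] A) = T.adjoint ∘L T := by
  have hinj : Function.Injective (T.adjoint ∘L T) := by
    rw [injective_iff_map_eq_zero]
    intro v hv
    have h0 : ⟪(T.adjoint ∘L T) v, v⟫ = 0 := by rw [hv, inner_zero_left]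
    rw [ContinuousLinearMap.comp_apply, ContinuousLinearMap.adjoint_inner_left,
      inner_self_eq_zero] at h0
    exact (injective_iff_map_eq_zero T).1 hT v h0
  exact ⟨(LinearEquiv.ofInjectiveEndo (T.adjoint ∘L T).toLinearMap hinj).toContinuousLinearEquiv,
    by ext1 v; rfl⟩

omit [FiniteDimensional ℝ V] in
theorem pinv_apply_self (T : A →L[ℝ] V) (hT : Function.Injective T) (v : A) :
    pinv T (T v) = v := by
  obtain ⟨e, he⟩ := exists_equiv_adjoint_comp T hT
  have : pinv T (T v) = (T.adjoint ∘L T).inverse ((T.adjoint ∘L T) v) := rfl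
  rw [this, ← he, ContinuousLinearMap.inverse_equiv]
  exact e.symm_apply_apply v

-- The normal equation `T†T x = T†w` says exactly that `w - T x` is orthogonal to the range.
omit [FiniteDimensional ℝ V] in
theorem apply_pinv (T : A →L[ℝ] V) (hT : Function.Injective T) (w : V) :
    T (pinv T w) = (LinearMap.range T.toLinearMap).starProjection w := by
  obtain ⟨e, he⟩ := exists_equiv_adjoint_comp T hT
  refine (Submodule.eq_starProjection_of_mem_orthogonal (LinearMap.mem_range_self _ _) ?_).symm
  rw [Submodule.mem_orthogonal]
  rintro _ ⟨u, rfl⟩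
  have h1 : (T.adjoint ∘L T) (pinv T w) = T.adjoint w := by
    have h3 : pinv T w = e.symm (T.adjoint w) := by
      rw [pinv, ContinuousLinearMap.comp_apply, ← he, ContinuousLinearMap.inverse_equiv]; rfl
    rw [h3, ← he]; exact e.apply_symm_apply _
  have h2 : T.adjoint (w - T (pinv T w)) = 0 := by
    rw [map_sub, ← h1]; simp
  rw [ContinuousLinearMap.coe_coe, ← ContinuousLinearMap.adjoint_inner_right, h2, inner_zero_right]

omit [FiniteDimensional ℝ V] in
theorem _root_.ContDiffAt.pinv {T : X → A →L[ℝ] V} {x : X} {k : WithTop ℕ∞}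
    (hT : ContDiffAt ℝ k T x) (hi : Function.Injective (T x)) :
    ContDiffAt ℝ k (fun y => pinv (T y)) x := by
  obtain ⟨e, he⟩ := exists_equiv_adjoint_comp (T x) hi
  have h1 : ContDiffAt ℝ k (fun y => (T y).adjoint) x :=
    ((ContinuousLinearMap.adjoint (𝕜 := ℝ) (E := A) (F := V)).toContinuousLinearEquiv.contDiff
      (n := k)).contDiffAt.comp x hT
  have h2 : ContDiffAt ℝ k (fun y => (T y).adjoint ∘L T y) x := h1.clm_comp hT
  have h3 : ContDiffAt ℝ k (ContinuousLinearMap.inverse : (A →L[ℝ] A) → A →L[ℝ] A)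
      ((T x).adjoint ∘L T x) := by
    rw [← he]; exact contDiffAt_map_inverse e
  exact (h3.comp x h2).clm_comp h1

omit [FiniteDimensional ℝ V] in
/-- Smoothness of the orthogonal projection onto the range of a smooth family of injective maps. -/
theorem _root_.ContDiffAt.starProjection_range {T : X → A →L[ℝ] V} {x : X} {k : WithTop ℕ∞}
    (hT : ContDiffAt ℝ k T x) (hi : ∀ᶠ y in 𝓝 x, Function.Injective (T y)) :
    ContDiffAt ℝ k (fun y => (LinearMap.range (T y).toLinearMap).starProjection) x := by
  refine (hT.clm_comp (hT.pinv hi.self_of_nhds)).congr_of_eventuallyEq ?_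
  filter_upwards [hi] with y hy
  ext1 w
  exact (apply_pinv _ hy w).symm

/-- Smoothness of the orthogonal projection onto the kernel of a smooth family of linear maps of
constant rank. -/
theorem _root_.ContDiffAt.starProjection_ker {T : X → V →L[ℝ] W} {x : X} {k : WithTop ℕ∞} {s : ℕ}
    (hT : ContDiffAt ℝ k T x) (K : X → Submodule ℝ V)
    (hK : ∀ᶠ y in 𝓝 x, K y = LinearMap.ker (T y).toLinearMap)
    (hs : ∀ᶠ y in 𝓝 x, Module.finrank ℝ (K y) = s) :
    ContDiffAt ℝ k (fun y => (K y).starProjection) x := by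
  set K0 := K x with hK0
  have hK0' : K0 = LinearMap.ker (T x).toLinearMap := hK.self_of_nhds
  -- a linear map `R` with `R (T x v) = v - P v`, `P` the projection to the kernel
  obtain ⟨R, hR⟩ : ∃ R : W →L[ℝ] V, ∀ v, R (T x v) = v - K0.starProjection v := by
    have hinj : LinearMap.ker ((T x).toLinearMap.domRestrict K0ᗮ) = ⊥ := by
      rw [LinearMap.ker_eq_bot']
      rintro ⟨v, hv⟩ h
      have : v ∈ K0 := by rw [hK0']; exact h
      have := Submodule.inner_right_of_mem_orthogonal this hv
      rw [inner_self_eq_zero] at this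
      exact Subtype.ext this
    obtain ⟨R0, hR0⟩ := LinearMap.exists_leftInverse_of_injective _ hinj
    refine ⟨LinearMap.toContinuousLinearMap (K0ᗮ.subtype ∘ₗ R0), fun v => ?_⟩
    have h1 : v - K0.starProjection v ∈ K0ᗮ := K0.sub_starProjection_mem_orthogonal v
    have h2 : T x v = T x (v - K0.starProjection v) := by
      have : K0.starProjection v ∈ LinearMap.ker (T x).toLinearMap := by
        rw [← hK0']; exact K0.starProjection_apply_mem v
      rw [map_sub, show T x (K0.starProjection v) = 0 from this, sub_zero]
    have h3 := congrArg (fun z : K0ᗮ => (z : V)) (LinearMap.congr_fun hR0 ⟨_, h1⟩)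
    rw [h2]
    exact h3
  -- `C x` is the identity, so `C y` is invertible for `y` near `x`. On `ker (T y)` it is the
  -- projection to `K0`, so `(C y)⁻¹ K0` contains that kernel, and equals it because the ranks
  -- agree.
  set C : X → V →L[ℝ] V := fun y => R ∘L T y + K0.starProjection with hC
  have hCx : C x = ContinuousLinearMap.id ℝ V := by
    ext1 v; simp [hC, hR]
  have hCs : ContDiffAt ℝ k C x := (contDiffAt_const.clm_comp hT).add contDiffAt_const
  have hCe : ∀ᶠ y in 𝓝 x, ∃ e : V ≃L[ℝ] V, (e : V →L[ℝ] V) = C y := by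
    have := hCs.continuousAt.preimage_mem_nhds
      (t := Set.range ((↑) : (V ≃L[ℝ] V) → (V →L[ℝ] V)))
      (by rw [hCx]; exact (ContinuousLinearEquiv.refl ℝ V).nhds)
    exact this
  have hCi : ContDiffAt ℝ k (fun y => (C y).inverse) x := by
    have h3 : ContDiffAt ℝ k (ContinuousLinearMap.inverse : (V →L[ℝ] V) → V →L[ℝ] V) (C x) := by
      rw [hCx]; exact contDiffAt_map_inverse (ContinuousLinearEquiv.refl ℝ V)
    exact h3.comp x hCs
  have hTs : ContDiffAt ℝ k (fun y => (C y).inverse ∘L K0.subtypeL) x := hCi.clm_comp contDiffAt_const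
  have hTi : ∀ᶠ y in 𝓝 x, Function.Injective ((C y).inverse ∘L K0.subtypeL) := by
    filter_upwards [hCe] with y ⟨e, he⟩
    rw [← he, ContinuousLinearMap.inverse_equiv]
    exact e.symm.injective.comp Subtype.val_injective
  refine (hTs.starProjection_range hTi).congr_of_eventuallyEq ?_
  filter_upwards [hCe, hTi, hK, hs] with y ⟨e, he⟩ hi hKy hsy
  have hle : K y ≤ LinearMap.range ((C y).inverse ∘L K0.subtypeL).toLinearMap := by
    intro z hz
    have hz' : T y z = 0 := by rw [hKy] at hz; exact hz
    refine ⟨⟨K0.starProjection z, K0.starProjection_apply_mem z⟩, ?_⟩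
    have : C y z = K0.starProjection z := by simp [hC, hz']
    have h4 : (C y).inverse (C y z) = z := by
      rw [← he, ContinuousLinearMap.inverse_equiv]; exact e.symm_apply_apply z
    rw [this] at h4
    exact h4
  congr 1
  refine Submodule.eq_of_le_of_finrank_eq hle ?_
  rw [LinearMap.finrank_range_of_inj hi, hsy]
  exact hs.self_of_nhds.symm

end LinearAlgebra
end Submfd

end

noncomputable section
namespace Submfd
open Filter Topology Set

/-! ### Invariance of a retract under a differential equation. -/

section Gronwall

variable {V T : Type*} [NormedAddCommGroup V] [NormedSpace ℝ V] [NormedAddCommGroup T]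
  [NormedSpace ℝ T]

/-- Let `Γ` be a map whose first component is a retraction onto a set, invariant under the fields
`w ↦ (Q (w, S) v, 0)`. A curve `(c, S₁)` with `c' = Q (c, S₁) c'` that starts in the image of `Γ`
remains in it. -/
theorem exists_nhds_forall_curve_eq (Γ : V → V × T) (w₀ : V) (S₀ : T) (hΓ : ContDiffAt ℝ 2 Γ w₀)
    (hΓ₀ : Γ w₀ = (w₀, S₀)) (Q : V × T → V →L[ℝ] V) (hQ : ContDiffAt ℝ 1 Q (w₀, S₀))
    (hinv : ∀ᶠ w in 𝓝 w₀, ∀ v, fderiv ℝ Γ (Γ w).1 (Q (Γ w) v) = (Q (Γ w) v, 0)) :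
    ∃ O ∈ 𝓝 (w₀, S₀), ∀ (c c' : ℝ → V) (S₁ : T) (B : ℝ),
      (∀ t ∈ Icc (0 : ℝ) 1, HasDerivAt c (c' t) t) → (∀ t ∈ Icc (0 : ℝ) 1, ‖c' t‖ ≤ B) →
      (∀ t ∈ Icc (0 : ℝ) 1, (c t, S₁) ∈ O) → (∀ t ∈ Icc (0 : ℝ) 1, Q (c t, S₁) (c' t) = c' t) →
      Γ (c 0) = (c 0, S₁) → ∀ t ∈ Icc (0 : ℝ) 1, Γ (c t) = (c t, S₁) := by
  -- `Y` measures the failure of invariance. It is Lipschitz near the base point and vanishes at the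
  -- points `Γ w`, so its size at `(c, S₁)` is controlled by the distance from `(c, S₁)` to `Γ c`.
  set Y : V × T → V →L[ℝ] V × T :=
    fun p => fderiv ℝ Γ p.1 ∘L Q p - ContinuousLinearMap.inl ℝ V T ∘L Q p with hY
  have hΓ' : ContDiffAt ℝ 1 (fderiv ℝ Γ) w₀ := hΓ.fderiv_right (by norm_num)
  have hYs : ContDiffAt ℝ 1 Y (w₀, S₀) := by
    have h1 : ContDiffAt ℝ 1 (fun p : V × T => fderiv ℝ Γ p.1) (w₀, S₀) :=
      ContDiffAt.comp (w₀, S₀) (g := fderiv ℝ Γ) hΓ' contDiffAt_fst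
    exact (h1.clm_comp hQ).sub (contDiffAt_const.clm_comp hQ)
  obtain ⟨K, s, hs, hK⟩ := hYs.exists_lipschitzOnWith
  have hd : ∀ᶠ w in 𝓝 w₀, DifferentiableAt ℝ Γ w := by
    filter_upwards [hΓ.eventually (by simp)] with w hw using hw.differentiableAt (by simp)
  have hs' : ∀ᶠ w in 𝓝 w₀, Γ w ∈ s := hΓ.continuousAt.preimage_mem_nhds (by rw [hΓ₀]; exact hs)
  have hO : ∀ᶠ p in 𝓝 (w₀, S₀), p ∈ s ∧ (Γ p.1 ∈ s ∧ DifferentiableAt ℝ Γ p.1 ∧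
      ∀ v, fderiv ℝ Γ (Γ p.1).1 (Q (Γ p.1) v) = (Q (Γ p.1) v, 0)) :=
    (show ∀ᶠ p in 𝓝 (w₀, S₀), p ∈ s from hs).and
      ((continuous_fst.tendsto (w₀, S₀)).eventually (hs'.and (hd.and hinv)))
  refine ⟨_, hO, fun c c' S₁ B hc hB hcO hQc h0 => ?_⟩
  -- Grönwall: the derivative of this difference is `Y (c, S₁) c'`, of norm at most `K * B` times
  -- the difference, which vanishes at `t = 0`.
  have key : ∀ t ∈ Icc (0 : ℝ) 1, Γ (c t) - (c t, S₁) = 0 := by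
    refine eq_zero_of_abs_deriv_le_mul_abs_self_of_eq_zero_right
      (f' := fun t => Y (c t, S₁) (c' t)) (K := K * B) ?_ ?_ (by rw [h0, sub_self]) ?_
    · intro t ht
      exact ((ContinuousAt.comp (g := Γ) (f := c) (hcO t ht).2.2.1.continuousAt (hc t ht).continuousAt).sub
        ((hc t ht).continuousAt.prodMk continuousAt_const)).continuousWithinAt
    · intro t ht
      have ht' := Ico_subset_Icc_self ht
      have h1 := (hcO t ht').2.2.1.hasFDerivAt.comp_hasDerivAt t (hc t ht')
      have h2 := (hc t ht').prodMk (hasDerivAt_const t S₁)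
      have h3 := (h1.sub h2).hasDerivWithinAt (s := Ici t)
      have h4 : Y (c t, S₁) (c' t) = fderiv ℝ Γ (c t) (c' t) - (c' t, 0) := by
        change fderiv ℝ Γ (c t) (Q (c t, S₁) (c' t)) - (Q (c t, S₁) (c' t), (0 : T)) = _
        rw [hQc t ht']
      rw [h4]
      exact h3
    · intro t ht
      have ht' := Ico_subset_Icc_self ht
      obtain ⟨hm, hm', -, hz⟩ := hcO t ht'
      have hz' : Y (Γ (c t)) = 0 := by
        ext1 v
        simp only [hY, sub_apply, ContinuousLinearMap.comp_apply]
        rw [hz v]; simp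
      have h4 := hK.dist_le_mul _ hm _ hm'
      rw [hz', dist_zero_right, dist_comm, dist_eq_norm] at h4
      calc ‖Y (c t, S₁) (c' t)‖ ≤ ‖Y (c t, S₁)‖ * ‖c' t‖ := ContinuousLinearMap.le_opNorm _ _
        _ ≤ (K * ‖Γ (c t) - (c t, S₁)‖) * B :=
          mul_le_mul h4 (hB t ht') (norm_nonneg _) (by positivity)
        _ = _ := by ring
  exact fun t ht => sub_eq_zero.1 (key t ht)

end Gronwall

/-! ### Sard's theorem: points where many derivatives vanish. -/

section Sard

open MeasureTheory

universe u

variable {E F : Type u} [NormedAddCommGroup E] [NormedSpace ℝ E] [NormedAddCommGroup F]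
  [NormedSpace ℝ F]

/-- A Taylor estimate by induction on `k`: the bound of one order less holds for the derivative, and
the mean value inequality on the segment from `x` to `y` gains one power. -/
theorem norm_le_pow_of_iteratedFDeriv_eq_zero {x : E} {r K : ℝ} (k : ℕ) (f : E → F)
    (hf : ∀ y ∈ Metric.ball x r, ContDiffAt ℝ ∞ f y) (h0 : ∀ i ≤ k, iteratedFDeriv ℝ i f x = 0)
    (hK : ∀ y ∈ Metric.ball x r, ‖iteratedFDeriv ℝ (k + 1) f y‖ ≤ K) :
    ∀ y ∈ Metric.ball x r, ‖f y‖ ≤ K * ‖y - x‖ ^ (k + 1) := by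
  induction k generalizing F with
  | zero =>
    intro y hy
    have hfx : f x = 0 := by
      have := congrArg (fun g => g 0) (h0 0 le_rfl)
      simpa using this
    have h1 := (convex_ball x r).norm_image_sub_le_of_norm_fderiv_le (𝕜 := ℝ) (f := f) (C := K)
      (fun z hz => (hf z hz).differentiableAt (by simp))
      (fun z hz => by have := hK z hz; rwa [zero_add, norm_iteratedFDeriv_one] at this)
      (Metric.mem_ball_self (Metric.pos_of_mem_ball hy)) hy
    simpa [hfx] using h1
  | succ k ih =>
    intro y hy
    have hr := Metric.pos_of_mem_ball hy
    have hfx : f x = 0 := by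
      have := congrArg (fun g => g 0) (h0 0 (Nat.zero_le _))
      simpa using this
    have ih' := ih (fderiv ℝ f) (fun z hz => (hf z hz).fderiv_right (by simp))
      (fun i hi => by
        rw [← norm_eq_zero, norm_iteratedFDeriv_fderiv, h0 (i + 1) (by omega), norm_zero])
      (fun z hz => by rw [norm_iteratedFDeriv_fderiv]; exact hK z hz)
    have hK0 : 0 ≤ K := (norm_nonneg _).trans (hK y hy)
    have hseg : ∀ z ∈ segment ℝ x y, z ∈ Metric.ball x r ∧ ‖z - x‖ ≤ ‖y - x‖ := by
      intro z hz
      refine ⟨(convex_ball x r).segment_subset (Metric.mem_ball_self hr) hy hz, ?_⟩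
      obtain ⟨t, ⟨ht0, ht1⟩, rfl⟩ := segment_eq_image' ℝ x y ▸ hz
      rw [add_sub_cancel_left, norm_smul, Real.norm_of_nonneg ht0]
      exact mul_le_of_le_one_left (norm_nonneg _) ht1
    have h1 := (convex_segment x y).norm_image_sub_le_of_norm_fderiv_le (𝕜 := ℝ) (f := f)
      (C := K * ‖y - x‖ ^ (k + 1))
      (fun z hz => (hf z (hseg z hz).1).differentiableAt (by simp))
      (fun z hz => (ih' z (hseg z hz).1).trans (by gcongr; exact (hseg z hz).2))
      (left_mem_segment ℝ x y) (right_mem_segment ℝ x y)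
    rw [hfx, sub_zero, mul_assoc, ← pow_succ] at h1
    exact h1

/-- The image of the points at which the derivatives of order `1, …, dim E` vanish is null. -/
theorem exists_nhds_volume_image_eq_zero {E : Type} [NormedAddCommGroup E] [NormedSpace ℝ E]
    [FiniteDimensional ℝ E] (f : E → ℝ) (x₀ : E)
    (hf : ∀ᶠ x in 𝓝 x₀, ContDiffAt ℝ ∞ f x) (k : ℕ) (hk : Module.finrank ℝ E ≤ k) :
    ∃ U ∈ 𝓝 x₀, volume (f '' {x ∈ U | ∀ i, 1 ≤ i → i ≤ k → iteratedFDeriv ℝ i f x = 0}) = 0 := by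
  obtain ⟨r, hr, hball⟩ := Metric.eventually_nhds_iff_ball.1 hf
  have hcont : ContinuousAt (fun x => iteratedFDeriv ℝ (k + 1) f x) x₀ :=
    ((hf.self_of_nhds).iteratedFDeriv_right (m := 0) (i := k + 1) (by
      exact_mod_cast le_top)).continuousAt
  obtain ⟨r', hr', hball'⟩ := Metric.eventually_nhds_iff_ball.1
    (hcont.norm.eventually (gt_mem_nhds (lt_add_one ‖iteratedFDeriv ℝ (k + 1) f x₀‖)))
  set K := ‖iteratedFDeriv ℝ (k + 1) f x₀‖ + 1
  -- A third of the radius: balls of radius `2ρ` about points of the `ρ`-ball stay inside the ball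
  -- of radius `min r r'`, and they contain the whole `ρ`-ball.
  set ρ := min r r' / 3 with hρ
  have hρ0 : 0 < ρ := by positivity
  refine ⟨Metric.ball x₀ ρ, Metric.ball_mem_nhds _ hρ0, ?_⟩
  set s := {x ∈ Metric.ball x₀ ρ | ∀ i, 1 ≤ i → i ≤ k → iteratedFDeriv ℝ i f x = 0}
  have hK0 : 0 ≤ K := by positivity
  -- Hölder continuity of exponent `k + 1` divides Hausdorff dimension by `k + 1`, so the image has
  -- dimension at most `dim E / (k + 1) < 1`.
  have hH : HolderOnWith K.toNNReal ((k + 1 : ℕ) : NNReal) f s := by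
    intro x hx y hy
    have hsub : Metric.ball x (2 * ρ) ⊆ Metric.ball x₀ (min r r') := by
      refine Metric.ball_subset_ball' ?_
      have := Metric.mem_ball.1 hx.1
      linarith
    have hsub1 := hsub.trans (Metric.ball_subset_ball (min_le_left _ _))
    have hsub2 := hsub.trans (Metric.ball_subset_ball (min_le_right _ _))
    have h1 := norm_le_pow_of_iteratedFDeriv_eq_zero (x := x) (r := 2 * ρ) (K := K) k
      (fun z => f z - f x)
      (fun z hz => (hball z (hsub1 hz)).sub contDiffAt_const)
      (fun i hi => by
        rcases Nat.eq_zero_or_pos i with rfl | hi0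
        · ext m; simp
        · have : iteratedFDeriv ℝ i (fun z => f z - f x) x = iteratedFDeriv ℝ i f x := by
            have hh := iteratedFDeriv_sub_apply (𝕜 := ℝ) (i := i) (f := f) (g := fun _ => f x) (x := x)
              ((hball x (hsub1 (Metric.mem_ball_self (by positivity)))).of_le
                (by exact_mod_cast le_top)) contDiffAt_const
            rw [iteratedFDeriv_const_of_ne (by omega)] at hh
            simpa [Pi.sub_def] using hh
          rw [this]; exact hx.2 i hi0 hi)
      (fun z hz => by
        have : iteratedFDeriv ℝ (k + 1) (fun z => f z - f x) z = iteratedFDeriv ℝ (k + 1) f z := by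
          have hh := iteratedFDeriv_sub_apply (𝕜 := ℝ) (i := k + 1) (f := f) (g := fun _ => f x)
            (x := z) ((hball z (hsub1 hz)).of_le (by exact_mod_cast le_top)) contDiffAt_const
          rw [iteratedFDeriv_const_of_ne (by omega)] at hh
          simpa [Pi.sub_def] using hh
        rw [this]; exact (hball' z (hsub2 hz)).le) y (by
          rw [Metric.mem_ball]
          have h1 := Metric.mem_ball.1 hx.1
          have h2 := Metric.mem_ball.1 hy.1
          rw [dist_comm] at h1
          linarith [dist_triangle y x₀ x])
    rw [edist_comm, edist_comm x y, edist_dist, edist_dist, Real.dist_eq, ← Real.norm_eq_abs,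
      dist_eq_norm]
    have h3 : (((k + 1 : ℕ) : NNReal) : ℝ) = ((k + 1 : ℕ) : ℝ) := by simp
    rw [h3, ENNReal.rpow_natCast, ← ENNReal.ofReal_pow (norm_nonneg _)]
    change _ ≤ ENNReal.ofReal K * _
    rw [← ENNReal.ofReal_mul hK0]
    exact ENNReal.ofReal_le_ofReal h1
  have h5 := hH.dimH_image_le (by exact_mod_cast Nat.succ_pos k)
  have h6 : dimH s ≤ Module.finrank ℝ E := by
    rw [← Real.dimH_univ_eq_finrank E]; exact dimH_mono (subset_univ _)
  have h7 : dimH (f '' s) < 1 := by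
    refine h5.trans_lt ?_
    rw [ENNReal.div_lt_iff (by left; simp) (by left; simp)]
    refine h6.trans_lt ?_
    rw [one_mul]
    have : Module.finrank ℝ E < k + 1 := by omega
    exact_mod_cast this
  rw [← hausdorffMeasure_real]
  have := hausdorffMeasure_of_dimH_lt (s := f '' s) (d := 1) (by exact_mod_cast h7)
  exact_mod_cast this

end Sard
end Submfd

end

noncomputable section
namespace Submfd
open Filter Topology Set

/-! ### The smooth inverse function theorem in normed spaces. -/

section InverseFunction

variable {E F : Type*} [NormedAddCommGroup E] [NormedSpace ℝ E] [CompleteSpace E]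
  [NormedAddCommGroup F] [NormedSpace ℝ F]

/-- The smooth inverse function theorem, with smoothness on neighbourhoods. -/
theorem exists_openPartialHomeomorph_contDiffOn {f : E → F} {x : E}
    (hf : ∀ᶠ y in 𝓝 x, ContDiffAt ℝ ∞ f y) (f' : E ≃L[ℝ] F)
    (hf' : HasFDerivAt f (f' : E →L[ℝ] F) x) :
    ∃ Φ : OpenPartialHomeomorph E F, x ∈ Φ.source ∧ ⇑Φ = f ∧ ContDiffOn ℝ ∞ Φ Φ.source ∧
      ContDiffOn ℝ ∞ Φ.symm Φ.target := by
  have hx := hf.self_of_nhds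
  have hinv : ∀ᶠ y in 𝓝 x, ∃ e : E ≃L[ℝ] F, (e : E →L[ℝ] F) = fderiv ℝ f y := by
    have hc : ContinuousAt (fderiv ℝ f) x := (hx.fderiv_right (m := 0) (by simp)).continuousAt
    exact hc.preimage_mem_nhds (by rw [hf'.fderiv]; exact f'.nhds)
  obtain ⟨O, hO, hOo, hxO⟩ := eventually_nhds_iff.1 (hf.and hinv)
  -- On `O` the map is smooth with invertible derivative at every point, which makes the inverse
  -- smooth on the whole target.
  let Φ := (hx.toOpenPartialHomeomorph f hf' (by simp)).restrOpen O hOo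
  have hΦ : ⇑Φ = f := rfl
  have hsrc : Φ.source ⊆ O := fun y hy => hy.2
  refine ⟨Φ, ⟨hx.mem_toOpenPartialHomeomorph_source hf' (by simp), hxO⟩, hΦ,
    fun y hy => ((hO y (hsrc hy)).1).contDiffWithinAt, fun z hz => ?_⟩
  have hm := Φ.map_target hz
  obtain ⟨h1, e, he⟩ := hO _ (hsrc hm)
  refine (Φ.contDiffAt_symm hz (f₀' := e) ?_ h1).contDiffWithinAt
  rw [he]
  exact (h1.differentiableAt (by simp)).hasFDerivAt

end InverseFunction

/-! ### Sard's theorem: induction on the dimension and regular values. -/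

section Sard

open MeasureTheory

/-- The zero set of `g` is a hypersurface near `x`, parametrized by the `m`-dimensional kernel of
`dg`. A critical point of `f` on it is critical for the restriction of `f`, so the statement in
dimension `m` applies. -/
theorem exists_nhds_volume_image_hypersurface {E : Type} [NormedAddCommGroup E] [NormedSpace ℝ E]
    [FiniteDimensional ℝ E] (m : ℕ) (hm : Module.finrank ℝ E = m + 1)
    (ih : ∀ (K : Type) [NormedAddCommGroup K] [NormedSpace ℝ K] [FiniteDimensional ℝ K],
      Module.finrank ℝ K = m → ∀ (f : K → ℝ) (x : K), (∀ᶠ y in 𝓝 x, ContDiffAt ℝ ∞ f y) →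
        ∃ U ∈ 𝓝 x, volume (f '' {y ∈ U | fderiv ℝ f y = 0}) = 0)
    (f g : E → ℝ) (x : E) (hf : ∀ᶠ y in 𝓝 x, ContDiffAt ℝ ∞ f y)
    (hg : ∀ᶠ y in 𝓝 x, ContDiffAt ℝ ∞ g y) (hgx : g x = 0) (hg' : fderiv ℝ g x ≠ 0) :
    ∃ U ∈ 𝓝 x, volume (f '' {y ∈ U | fderiv ℝ f y = 0 ∧ g y = 0}) = 0 := by
  have := FiniteDimensional.complete ℝ E
  set ℓ := fderiv ℝ g x with hℓ
  obtain ⟨e, he⟩ : ∃ e, ℓ e = 1 := by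
    obtain ⟨v, hv⟩ : ∃ v, ℓ v ≠ 0 := by
      by_contra! h
      exact hg' (ContinuousLinearMap.ext h)
    exact ⟨(ℓ v)⁻¹ • v, by simp [hv]⟩
  let K := LinearMap.ker ℓ.toLinearMap
  have hK : Module.finrank ℝ K = m := by
    have h1 := LinearMap.finrank_range_add_finrank_ker ℓ.toLinearMap
    have h2 : LinearMap.range ℓ.toLinearMap = ⊤ :=
      LinearMap.range_eq_top.2 fun r => ⟨r • e, by simp [he]⟩
    rw [h2, finrank_top, Module.finrank_self, hm] at h1
    change Module.finrank ℝ (LinearMap.ker ℓ.toLinearMap) = m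
    omega
  let pr : E →L[ℝ] K := (ContinuousLinearMap.id ℝ E - ℓ.smulRight e).codRestrict K (fun v => by
    simp [K, he])
  have hpr : ∀ v, ((pr v : K) : E) = v - ℓ v • e := fun v => rfl
  let D : E ≃L[ℝ] ℝ × K := ContinuousLinearEquiv.equivOfInverse (ℓ.prod pr)
    ((ContinuousLinearMap.fst ℝ ℝ K).smulRight e + K.subtypeL ∘L ContinuousLinearMap.snd ℝ ℝ K)
    (fun v => by simp [hpr])
    (fun ⟨t, k⟩ => by
      have hk : ℓ k = 0 := k.2
      refine Prod.ext ?_ (Subtype.ext ?_)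
      · simp [he, hk]
      · simp [hpr, he, hk])
  -- The coordinates `(g, pr)` straighten the hypersurface `g = 0`; `σ` below is its parametrization
  -- by `K`.
  obtain ⟨Φ, hxΦ, hΦ, hΦs, hΦt⟩ := exists_openPartialHomeomorph_contDiffOn
    (f := fun y => (g y, pr y)) (x := x)
    (by filter_upwards [hg] with y hy using hy.prodMk pr.contDiff.contDiffAt) D
    (((hg.self_of_nhds.differentiableAt (by simp)).hasFDerivAt).prodMk pr.hasFDerivAt)
  have hΦx : Φ x = (0, pr x) := by rw [hΦ]; exact Prod.ext hgx rfl
  have hxt : ((0 : ℝ), pr x) ∈ Φ.target := hΦx ▸ Φ.map_source hxΦ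
  have hback : Φ.symm (0, pr x) = x := by rw [← hΦx]; exact Φ.left_inv hxΦ
  set σ : K → E := fun k => Φ.symm (0, k) with hσ
  have hσs : ∀ k, ((0 : ℝ), k) ∈ Φ.target → ContDiffAt ℝ ∞ σ k := fun k hk =>
    ContDiffAt.comp k (g := Φ.symm) ((hΦt _ hk).contDiffAt (Φ.open_target.mem_nhds hk))
      (contDiffAt_const.prodMk contDiffAt_id)
  have hev : ∀ᶠ k in 𝓝 (pr x), ((0 : ℝ), k) ∈ Φ.target :=
    (Continuous.prodMk_right (0 : ℝ)).continuousAt.preimage_mem_nhds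
      (Φ.open_target.mem_nhds hxt)
  have hσx : Tendsto σ (𝓝 (pr x)) (𝓝 x) := by
    have := (hσs _ hxt).continuousAt.tendsto
    rwa [show σ (pr x) = x from hback] at this
  obtain ⟨U, hU, hU0⟩ := ih K hK (f ∘ σ) (pr x) (by
    filter_upwards [hev, hσx.eventually hf] with k hk hk' using hk'.comp k (hσs k hk))
  have hV : ∀ᶠ y in 𝓝 x, y ∈ Φ.source ∧ pr y ∈ U ∧ ContDiffAt ℝ ∞ f y :=
    (show ∀ᶠ y in 𝓝 x, y ∈ Φ.source from Φ.open_source.mem_nhds hxΦ).and ((show ∀ᶠ y in 𝓝 x, pr y ∈ U from pr.continuous.continuousAt.preimage_mem_nhds hU).and hf)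
  refine ⟨_, hV, measure_mono_null ?_ hU0⟩
  rintro _ ⟨y, ⟨⟨hy1, hy2, hy3⟩, hy4, hy5⟩, rfl⟩
  have h1 : Φ y = (0, pr y) := by rw [hΦ]; exact Prod.ext hy5 rfl
  have h2 : σ (pr y) = y := by rw [hσ]; change Φ.symm (0, pr y) = y; rw [← h1]; exact Φ.left_inv hy1
  refine ⟨pr y, ⟨hy2, ?_⟩, by rw [Function.comp_apply, h2]⟩
  have h3 := hσs (pr y) (h1 ▸ Φ.map_source hy1)
  rw [fderiv_comp _ (by rw [h2]; exact hy3.differentiableAt (by simp))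
    (h3.differentiableAt (by simp)), h2, hy4, ContinuousLinearMap.zero_comp]

/-- Sard's theorem for real-valued smooth functions, local form. -/
theorem exists_nhds_volume_image_critical_eq_zero (m : ℕ) : ∀ (E : Type) [NormedAddCommGroup E]
    [NormedSpace ℝ E] [FiniteDimensional ℝ E], Module.finrank ℝ E = m → ∀ (f : E → ℝ) (x : E),
      (∀ᶠ y in 𝓝 x, ContDiffAt ℝ ∞ f y) →
        ∃ U ∈ 𝓝 x, volume (f '' {y ∈ U | fderiv ℝ f y = 0}) = 0 := by
  induction m with
  | zero =>
    intro E _ _ _ hE f x hf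
    obtain ⟨U, hU, h0⟩ := exists_nhds_volume_image_eq_zero f x hf 0 hE.le
    refine ⟨U, hU, measure_mono_null (Set.image_mono (f := f) ?_) h0⟩
    exact fun y hy => ⟨hy.1, fun i h1 h2 => by omega⟩
  | succ m ih =>
    intro E _ _ _ hE f
    -- The order of flatness `m + 1 - d` decreases as `d` grows: `d = 0` is the Hölder estimate at
    -- order `dim E`, and `d = m` leaves only the vanishing of the first derivative.
    have main : ∀ d, d ≤ m → ∀ x, (∀ᶠ y in 𝓝 x, ContDiffAt ℝ ∞ f y) → ∃ U ∈ 𝓝 x, volume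
        (f '' {y ∈ U | ∀ i, 1 ≤ i → i ≤ m + 1 - d → iteratedFDeriv ℝ i f y = 0}) = 0 := by
      intro d
      induction d with
      | zero => exact fun _ x hf => exists_nhds_volume_image_eq_zero f x hf (m + 1) hE.le
      | succ d ihd =>
        intro hd x hf
        obtain ⟨U, hU, hU0⟩ := ihd (by omega) x hf
        set k := m + 1 - (d + 1) with hk
        have hk1 : m + 1 - d = k + 1 := by omega
        have hk0 : 1 ≤ k := by omega
        -- At a point flat to order exactly `k`, some component `g` of the `k`-th derivative
        -- vanishes with nonzero differential. Nearby points flat to order `k` lie on the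
        -- hypersurface `g = 0`, where the induction on dimension applies.
        set S := {y | ContDiffAt ℝ ∞ f y ∧ (∀ i, 1 ≤ i → i ≤ k → iteratedFDeriv ℝ i f y = 0) ∧
          iteratedFDeriv ℝ (k + 1) f y ≠ 0} with hS
        obtain ⟨O, hO, hOo, hxO⟩ := eventually_nhds_iff.1 hf
        have hloc : ∀ y ∈ S ∩ O, ∃ V ∈ 𝓝 y, volume (f '' {z ∈ V |
            ∀ i, 1 ≤ i → i ≤ k → iteratedFDeriv ℝ i f z = 0}) = 0 := by
          rintro y ⟨⟨-, hy0, hy1⟩, hyO⟩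
          have hfy : ∀ᶠ z in 𝓝 y, ContDiffAt ℝ ∞ f z :=
            eventually_of_mem (hOo.mem_nhds hyO) hO
          obtain ⟨v, hv⟩ : ∃ v : Fin (k + 1) → E, iteratedFDeriv ℝ (k + 1) f y v ≠ 0 := by
            by_contra! h
            exact hy1 (ContinuousMultilinearMap.ext h)
          set g : E → ℝ := fun z => iteratedFDeriv ℝ k f z (Fin.tail v) with hg
          have hgs : ∀ z, ContDiffAt ℝ ∞ f z → ContDiffAt ℝ ∞ g z := fun z hz =>
            (ContinuousMultilinearMap.apply ℝ (fun _ : Fin k => E) ℝ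
              (Fin.tail v)).contDiff.contDiffAt.comp z
              (hz.iteratedFDeriv_right (m := ∞) (i := k)
                (by exact_mod_cast (le_top : ((⊤ : ℕ∞) + k) ≤ ⊤)))
          have hgy : fderiv ℝ g y (v 0) = iteratedFDeriv ℝ (k + 1) f y v := by
            rw [iteratedFDeriv_succ_apply_left]
            have hdf : DifferentiableAt ℝ (iteratedFDeriv ℝ k f) y :=
              (hfy.self_of_nhds.iteratedFDeriv_right (m := ∞) (i := k)
                (by exact_mod_cast (le_top : ((⊤ : ℕ∞) + k) ≤ ⊤))).differentiableAt (by simp)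
            have := ((ContinuousMultilinearMap.apply ℝ (fun _ : Fin k => E) ℝ
              (Fin.tail v)).hasFDerivAt.comp y hdf.hasFDerivAt).fderiv
            exact congrArg (fun L => L (v 0)) this
          obtain ⟨V, hV, hV0⟩ := exists_nhds_volume_image_hypersurface m hE ih f g y hfy
            (by filter_upwards [hfy] with z hz using hgs z hz)
            (by simp [hg, hy0 k hk0 le_rfl])
            (fun h => hv (by rw [← hgy, h]; rfl))
          refine ⟨V, hV, measure_mono_null (Set.image_mono (f := f) ?_) hV0⟩
          refine fun z hz => ⟨hz.1, ?_, ?_⟩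
          · have h1 := hz.2 1 le_rfl hk0
            rw [← norm_eq_zero, norm_iteratedFDeriv_one, norm_eq_zero] at h1
            exact h1
          · simp [hg, hz.2 k hk0 le_rfl]
        choose! V hV hV0 using hloc
        obtain ⟨t, htS, htc, htU⟩ := TopologicalSpace.countable_cover_nhdsWithin (s := S ∩ O)
          (fun y hy => mem_nhdsWithin_of_mem_nhds (hV y hy))
        refine ⟨U ∩ O, inter_mem hU (hOo.mem_nhds hxO), ?_⟩
        refine measure_mono_null (t := _ ∪ ⋃ y ∈ t, _) ?_ (measure_union_null hU0
          ((measure_biUnion_null_iff htc).2 fun y hy => hV0 y (htS hy)))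
        rintro _ ⟨z, ⟨⟨hzU, hzO⟩, hz⟩, rfl⟩
        by_cases hzk : iteratedFDeriv ℝ (k + 1) f z = 0
        · left
          refine ⟨z, ⟨hzU, fun i h1 h2 => ?_⟩, rfl⟩
          rcases (show i ≤ k ∨ i = k + 1 by omega) with h | rfl
          exacts [hz i h1 h, hzk]
        · right
          obtain ⟨y, hy, hzy⟩ := mem_iUnion₂.1 (htU ⟨⟨hO z hzO, hz, hzk⟩, hzO⟩)
          exact mem_iUnion₂.2 ⟨y, hy, z, ⟨hzy, hz⟩, rfl⟩
    intro x hf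
    obtain ⟨U, hU, hU0⟩ := main m le_rfl x hf
    refine ⟨U, hU, measure_mono_null (Set.image_mono (f := f) ?_) hU0⟩
    refine fun y hy => ⟨hy.1, fun i h1 h2 => ?_⟩
    obtain rfl : i = 1 := by omega
    rw [← norm_eq_zero, norm_iteratedFDeriv_one, norm_eq_zero]
    exact hy.2

/-- A smooth real function on a manifold has regular values. -/
theorem exists_forall_eq_imp_mfderiv_ne_zero {m : ℕ} {L : Type*} [TopologicalSpace L]
    [SecondCountableTopology L] [ChartedSpace (Euc m) L] [IsManifold 𝓘(ℝ, Euc m) ∞ L] (f : L → ℝ)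
    (hf : ContMDiff 𝓘(ℝ, Euc m) 𝓘(ℝ, ℝ) ∞ f) :
    ∃ t, ∀ u, f u = t → mfderiv 𝓘(ℝ, Euc m) 𝓘(ℝ, ℝ) f u ≠ 0 := by
  have hloc : ∀ u : L, ∃ V ∈ 𝓝 u,
      volume (f '' {v ∈ V | mfderiv 𝓘(ℝ, Euc m) 𝓘(ℝ, ℝ) f v = 0}) = 0 := by
    intro u
    set e := extChartAt 𝓘(ℝ, Euc m) u with he
    have hs : ∀ y ∈ e.target, ContDiffAt ℝ ∞ (f ∘ e.symm) y := by
      intro y hy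
      have h1 := (contMDiffOn_extChartAt_symm (I := 𝓘(ℝ, Euc m)) (n := ∞) u).contMDiffAt
        ((isOpen_extChartAt_target u).mem_nhds hy)
      exact contMDiffAt_iff_contDiffAt.1 (hf.contMDiffAt.comp y h1)
    obtain ⟨U, hU, hU0⟩ := exists_nhds_volume_image_critical_eq_zero m (Euc m) (by simp)
      (f ∘ e.symm) (e u) (eventually_of_mem (extChartAt_target_mem_nhds u) hs)
    have hV : ∀ᶠ v in 𝓝 u, v ∈ e.source ∧ e v ∈ U :=
      (show ∀ᶠ v in 𝓝 u, v ∈ e.source from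
        extChartAt_source_mem_nhds (I := 𝓘(ℝ, Euc m)) u).and
        ((continuousAt_extChartAt (I := 𝓘(ℝ, Euc m)) u).preimage_mem_nhds hU)
    refine ⟨_, hV, measure_mono_null ?_ hU0⟩
    rintro _ ⟨v, ⟨⟨hv1, hv2⟩, hv3⟩, rfl⟩
    have hvt := e.map_source hv1
    refine ⟨e v, ⟨hv2, ?_⟩, by rw [Function.comp_apply, e.left_inv hv1]⟩
    have h1 := ((contMDiffOn_extChartAt_symm (I := 𝓘(ℝ, Euc m)) (n := ∞) u).contMDiffAt
        ((isOpen_extChartAt_target u).mem_nhds hvt)).mdifferentiableAt (by simp)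
    rw [← mfderiv_eq_fderiv, mfderiv_comp (e v)
      (hf.mdifferentiable (by simp) _) h1]
    rw [e.left_inv hv1, hv3]
    exact ContinuousLinearMap.zero_comp _
  choose V hV hV0 using hloc
  obtain ⟨c, hc, hcV⟩ := TopologicalSpace.countable_cover_nhds hV
  have h0 : volume (⋃ u ∈ c, f '' {v ∈ V u | mfderiv 𝓘(ℝ, Euc m) 𝓘(ℝ, ℝ) f v = 0}) = 0 :=
    (measure_biUnion_null_iff hc).2 fun u _ => hV0 u
  obtain ⟨t, ht⟩ : ∃ t, t ∉ ⋃ u ∈ c, f '' {v ∈ V u | mfderiv 𝓘(ℝ, Euc m) 𝓘(ℝ, ℝ) f v = 0} := by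
    by_contra! h
    rw [(eq_univ_of_forall h)] at h0
    simp at h0
  refine ⟨t, fun u hu hd => ht ?_⟩
  have : u ∈ ⋃ x ∈ c, V x := by rw [hcV]; trivial
  obtain ⟨x, hx, hux⟩ := mem_iUnion₂.1 this
  exact mem_iUnion₂.2 ⟨x, hx, u, ⟨hux, hd⟩, hu⟩

end Sard

end Submfd

end

noncomputable section
namespace Submfd
open Filter Topology Set

/-! ### The inverse function theorem on manifolds. -/

section InverseFunctionManifold

variable {E F : Type*} [NormedAddCommGroup E] [NormedSpace ℝ E] [FiniteDimensional ℝ E]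
  [NormedAddCommGroup F] [NormedSpace ℝ F] [FiniteDimensional ℝ F]
  {H K : Type*} [TopologicalSpace H] [TopologicalSpace K]
  (I : ModelWithCorners ℝ E H) (J : ModelWithCorners ℝ F K) [I.Boundaryless] [J.Boundaryless]
  {A B : Type*} [TopologicalSpace A] [ChartedSpace H A] [IsManifold I ∞ A]
  [TopologicalSpace B] [ChartedSpace K B] [IsManifold J ∞ B]

/-- The extended chart at a point of a manifold without boundary. -/
def extChartDiffeomorph (a : A) : PartialDiffeomorph I 𝓘(ℝ, E) A E ∞ where
  toPartialEquiv := extChartAt I a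
  open_source := isOpen_extChartAt_source a
  open_target := isOpen_extChartAt_target a
  contMDiffOn_toFun := by
    have := contMDiffOn_extChartAt (I := I) (n := ∞) (x := a)
    rwa [← extChartAt_source I] at this
  contMDiffOn_invFun := contMDiffOn_extChartAt_symm a

variable {I J}

omit [FiniteDimensional ℝ F] in
/-- The inverse function theorem on manifolds without boundary. -/
theorem isLocalDiffeomorphAt_of_bijective_mfderiv {f : A → B} {a : A}
    (hf : ∀ᶠ x in 𝓝 a, ContMDiffAt I J ∞ f x) (hd : Function.Bijective (mfderiv I J f a)) :
    IsLocalDiffeomorphAt I J ∞ f a := by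
  have := FiniteDimensional.complete ℝ E
  set φ := extChartDiffeomorph I a with hφ
  set ψ := extChartDiffeomorph J (f a) with hψ
  have haφ : a ∈ φ.source := mem_extChartAt_source a
  have hfa : f a ∈ ψ.source := mem_extChartAt_source (f a)
  have hback : φ.symm (φ a) = a := φ.left_inv haφ
  have hφa : φ a ∈ φ.target := φ.map_source haφ
  have hsymm : ∀ y ∈ φ.target, ContMDiffAt 𝓘(ℝ, E) I ∞ φ.symm y := fun y hy =>
    φ.contMDiffOn_invFun.contMDiffAt (φ.open_target.mem_nhds hy)
  have hsymmt : Tendsto φ.symm (𝓝 (φ a)) (𝓝 a) := by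
    have := (hsymm _ hφa).continuousAt.tendsto
    rwa [hback] at this
  set G : E → F := fun y => ψ (f (φ.symm y)) with hG
  have hev : ∀ᶠ y in 𝓝 (φ a), y ∈ φ.target ∧ ContMDiffAt I J ∞ f (φ.symm y) ∧
      f (φ.symm y) ∈ ψ.source := by
    refine (show ∀ᶠ y in 𝓝 (φ a), y ∈ φ.target from φ.open_target.mem_nhds hφa).and
      (hsymmt.eventually (p := fun x => ContMDiffAt I J ∞ f x ∧ f x ∈ ψ.source) (hf.and ?_))
    exact hf.self_of_nhds.continuousAt.preimage_mem_nhds (ψ.open_source.mem_nhds hfa)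
  have hGs : ∀ᶠ y in 𝓝 (φ a), ContDiffAt ℝ ∞ G y := by
    filter_upwards [hev] with y ⟨h1, h2, h3⟩
    exact contMDiffAt_iff_contDiffAt.1
      ((ψ.contMDiffOn_toFun.contMDiffAt (ψ.open_source.mem_nhds h3)).comp y
        (h2.comp y (hsymm y h1)))
  have hGd : fderiv ℝ G (φ a) = mfderiv I J f a := by
    rw [(hf.self_of_nhds.mdifferentiableAt (by simp)).mfderiv, I.range_eq_univ,
      fderivWithin_univ]
    rfl
  let D : E ≃L[ℝ] F := (LinearEquiv.ofBijective (fderiv ℝ G (φ a)).toLinearMap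
    (by rw [hGd]; exact hd)).toContinuousLinearEquiv
  have hD : (D : E →L[ℝ] F) = fderiv ℝ G (φ a) := by ext1 v; rfl
  obtain ⟨Φ, haΦ, hΦ, hΦs, hΦt⟩ := exists_openPartialHomeomorph_contDiffOn hGs D
    (by rw [hD]; exact (hGs.self_of_nhds.differentiableAt (by simp)).hasFDerivAt)
  obtain ⟨O, hO, hOo, haO⟩ := eventually_nhds_iff.1 hev
  let Φ' := Φ.restrOpen O hOo
  let Θ : PartialDiffeomorph 𝓘(ℝ, E) 𝓘(ℝ, F) E F ∞ :=
    { toPartialEquiv := Φ'.toPartialEquiv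
      open_source := Φ'.open_source
      open_target := Φ'.open_target
      contMDiffOn_toFun := (hΦs.mono (fun y hy => hy.1)).contMDiffOn
      contMDiffOn_invFun := (hΦt.mono (fun y hy => hy.1)).contMDiffOn }
  have hΘ : ∀ y, Θ y = G y := fun y => congrFun hΦ y
  refine ⟨(φ.trans Θ).trans ψ.symm, ⟨⟨haφ, haΦ, haO⟩, ?_⟩, ?_⟩
  · change Θ (φ a) ∈ ψ.target
    rw [hΘ, hG]
    change ψ (f (φ.symm (φ a))) ∈ _
    rw [hback]
    exact ψ.map_source hfa
  · rintro x ⟨⟨hx1, -, hx2⟩, -⟩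
    change f x = ψ.symm (Θ (φ x))
    have hx3 : φ.symm (φ x) = x := φ.left_inv hx1
    have h4 := (hO _ hx2).2.2
    change f (φ.symm (φ x)) ∈ _ at h4
    rw [hx3] at h4
    rw [hΘ]
    change f x = ψ.symm (ψ (f (φ.symm (φ x))))
    rw [hx3]
    exact (ψ.left_inv h4).symm

end InverseFunctionManifold

/-! ### Global sections over simply connected spaces. -/

section Monodromy

/-- Over a simply connected space, locally constant identifications of the sets `P u` with a fixed
set give global sections. -/
theorem exists_global_section {L F W : Type*} [TopologicalSpace L] [SimplyConnectedSpace L]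
    [LocallyPathConnectedSpace L] [TopologicalSpace F] [DiscreteTopology F] [Nonempty F]
    (P : L → Set W) (U : L → Set L) (hU : ∀ i, IsOpen (U i)) (hUi : ∀ i, i ∈ U i)
    (e : L → L → F → W) (he : ∀ i, ∀ u ∈ U i, BijOn (e i u) univ (P u))
    (htrans : ∀ i j, ∀ u ∈ U i ∩ U j, ∀ a b, e i u a = e j u b → ∀ᶠ v in 𝓝 u, e i v a = e j v b)
    (u₀ : L) (w₀ : W) (hw₀ : w₀ ∈ P u₀) :
    ∃ w : L → W, w u₀ = w₀ ∧ ∀ i, ∀ u ∈ U i, ∃ a, ∀ᶠ v in 𝓝 u, w v = e i v a := by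
  have hinj : ∀ i, ∀ u ∈ U i, Function.Injective (e i u) := fun i u hu =>
    injOn_univ.1 (he i u hu).injOn
  have hinv : ∀ i j, ∀ u ∈ U i ∩ U j, ∀ a, e j u (Function.invFun (e j u) (e i u a)) = e i u a := by
    intro i j u hu a
    refine Function.invFun_eq ?_
    obtain ⟨b, -, hb⟩ := (he j u hu.2).surjOn ((he i u hu.1).mapsTo (mem_univ a))
    exact ⟨b, hb⟩
  -- With a discrete fibre and locally constant transition maps the bundle is a covering of `L`.
  -- Simple connectedness lifts the identity of `L` through the prescribed point.
  let Z : FiberBundleCore L L F :=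
    { baseSet := U
      isOpen_baseSet := hU
      indexAt := id
      mem_baseSet_at := hUi
      coordChange := fun i j u a => Function.invFun (e j u) (e i u a)
      coordChange_self := fun i u hu a => Function.leftInverse_invFun (hinj i u hu) a
      continuousOn_coordChange := by
        rintro i j ⟨u, a⟩ ⟨hu, -⟩
        refine ContinuousAt.continuousWithinAt ?_
        set b := Function.invFun (e j u) (e i u a) with hb
        have hev : ∀ᶠ p : L × F in 𝓝 (u, a), Function.invFun (e j p.1) (e i p.1 p.2) = b := by
          have h1 : ∀ᶠ v in 𝓝 u, e i v a = e j v b ∧ v ∈ U j :=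
            (htrans i j u hu a b (hinv i j u hu a).symm).and ((hU j).mem_nhds hu.2)
          have h2 : ∀ᶠ c in 𝓝 a, c = a := by rw [nhds_discrete]; rfl
          rw [nhds_prod_eq]
          filter_upwards [h1.prod_mk h2] with p ⟨⟨hp1, hp3⟩, hp2⟩
          rw [hp2, hp1]
          exact Function.leftInverse_invFun (hinj j p.1 hp3) b
        exact (tendsto_congr' hev).2 (by simp [hb])
      coordChange_comp := by
        rintro i j k u ⟨⟨hi, hj⟩, hk⟩ a
        rw [hinv i j u ⟨hi, hj⟩ a] }
  have hcov : IsCoveringMap (Bundle.TotalSpace.proj : Z.TotalSpace → L) :=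
    FiberBundle.isCoveringMap (F := F) (E := Z.Fiber)
  obtain ⟨a₀, -, ha₀⟩ := (he u₀ u₀ (hUi u₀)).surjOn hw₀
  obtain ⟨σ, ⟨hσ0, hσ⟩, -⟩ := hcov.existsUnique_continuousMap_lifts (ContinuousMap.id L) u₀
    (⟨u₀, a₀⟩ : Z.TotalSpace) rfl
  have hproj : ∀ u, (σ u).proj = u := fun u => congrFun hσ u
  let val : Z.TotalSpace → W := fun p => e p.proj p.proj p.2
  refine ⟨fun u => val (σ u), (congrArg val hσ0).trans ha₀, fun i u hu => ?_⟩
  have hmem : σ u ∈ (Z.localTriv i).source := by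
    rw [Z.mem_localTriv_source, hproj]; exact hu
  have hcont : ContinuousAt (fun v => (Z.localTriv i (σ v)).2) u :=
    (continuous_snd.continuousAt).comp
      (((Z.localTriv i).continuousAt hmem).comp σ.continuous.continuousAt)
  refine ⟨(Z.localTriv i (σ u)).2, ?_⟩
  have h1 : ∀ᶠ v in 𝓝 u, (Z.localTriv i (σ v)).2 ∈ ({(Z.localTriv i (σ u)).2} : Set F) :=
    hcont.preimage_mem_nhds (by rw [nhds_discrete]; exact mem_singleton _)
  filter_upwards [h1, (hU i).mem_nhds hu] with v hv hvi
  rw [← eq_of_mem_singleton hv]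
  have h3 := hinv (σ v).proj i (σ v).proj ⟨hUi _, by rw [hproj]; exact hvi⟩ (σ v).2
  have h4 : ∀ u', (σ v).proj = u' → val (σ v) = e i u' (Z.localTriv i (σ v)).2 := by
    rintro _ rfl
    exact h3.symm
  exact h4 v (hproj v)

end Monodromy

/-! ### Local left inverses of immersions. -/

section LeftInverse

/-- An immersion has smooth local left inverses. -/
theorem IsSmoothImmersion.exists_leftInverse {n q : ℕ} {M : Type*} [TopologicalSpace M]
    [ChartedSpace (Euc n) M] [IsManifold 𝓘(ℝ, Euc n) ∞ M] {f : M → Euc q}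
    (hf : IsSmoothImmersion n f) (x₀ : M) :
    ∃ P : Euc q → M, (∀ᶠ y in 𝓝 (f x₀), ContMDiffAt 𝓘(ℝ, Euc q) 𝓘(ℝ, Euc n) ∞ P y) ∧
      ∀ᶠ x in 𝓝 x₀, P (f x) = x := by
  -- Followed by this linear map, `f` has the identity as differential at `x₀`; the local inverse of
  -- `ℓ ∘ f`, precomposed with `ℓ`, is the required left inverse.
  set ℓ : Euc q →L[ℝ] Euc n := pinv (differential n f x₀) with hℓ
  have hs : ContMDiff 𝓘(ℝ, Euc n) 𝓘(ℝ, Euc n) ∞ (ℓ ∘ f) := ℓ.contDiff.comp_contMDiff hf.smooth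
  have hd : mfderiv 𝓘(ℝ, Euc n) 𝓘(ℝ, Euc n) (ℓ ∘ f) x₀ = ContinuousLinearMap.id ℝ (Euc n) := by
    rw [mfderiv_comp x₀ ((ℓ.contMDiff (n := ∞)).mdifferentiableAt (by simp))
      (hf.smooth.mdifferentiableAt (by simp))]
    rw [mfderiv_eq_fderiv, ℓ.fderiv]
    ext1 v
    exact pinv_apply_self _ (hf.injective x₀) v
  have hloc := isLocalDiffeomorphAt_of_bijective_mfderiv (f := ℓ ∘ f) (a := x₀)
    (Eventually.of_forall fun x => hs x) (by rw [hd]; exact Function.bijective_id)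
  obtain ⟨Φ, hx, hΦ⟩ := hloc
  have hy : ℓ (f x₀) ∈ Φ.target := by
    have := Φ.map_source hx
    rwa [← hΦ hx] at this
  refine ⟨fun y => Φ.symm (ℓ y), ?_, ?_⟩
  · have h1 : ∀ᶠ y in 𝓝 (f x₀), ℓ y ∈ Φ.target :=
      ℓ.continuous.continuousAt.preimage_mem_nhds (Φ.open_target.mem_nhds hy)
    filter_upwards [h1] with y hy'
    exact (Φ.contMDiffOn_invFun.contMDiffAt (Φ.open_target.mem_nhds hy')).comp y ℓ.contMDiff.contMDiffAt
  · filter_upwards [Φ.open_source.mem_nhds hx] with x hx'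
    have : ℓ (f x) = Φ x := hΦ hx'
    rw [this]
    exact Φ.left_inv hx'

end LeftInverse

end Submfd

end

noncomputable section
namespace Submfd
open Filter Topology Set

/-! ### Calculus of vector-valued functions on a manifold. -/

section VectorValuedDerivative

variable {k : ℕ} {M : Type*} [TopologicalSpace M] [ChartedSpace (Euc k) M]
  {V W : Type*} [NormedAddCommGroup V] [NormedSpace ℝ V] [NormedAddCommGroup W] [NormedSpace ℝ W]

variable (k) in
/-- The differential at `x` of a map with values in a normed space. -/
def dd (F : M → V) (x : M) : Euc k →L[ℝ] V := mfderiv 𝓘(ℝ, Euc k) 𝓘(ℝ, V) F x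

/-- `F'` is the differential at `x` of the map `F` with values in a normed space. -/
def HasDD (F : M → V) (F' : Euc k →L[ℝ] V) (x : M) : Prop :=
  HasFDerivAt (F ∘ (extChartAt 𝓘(ℝ, Euc k) x).symm) F' (extChartAt 𝓘(ℝ, Euc k) x x)

theorem differential_eq_dd {q : ℕ} (f : M → Euc q) (x : M) : differential k f x = dd k f x := rfl

theorem _root_.HasMFDerivAt.hasDD {F : M → V} {F' : Euc k →L[ℝ] V} {x : M}
    (h : HasMFDerivAt 𝓘(ℝ, Euc k) 𝓘(ℝ, V) F x F') : HasDD F F' x := by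
  have h1 : HasFDerivWithinAt (F ∘ (extChartAt 𝓘(ℝ, Euc k) x).symm) F' univ
      (extChartAt 𝓘(ℝ, Euc k) x x) := by
    have := h.2
    rwa [ModelWithCorners.range_eq_univ] at this
  exact hasFDerivWithinAt_univ.1 h1

theorem _root_.MDifferentiableAt.hasDD {F : M → V} {x : M}
    (h : MDifferentiableAt 𝓘(ℝ, Euc k) 𝓘(ℝ, V) F x) : HasDD F (dd k F x) x :=
  h.hasMFDerivAt.hasDD

theorem _root_.ContMDiffAt.hasDD {F : M → V} {x : M}
    (h : ContMDiffAt 𝓘(ℝ, Euc k) 𝓘(ℝ, V) ∞ F x) : HasDD F (dd k F x) x :=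
  (h.mdifferentiableAt (by simp)).hasDD

theorem _root_.ContMDiff.hasDD {F : M → V}
    (h : ContMDiff 𝓘(ℝ, Euc k) 𝓘(ℝ, V) ∞ F) (x : M) : HasDD F (dd k F x) x :=
  h.contMDiffAt.hasDD

namespace HasDD

variable {F G : M → V} {F' G' : Euc k →L[ℝ] V} {x : M}

theorem continuousAt (h : HasDD F F' x) : ContinuousAt F x := by
  have h1 : ContinuousAt ((F ∘ (extChartAt 𝓘(ℝ, Euc k) x).symm) ∘ extChartAt 𝓘(ℝ, Euc k) x) x :=
    (HasFDerivAt.continuousAt h).comp (continuousAt_extChartAt x)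
  refine h1.congr ?_
  filter_upwards [extChartAt_source_mem_nhds (I := 𝓘(ℝ, Euc k)) x] with y hy
  simp only [Function.comp_apply, (extChartAt 𝓘(ℝ, Euc k) x).left_inv hy]

theorem hasMFDerivAt (h : HasDD F F' x) : HasMFDerivAt 𝓘(ℝ, Euc k) 𝓘(ℝ, V) F x F' := by
  refine ⟨h.continuousAt, ?_⟩
  rw [ModelWithCorners.range_eq_univ]
  exact HasFDerivAt.hasFDerivWithinAt h

theorem dd_eq (h : HasDD F F' x) : dd k F x = F' := h.hasMFDerivAt.mfderiv

theorem const (c : V) (x : M) : HasDD (fun _ : M => c) (0 : Euc k →L[ℝ] V) x :=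
  hasFDerivAt_const c _

theorem add (hF : HasDD F F' x) (hG : HasDD G G' x) : HasDD (fun y => F y + G y) (F' + G') x :=
  HasFDerivAt.add hF hG

theorem sub (hF : HasDD F F' x) (hG : HasDD G G' x) : HasDD (fun y => F y - G y) (F' - G') x :=
  HasFDerivAt.sub hF hG

theorem neg (hF : HasDD F F' x) : HasDD (fun y => -F y) (-F') x := HasFDerivAt.neg hF

theorem sum {ι : Type*} {s : Finset ι} {F : ι → M → V} {F' : ι → Euc k →L[ℝ] V}
    (h : ∀ i ∈ s, HasDD (F i) (F' i) x) : HasDD (fun y => ∑ i ∈ s, F i y) (∑ i ∈ s, F' i) x := by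
  have := HasFDerivAt.fun_sum h
  exact this

theorem prodMk {G : M → W} {G' : Euc k →L[ℝ] W} (hF : HasDD F F' x) (hG : HasDD G G' x) :
    HasDD (fun y => (F y, G y)) (F'.prod G') x :=
  HasFDerivAt.prodMk hF hG

theorem comp_left {G : V → W} {G' : V →L[ℝ] W} (hG : HasFDerivAt G G' (F x)) (hF : HasDD F F' x) :
    HasDD (fun y => G (F y)) (G' ∘L F') x := by
  have h1 : HasFDerivAt G G' ((F ∘ (extChartAt 𝓘(ℝ, Euc k) x).symm)
      (extChartAt 𝓘(ℝ, Euc k) x x)) := by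
    rw [Function.comp_apply, extChartAt_to_inv]; exact hG
  exact h1.comp _ hF

theorem smul {c : M → ℝ} {c' : Euc k →L[ℝ] ℝ} (hc : HasDD c c' x) (hF : HasDD F F' x) :
    HasDD (fun y => c y • F y) (c x • F' + c'.smulRight (F x)) x := by
  have h := HasFDerivAt.smul hc hF
  simp only [Function.comp_apply, extChartAt_to_inv] at h
  exact h

theorem const_smul (c : ℝ) (hF : HasDD F F' x) : HasDD (fun y => c • F y) (c • F') x :=
  HasFDerivAt.const_smul hF c

theorem clm_apply {T : M → V →L[ℝ] W} {T' : Euc k →L[ℝ] V →L[ℝ] W} (hT : HasDD T T' x)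
    (hF : HasDD F F' x) : HasDD (fun y => T y (F y)) (T x ∘L F' + T'.flip (F x)) x := by
  have h := HasFDerivAt.clm_apply hT hF
  simp only [Function.comp_apply, extChartAt_to_inv] at h
  exact h

theorem clm_comp {U : Type*} [NormedAddCommGroup U] [NormedSpace ℝ U] (ℓ : V →L[ℝ] U)
    (hF : HasDD F F' x) : HasDD (fun y => ℓ (F y)) (ℓ ∘L F') x :=
  comp_left ℓ.hasFDerivAt hF

theorem congr (hF : HasDD F F' x) (h : G =ᶠ[𝓝 x] F) : HasDD G F' x := by
  refine HasFDerivAt.congr_of_eventuallyEq hF ?_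
  have h1 : Tendsto (extChartAt 𝓘(ℝ, Euc k) x).symm (𝓝 (extChartAt 𝓘(ℝ, Euc k) x x)) (𝓝 x) := by
    have := (continuousAt_extChartAt_symm (I := 𝓘(ℝ, Euc k)) x).tendsto
    rwa [extChartAt_to_inv] at this
  exact h1.eventually h

theorem comp_right {m : ℕ} {L : Type*} [TopologicalSpace L] [ChartedSpace (Euc m) L] {j : L → M}
    {u : L} {J : Euc m →L[ℝ] Euc k} (hF : HasDD F F' (j u))
    (hj : HasMFDerivAt 𝓘(ℝ, Euc m) 𝓘(ℝ, Euc k) j u J) : HasDD (fun v => F (j v)) (F' ∘L J) u :=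
  (hF.hasMFDerivAt.comp u hj).hasDD

end HasDD

theorem HasDD.inner {V : Type*} [NormedAddCommGroup V] [InnerProductSpace ℝ V] {F G : M → V}
    {F' G' : Euc k →L[ℝ] V} {x : M} (hF : HasDD F F' x) (hG : HasDD G G' x) :
    HasDD (fun y => ⟪F y, G y⟫)
      ((innerSL ℝ (F x)) ∘L G' + (innerSL ℝ (G x)) ∘L F') x := by
  have h := HasFDerivAt.inner ℝ hF hG
  refine HasFDerivAt.congr_fderiv h ?_
  ext1 X
  simp [Function.comp_apply, real_inner_comm]

theorem dd_congr {F G : M → V} {x : M} (h : F =ᶠ[𝓝 x] G) : dd k F x = dd k G x :=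
  Filter.EventuallyEq.mfderiv_eq h

/-- A map with vanishing differential near `x` is constant near `x`. -/
theorem eventually_eq_of_hasDD_zero [IsManifold 𝓘(ℝ, Euc k) ∞ M] {F : M → V} {x : M}
    (h : ∀ᶠ y in 𝓝 x, HasDD F (0 : Euc k →L[ℝ] V) y) : ∀ᶠ y in 𝓝 x, F y = F x := by
  set e := extChartAt 𝓘(ℝ, Euc k) x with he
  have h1 : Tendsto e.symm (𝓝 (e x)) (𝓝 x) := by
    have := (continuousAt_extChartAt_symm (I := 𝓘(ℝ, Euc k)) x).tendsto
    rwa [extChartAt_to_inv] at this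
  have h2 : ∀ᶠ z in 𝓝 (e x), HasFDerivAt (F ∘ e.symm) (0 : Euc k →L[ℝ] V) z := by
    filter_upwards [h1.eventually h, extChartAt_target_mem_nhds (I := 𝓘(ℝ, Euc k)) x] with z hz hzt
    have h3 := ((contMDiffOn_extChartAt_symm (I := 𝓘(ℝ, Euc k)) (n := ∞) x).contMDiffAt
      ((isOpen_extChartAt_target x).mem_nhds hzt)).mdifferentiableAt (by simp)
    have h4 := hz.hasMFDerivAt.comp z h3.hasMFDerivAt
    have h5 := h4.hasFDerivAt
    refine h5.congr_fderiv ?_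
    ext1 v
    rfl
  obtain ⟨r, hr, hball⟩ := Metric.eventually_nhds_iff_ball.1 h2
  have h6 : ∀ z ∈ Metric.ball (e x) r, F (e.symm z) = F x := by
    intro z hz
    have := (convex_ball (e x) r).is_const_of_fderivWithin_eq_zero (𝕜 := ℝ) (f := F ∘ e.symm)
      (fun y hy => (hball y hy).differentiableAt.differentiableWithinAt)
      (fun y hy => by
        rw [fderivWithin_of_isOpen Metric.isOpen_ball hy, (hball y hy).fderiv])
      hz (Metric.mem_ball_self hr)
    simpa [he] using this
  have h7 : ∀ᶠ y in 𝓝 x, e y ∈ Metric.ball (e x) r :=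
    (continuousAt_extChartAt (I := 𝓘(ℝ, Euc k)) x).preimage_mem_nhds (Metric.ball_mem_nhds _ hr)
  filter_upwards [h7, extChartAt_source_mem_nhds (I := 𝓘(ℝ, Euc k)) x] with y hy hys
  rw [← h6 _ hy, e.left_inv hys]

/-- A map with vanishing differential on a connected manifold is constant. -/
theorem eq_of_hasDD_zero [IsManifold 𝓘(ℝ, Euc k) ∞ M] [PreconnectedSpace M] {F : M → V}
    (h : ∀ x, HasDD F (0 : Euc k →L[ℝ] V) x) (x y : M) : F x = F y := by
  have : IsLocallyConstant F := (IsLocallyConstant.iff_eventually_eq F).2 fun x =>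
    eventually_eq_of_hasDD_zero (Eventually.of_forall h)
  exact this.apply_eq_of_isPreconnected isPreconnected_univ (mem_univ _) (mem_univ _)

end VectorValuedDerivative

end Submfd

end

/-! ### The structure equations of a Dupin principal normal in a chart. -/

noncomputable section
namespace Submfd
open Filter Topology Set

/-- A Dupin principal normal `η`, in local coordinates: `g` is an immersion of the open set `O`, `τ`
is the tangential projection and `π` the projection onto the image `E` of the nullity of `η`. -/
structure LocalDupin {n q : ℕ} (O : Set (Euc n)) (g : Euc n → Euc q) (τ π : Euc n → Euc q →L[ℝ] Euc q)
    (η : Euc n → Euc q) : Prop where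
  isOpen : IsOpen O
  smooth_g : ∀ y ∈ O, ContDiffAt ℝ ∞ g y
  smooth_τ : ∀ y ∈ O, ContDiffAt ℝ ∞ τ y
  smooth_π : ∀ y ∈ O, ContDiffAt ℝ ∞ π y
  smooth_η : ∀ y ∈ O, ContDiffAt ℝ ∞ η y
  inj : ∀ y ∈ O, Function.Injective (fderiv ℝ g y)
  τ_g : ∀ y ∈ O, ∀ X, τ y (fderiv ℝ g y X) = fderiv ℝ g y X
  τ_range : ∀ y ∈ O, ∀ w, ∃ X, fderiv ℝ g y X = τ y w
  τ_symm : ∀ y ∈ O, ∀ v w, ⟪τ y v, w⟫ = ⟪v, τ y w⟫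
  τ_η : ∀ y ∈ O, τ y (η y) = 0
  π_symm : ∀ y ∈ O, ∀ v w, ⟪π y v, w⟫ = ⟪v, π y w⟫
  π_π : ∀ y ∈ O, ∀ w, π y (π y w) = π y w
  τ_π : ∀ y ∈ O, ∀ w, τ y (π y w) = π y w
  null : ∀ y ∈ O, ∀ w X, fderiv ℝ τ y X (π y w) = ⟪π y w, fderiv ℝ g y X⟫ • η y
  of_null : ∀ y ∈ O, ∀ w, τ y w = w → (∀ X, fderiv ℝ τ y X w = ⟪w, fderiv ℝ g y X⟫ • η y) →
    π y w = w
  dupin : ∀ y ∈ O, ∀ Z, π y (fderiv ℝ g y Z) = fderiv ℝ g y Z →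
    τ y (fderiv ℝ η y Z) = fderiv ℝ η y Z
  π_ne : ∀ y ∈ O, π y ≠ 0

/-- The mean curvature vector field of the nullity distribution of a principal normal. -/
def meanCurv {n q : ℕ} (g : Euc n → Euc q) (π : Euc n → Euc q →L[ℝ] Euc q) (y : Euc n) : Euc q :=
  (∑ k, ‖π y (EuclideanSpace.basisFun (Fin q) ℝ k)‖ ^ 2)⁻¹ •
    ∑ k, fderiv ℝ π y (pinv (fderiv ℝ g y) (π y (EuclideanSpace.basisFun (Fin q) ℝ k)))
      (π y (EuclideanSpace.basisFun (Fin q) ℝ k))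

namespace LocalDupin

variable {n q : ℕ} {O : Set (Euc n)} {g : Euc n → Euc q} {τ π : Euc n → Euc q →L[ℝ] Euc q}
  {η : Euc n → Euc q} (h : LocalDupin O g τ π η) {y : Euc n} (hy : y ∈ O)
include h hy

theorem nhds : O ∈ 𝓝 y := h.isOpen.mem_nhds hy

theorem hasFDerivAt_g' : HasFDerivAt (fderiv ℝ g) (fderiv ℝ (fderiv ℝ g) y) y :=
  (((h.smooth_g y hy).fderiv_right (m := ∞) (by simp)).differentiableAt (by simp)).hasFDerivAt

theorem hasFDerivAt_τ : HasFDerivAt τ (fderiv ℝ τ y) y :=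
  ((h.smooth_τ y hy).differentiableAt (by simp)).hasFDerivAt

theorem hasFDerivAt_π : HasFDerivAt π (fderiv ℝ π y) y :=
  ((h.smooth_π y hy).differentiableAt (by simp)).hasFDerivAt

theorem hasFDerivAt_η : HasFDerivAt η (fderiv ℝ η y) y :=
  ((h.smooth_η y hy).differentiableAt (by simp)).hasFDerivAt

theorem τ_τ (w : Euc q) : τ y (τ y w) = τ y w := by
  obtain ⟨X, hX⟩ := h.τ_range y hy w
  rw [← hX, h.τ_g y hy]

theorem π_τ (w : Euc q) : π y (τ y w) = π y w := by
  refine ext_inner_right ℝ fun v => ?_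
  rw [h.π_symm y hy, h.τ_symm y hy, h.τ_π y hy, h.π_symm y hy]

theorem snd_fderiv_symm (X Y : Euc n) :
    fderiv ℝ (fderiv ℝ g) y X Y = fderiv ℝ (fderiv ℝ g) y Y X :=
  ((h.smooth_g y hy).isSymmSndFDerivAt (by simpa using ENat.LEInfty.out)) X Y

/-- Differentiate `τ (g_* Y) = g_* Y`. The right-hand side is the second fundamental form of `g`,
which is therefore carried by `dτ`. -/
theorem fderiv_τ_apply_g (X Y : Euc n) : fderiv ℝ τ y X (fderiv ℝ g y Y) =
    fderiv ℝ (fderiv ℝ g) y X Y - τ y (fderiv ℝ (fderiv ℝ g) y X Y) := by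
  have h1 := (h.hasFDerivAt_g' hy).clm_apply (hasFDerivAt_const Y y)
  have h2 := (h.hasFDerivAt_τ hy).clm_apply h1
  have h3 := h2.congr_of_eventuallyEq (f₁ := fun z => fderiv ℝ g z Y)
    (by filter_upwards [h.nhds hy] with z hz using (h.τ_g z hz Y).symm)
  have h4 := congrArg (fun T => T X) (h3.unique h1)
  simp at h4
  exact eq_sub_of_add_eq' h4

theorem fderiv_τ_symm (X Y : Euc n) :
    fderiv ℝ τ y X (fderiv ℝ g y Y) = fderiv ℝ τ y Y (fderiv ℝ g y X) := by
  rw [h.fderiv_τ_apply_g hy, h.fderiv_τ_apply_g hy, h.snd_fderiv_symm hy]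

theorem fderiv_τ_mul (X : Euc n) (w : Euc q) :
    fderiv ℝ τ y X (τ y w) = fderiv ℝ τ y X w - τ y (fderiv ℝ τ y X w) := by
  have h1 := (h.hasFDerivAt_τ hy).clm_apply (hasFDerivAt_const w y)
  have h2 := (h.hasFDerivAt_τ hy).clm_apply h1
  have h3 := h2.congr_of_eventuallyEq (f₁ := fun z => τ z w)
    (by filter_upwards [h.nhds hy] with z hz using (h.τ_τ hz w).symm)
  have h4 := congrArg (fun T => T X) (h3.unique h1)
  simp at h4
  exact eq_sub_of_add_eq' h4

/-- Differentiate `π² = π`. In particular `π dπ(X) a = 0` whenever `π a = a`. -/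
theorem fderiv_π_mul (X : Euc n) (w : Euc q) :
    fderiv ℝ π y X (π y w) = fderiv ℝ π y X w - π y (fderiv ℝ π y X w) := by
  have h1 := (h.hasFDerivAt_π hy).clm_apply (hasFDerivAt_const w y)
  have h2 := (h.hasFDerivAt_π hy).clm_apply h1
  have h3 := h2.congr_of_eventuallyEq (f₁ := fun z => π z w)
    (by filter_upwards [h.nhds hy] with z hz using (h.π_π z hz w).symm)
  have h4 := congrArg (fun T => T X) (h3.unique h1)
  simp at h4
  exact eq_sub_of_add_eq' h4

theorem fderiv_π_symm (X : Euc n) (v w : Euc q) :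
    ⟪fderiv ℝ π y X v, w⟫ = ⟪v, fderiv ℝ π y X w⟫ := by
  have h1 := ((h.hasFDerivAt_π hy).clm_apply (hasFDerivAt_const v y)).inner ℝ (hasFDerivAt_const w y)
  have h2 := (hasFDerivAt_const v y).inner ℝ ((h.hasFDerivAt_π hy).clm_apply (hasFDerivAt_const w y))
  have h3 := h2.congr_of_eventuallyEq (f₁ := fun z => ⟪π z v, w⟫)
    (by filter_upwards [h.nhds hy] with z hz using h.π_symm z hz v w)
  have h4 := congrArg (fun T => T X) (h1.unique h3)
  simpa using h4

theorem fderiv_τ_η (X : Euc n) : fderiv ℝ τ y X (η y) + τ y (fderiv ℝ η y X) = 0 := by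
  have h2 := (h.hasFDerivAt_τ hy).clm_apply (h.hasFDerivAt_η hy)
  have h3 := h2.congr_of_eventuallyEq (f₁ := fun z => (0 : Euc q))
    (by filter_upwards [h.nhds hy] with z hz using (h.τ_η z hz).symm)
  have h4 := congrArg (fun T => T X) (h3.unique (hasFDerivAt_const 0 y))
  simp at h4
  rw [← h4]; abel

/-- The Codazzi equation for a field `ξ` with `dτ(X) ξ + c dη(X) = ⟨ξ, X⟩ η`. -/
theorem codazzi {ξ : Euc n → Euc q} (hξ : ∀ z ∈ O, ContDiffAt ℝ ∞ ξ z) (c : ℝ)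
    (heq : ∀ z ∈ O, ∀ X, fderiv ℝ τ z X (ξ z) + c • fderiv ℝ η z X =
      ⟪ξ z, fderiv ℝ g z X⟫ • η z) (X Y : Euc n) :
    fderiv ℝ τ y X (fderiv ℝ ξ y Y) - fderiv ℝ τ y Y (fderiv ℝ ξ y X) =
      (⟪fderiv ℝ ξ y Y, fderiv ℝ g y X⟫ - ⟪fderiv ℝ ξ y X, fderiv ℝ g y Y⟫) • η y +
      ⟪ξ y, fderiv ℝ g y X⟫ • fderiv ℝ η y Y - ⟪ξ y, fderiv ℝ g y Y⟫ • fderiv ℝ η y X := by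
  have hdτ : HasFDerivAt (fderiv ℝ τ) (fderiv ℝ (fderiv ℝ τ) y) y :=
    (((h.smooth_τ y hy).fderiv_right (m := ∞) (by simp)).differentiableAt (by simp)).hasFDerivAt
  have hdη : HasFDerivAt (fderiv ℝ η) (fderiv ℝ (fderiv ℝ η) y) y :=
    (((h.smooth_η y hy).fderiv_right (m := ∞) (by simp)).differentiableAt (by simp)).hasFDerivAt
  have hdξ : HasFDerivAt ξ (fderiv ℝ ξ y) y := ((hξ y hy).differentiableAt (by simp)).hasFDerivAt
  -- The hypothesis differentiated in the direction `Y`. On exchanging `X` and `Y` and subtracting,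
  -- the second derivatives of `τ`, `η` and `g` cancel by symmetry.
  have key : ∀ X Y, fderiv ℝ (fderiv ℝ τ) y Y X (ξ y) + fderiv ℝ τ y X (fderiv ℝ ξ y Y) +
      c • fderiv ℝ (fderiv ℝ η) y Y X = ⟪ξ y, fderiv ℝ g y X⟫ • fderiv ℝ η y Y +
      (⟪fderiv ℝ ξ y Y, fderiv ℝ g y X⟫ + ⟪ξ y, fderiv ℝ (fderiv ℝ g) y Y X⟫) • η y := by
    intro X Y
    have h1 := ((hdτ.clm_apply (hasFDerivAt_const X y)).clm_apply hdξ).add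
      ((hdη.clm_apply (hasFDerivAt_const X y)).const_smul c)
    have h2 := (hdξ.inner ℝ ((h.hasFDerivAt_g' hy).clm_apply (hasFDerivAt_const X y))).smul
      (h.hasFDerivAt_η hy)
    have h3 := h2.congr_of_eventuallyEq
      (f₁ := fun z => fderiv ℝ τ z X (ξ z) + c • fderiv ℝ η z X)
      (by filter_upwards [h.nhds hy] with z hz using heq z hz X)
    have h4 := congrArg (fun T => T Y) (h1.unique h3)
    simp at h4
    rw [add_comm (fderiv ℝ (fderiv ℝ τ) y Y X (ξ y)), h4, add_comm ⟪ξ y, _⟫]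
  have h5 := key X Y
  have h6 := key Y X
  rw [((h.smooth_τ y hy).isSymmSndFDerivAt (by simpa using ENat.LEInfty.out)) Y X,
    ((h.smooth_η y hy).isSymmSndFDerivAt (by simpa using ENat.LEInfty.out)) Y X, h.snd_fderiv_symm hy Y X] at h5
  have h7 : fderiv ℝ τ y X (fderiv ℝ ξ y Y) - fderiv ℝ τ y Y (fderiv ℝ ξ y X) =
    (fderiv ℝ (fderiv ℝ τ) y X Y (ξ y) + fderiv ℝ τ y X (fderiv ℝ ξ y Y) +
      c • fderiv ℝ (fderiv ℝ η) y X Y) - (fderiv ℝ (fderiv ℝ τ) y X Y (ξ y) +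
      fderiv ℝ τ y Y (fderiv ℝ ξ y X) + c • fderiv ℝ (fderiv ℝ η) y X Y) := by abel
  rw [h7, h5, h6]
  module

/-- The consequence of the Codazzi equation in the directions of the nullity. -/
theorem codazzi_null {ξ : Euc n → Euc q} (hξ : ∀ z ∈ O, ContDiffAt ℝ ∞ ξ z) (c : ℝ)
    (heq : ∀ z ∈ O, ∀ X, fderiv ℝ τ z X (ξ z) + c • fderiv ℝ η z X =
      ⟪ξ z, fderiv ℝ g z X⟫ • η z) (X Z : Euc n) (hZ : π y (fderiv ℝ g y Z) = fderiv ℝ g y Z) :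
    fderiv ℝ τ y X (τ y (fderiv ℝ ξ y Z)) - ⟪fderiv ℝ ξ y Z, fderiv ℝ g y X⟫ • η y =
      -(⟪ξ y, fderiv ℝ g y Z⟫ • (fderiv ℝ η y X - τ y (fderiv ℝ η y X))) := by
  -- The part normal to `g` of the Codazzi equation: `dη(Z)` is tangent by the Dupin condition, so
  -- its normal part drops out.
  have h1 := congrArg (fun w => w - τ y w) (h.codazzi hy hξ c heq X Z)
  simp only [map_sub, map_add, map_smul, h.τ_η y hy, h.dupin y hy Z hZ, smul_zero] at h1
  -- Symmetry of the second fundamental form lets `Z` be the vector acted upon, where its nullity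
  -- gives the value.
  have h2 : fderiv ℝ τ y Z (τ y (fderiv ℝ ξ y X)) = ⟪fderiv ℝ ξ y X, fderiv ℝ g y Z⟫ • η y := by
    obtain ⟨W, hW⟩ := h.τ_range y hy (fderiv ℝ ξ y X)
    rw [← hW, h.fderiv_τ_symm hy, ← hZ, h.null y hy, hZ, hW, ← h.τ_symm y hy, h.τ_g y hy,
      real_inner_comm]
  rw [h.fderiv_τ_mul hy] at h2 ⊢
  have h3 : fderiv ℝ τ y X (fderiv ℝ ξ y Z) - τ y (fderiv ℝ τ y X (fderiv ℝ ξ y Z)) =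
      (fderiv ℝ τ y X (fderiv ℝ ξ y Z) - fderiv ℝ τ y Z (fderiv ℝ ξ y X) -
      (τ y (fderiv ℝ τ y X (fderiv ℝ ξ y Z)) - τ y (fderiv ℝ τ y Z (fderiv ℝ ξ y X)))) +
      (fderiv ℝ τ y Z (fderiv ℝ ξ y X) - τ y (fderiv ℝ τ y Z (fderiv ℝ ξ y X))) := by abel
  rw [h3, h1, h2]
  module

theorem π_eq_τ_of_forall {w : Euc q}
    (hw : ∀ X, fderiv ℝ τ y X (τ y w) - ⟪w, fderiv ℝ g y X⟫ • η y = 0) : π y w = τ y w := by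
  rw [← h.π_τ hy]
  refine h.of_null y hy _ (h.τ_τ hy w) fun X => ?_
  rw [sub_eq_zero.1 (hw X), h.τ_symm y hy, h.τ_g y hy]

omit hy in
theorem heq_section (a : Euc q) (z : Euc n) (hz : z ∈ O) (X : Euc n) :
    fderiv ℝ τ z X (π z a) + (0 : ℝ) • fderiv ℝ η z X = ⟪π z a, fderiv ℝ g z X⟫ • η z := by
  rw [zero_smul, add_zero, h.null z hz]

omit hy in
theorem smooth_section (a : Euc q) (z : Euc n) (hz : z ∈ O) : ContDiffAt ℝ ∞ (fun z => π z a) z :=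
  (h.smooth_π z hz).clm_apply contDiffAt_const

theorem fderiv_section (a : Euc q) (X : Euc n) :
    fderiv ℝ (fun z => π z a) y X = fderiv ℝ π y X a := by
  have := ((h.hasFDerivAt_π hy).clm_apply (hasFDerivAt_const a y)).fderiv
  rw [this]; simp

/-- The case `c = 0` of `codazzi_null`, for the section `π a` of the nullity. The right-hand side
depends on `a` and `Z` only through one inner product, and this is the source of umbilicity. -/
theorem fderiv_π_null (a : Euc q) (Z : Euc n) (hZ : π y (fderiv ℝ g y Z) = fderiv ℝ g y Z) (X : Euc n) :
    fderiv ℝ τ y X (τ y (fderiv ℝ π y Z a)) - ⟪fderiv ℝ π y Z a, fderiv ℝ g y X⟫ • η y =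
      -(⟪π y a, fderiv ℝ g y Z⟫ • (fderiv ℝ η y X - τ y (fderiv ℝ η y X))) := by
  have := h.codazzi_null hy (h.smooth_section a) 0 (h.heq_section a) X Z hZ
  rwa [h.fderiv_section hy] at this

theorem normal_fderiv_π (a : Euc q) (Z : Euc n) :
    fderiv ℝ π y Z a - τ y (fderiv ℝ π y Z a) = ⟪π y a, fderiv ℝ g y Z⟫ • η y := by
  have h1 := (h.hasFDerivAt_π hy).clm_apply (hasFDerivAt_const a y)
  have h2 := (h.hasFDerivAt_τ hy).clm_apply h1
  have h3 := h2.congr_of_eventuallyEq (f₁ := fun z => π z a)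
    (by filter_upwards [h.nhds hy] with z hz using (h.τ_π z hz a).symm)
  have h4 := congrArg (fun T => T Z) (h3.unique h1)
  simp at h4
  rw [← h.null y hy]
  nth_rewrite 1 [← h4]
  abel

/-- The difference `w` of the two sides vanishes in each of three parts. The right-hand sides of
`fderiv_π_null` cancel in it, so its tangent part lies in the nullity; its component there is zero
because `π² = π`; its normal part is zero by `normal_fderiv_π`. -/
theorem umbilic_aux (a a' : Euc q) (ha : π y a = a) (ha' : π y a' = a') (Z Z' : Euc n)
    (hZ : π y (fderiv ℝ g y Z) = fderiv ℝ g y Z) (hZ' : π y (fderiv ℝ g y Z') = fderiv ℝ g y Z') :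
    ⟪a', fderiv ℝ g y Z'⟫ • fderiv ℝ π y Z a = ⟪a, fderiv ℝ g y Z⟫ • fderiv ℝ π y Z' a' := by
  rw [← sub_eq_zero]
  set w := ⟪a', fderiv ℝ g y Z'⟫ • fderiv ℝ π y Z a - ⟪a, fderiv ℝ g y Z⟫ • fderiv ℝ π y Z' a' with hw
  have h1 : π y w = τ y w := by
    refine h.π_eq_τ_of_forall hy fun X => ?_
    have e1 := h.fderiv_π_null hy a Z hZ X
    have e2 := h.fderiv_π_null hy a' Z' hZ' X
    rw [ha] at e1
    rw [ha'] at e2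
    have : fderiv ℝ τ y X (τ y w) - ⟪w, fderiv ℝ g y X⟫ • η y =
        ⟪a', fderiv ℝ g y Z'⟫ • (fderiv ℝ τ y X (τ y (fderiv ℝ π y Z a)) -
          ⟪fderiv ℝ π y Z a, fderiv ℝ g y X⟫ • η y) -
        ⟪a, fderiv ℝ g y Z⟫ • (fderiv ℝ τ y X (τ y (fderiv ℝ π y Z' a')) -
          ⟪fderiv ℝ π y Z' a', fderiv ℝ g y X⟫ • η y) := by
      simp only [hw, map_sub, map_smul, inner_sub_left, real_inner_smul_left]
      module
    rw [this, e1, e2]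
    module
  have h2 : π y w = 0 := by
    have e1 := h.fderiv_π_mul hy Z a
    have e2 := h.fderiv_π_mul hy Z' a'
    rw [ha] at e1
    rw [ha'] at e2
    have e3 : π y (fderiv ℝ π y Z a) = 0 := sub_eq_self.1 e1.symm
    have e4 : π y (fderiv ℝ π y Z' a') = 0 := sub_eq_self.1 e2.symm
    simp [hw, e3, e4]
  have h3 : w - τ y w = 0 := by
    have e1 := h.normal_fderiv_π hy a Z
    have e2 := h.normal_fderiv_π hy a' Z'
    rw [ha] at e1
    rw [ha'] at e2
    have : w - τ y w = ⟪a', fderiv ℝ g y Z'⟫ • (fderiv ℝ π y Z a - τ y (fderiv ℝ π y Z a)) -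
        ⟪a, fderiv ℝ g y Z⟫ • (fderiv ℝ π y Z' a' - τ y (fderiv ℝ π y Z' a')) := by
      simp only [hw, map_sub, map_smul]
      module
    rw [this, e1, e2]
    module
  rw [← h1, h2, sub_zero] at h3
  exact h3

theorem g_pinv (a : Euc q) : fderiv ℝ g y (pinv (fderiv ℝ g y) (π y a)) = π y a := by
  obtain ⟨X, hX⟩ := h.τ_range y hy (π y a)
  rw [h.τ_π y hy] at hX
  rw [← hX, pinv_apply_self _ (h.inj y hy)]

theorem sum_pos : 0 < ∑ k, ‖π y (EuclideanSpace.basisFun (Fin q) ℝ k)‖ ^ 2 := by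
  refine (Finset.sum_nonneg fun _ _ => by positivity).lt_of_ne fun h0 => h.π_ne y hy ?_
  have h1 := (Finset.sum_eq_zero_iff_of_nonneg (fun _ _ => by positivity)).1 h0.symm
  have h2 : (π y).toLinearMap = 0 := by
    refine (EuclideanSpace.basisFun (Fin q) ℝ).toBasis.ext fun k => ?_
    have := h1 k (Finset.mem_univ _)
    simpa using this
  ext1 v
  exact LinearMap.congr_fun h2 v

/-- Let `a'` and `Z'` both represent `π e_k` in `umbilic_aux` and sum over an orthonormal basis of
the ambient space. The coefficients add up to `∑ ‖π e_k‖²`, the trace of `π`, which is why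
`meanCurv` divides by it; no local frame of the nullity is needed. -/
theorem umbilic (a : Euc q) (ha : π y a = a) (Z : Euc n)
    (hZ : π y (fderiv ℝ g y Z) = fderiv ℝ g y Z) :
    fderiv ℝ π y Z a = ⟪a, fderiv ℝ g y Z⟫ • meanCurv g π y := by
  have h0 := h.sum_pos hy
  rw [meanCurv, smul_comm, ← inv_smul_eq_iff₀ (inv_ne_zero h0.ne'), inv_inv, Finset.sum_smul,
    Finset.smul_sum]
  refine Finset.sum_congr rfl fun k _ => ?_
  have := h.umbilic_aux hy a (π y (EuclideanSpace.basisFun (Fin q) ℝ k)) ha (h.π_π y hy _) Z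
    (pinv (fderiv ℝ g y) (π y (EuclideanSpace.basisFun (Fin q) ℝ k))) hZ
    (by rw [h.g_pinv hy, h.π_π y hy])
  rwa [h.g_pinv hy, real_inner_self_eq_norm_sq] at this

/-- A unit vector of the nullity. -/
theorem exists_unit : ∃ Z, π y (fderiv ℝ g y Z) = fderiv ℝ g y Z ∧ ⟪fderiv ℝ g y Z, fderiv ℝ g y Z⟫ = 1 := by
  obtain ⟨w, hw⟩ : ∃ w, π y w ≠ 0 := by
    by_contra! hc
    exact h.π_ne y hy (ContinuousLinearMap.ext hc)
  refine ⟨‖π y w‖⁻¹ • pinv (fderiv ℝ g y) (π y w), ?_, ?_⟩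
  · rw [map_smul, h.g_pinv hy, map_smul, h.π_π y hy]
  · rw [map_smul, h.g_pinv hy, real_inner_self_eq_norm_sq, norm_smul, norm_inv, norm_norm,
      inv_mul_cancel₀ (norm_ne_zero_iff.2 hw), one_pow]

theorem π_meanCurv : π y (meanCurv g π y) = 0 := by
  obtain ⟨Z, hZ, hZ1⟩ := h.exists_unit hy
  have e1 := h.fderiv_π_mul hy Z (fderiv ℝ g y Z)
  rw [hZ, h.umbilic hy _ hZ Z hZ, hZ1, one_smul] at e1
  exact sub_eq_self.1 e1.symm

/-- `H = dπ(Z)Z` for a unit vector `Z` of the nullity, and the part of it normal to `g` is the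
second fundamental form on `(Z, Z)`, which is `η`. -/
theorem τ_meanCurv : τ y (meanCurv g π y) = meanCurv g π y - η y := by
  obtain ⟨Z, hZ, hZ1⟩ := h.exists_unit hy
  have e1 := h.normal_fderiv_π hy (fderiv ℝ g y Z) Z
  rw [hZ, h.umbilic hy _ hZ Z hZ, hZ1, one_smul, one_smul] at e1
  rw [← e1]; abel

/-- Apply `fderiv_π_null` to a unit vector of the nullity paired with itself. The resulting equation
is of the form required by `codazzi`, with `ξ = H` and `c = 1`, so the Codazzi argument can be used
a second time. -/
theorem fderiv_τ_meanCurv (X : Euc n) : fderiv ℝ τ y X (meanCurv g π y) + fderiv ℝ η y X =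
    ⟪meanCurv g π y, fderiv ℝ g y X⟫ • η y := by
  obtain ⟨Z, hZ, hZ1⟩ := h.exists_unit hy
  have e1 := h.fderiv_π_null hy (fderiv ℝ g y Z) Z hZ X
  rw [hZ, h.umbilic hy _ hZ Z hZ, hZ1, one_smul, one_smul, h.τ_meanCurv hy, map_sub] at e1
  have e2 := h.fderiv_τ_η hy X
  have e3 : fderiv ℝ τ y X (meanCurv g π y) + fderiv ℝ η y X =
    (fderiv ℝ τ y X (meanCurv g π y) - fderiv ℝ τ y X (η y) -
      ⟪meanCurv g π y, fderiv ℝ g y X⟫ • η y) + (fderiv ℝ τ y X (η y) + τ y (fderiv ℝ η y X)) +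
      (fderiv ℝ η y X - τ y (fderiv ℝ η y X)) + ⟪meanCurv g π y, fderiv ℝ g y X⟫ • η y := by abel
  rw [e3, e1, e2]
  abel

theorem smooth_meanCurv : ContDiffAt ℝ ∞ (meanCurv g π) y := by
  have hπ : ∀ k, ContDiffAt ℝ ∞ (fun z => π z (EuclideanSpace.basisFun (Fin q) ℝ k)) y := fun k =>
    h.smooth_section _ y hy
  have hdπ : ContDiffAt ℝ ∞ (fderiv ℝ π) y := (h.smooth_π y hy).fderiv_right (by simp)
  have hdg : ContDiffAt ℝ ∞ (fderiv ℝ g) y := (h.smooth_g y hy).fderiv_right (by simp)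
  refine ContDiffAt.smul (ContDiffAt.inv (ContDiffAt.sum fun k _ => (hπ k).norm_sq ℝ)
    (h.sum_pos hy).ne') (ContDiffAt.sum fun k _ => ?_)
  exact (hdπ.clm_apply ((hdg.pinv (h.inj y hy)).clm_apply (hπ k))).clm_apply (hπ k)

/-- On `π w` this is umbilicity. On the rest of `w` the derivative takes values in the nullity, and
the symmetry of `dπ(Z)` reduces its value to umbilicity again. -/
theorem fderiv_π_eq (Z : Euc n) (hZ : π y (fderiv ℝ g y Z) = fderiv ℝ g y Z) (w : Euc q) :
    fderiv ℝ π y Z w = ⟪fderiv ℝ g y Z, w⟫ • meanCurv g π y +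
      ⟪meanCurv g π y, w⟫ • fderiv ℝ g y Z := by
  have e1 : fderiv ℝ π y Z (π y w) = ⟪fderiv ℝ g y Z, w⟫ • meanCurv g π y := by
    rw [h.umbilic hy _ (h.π_π y hy w) Z hZ, h.π_symm y hy, hZ, real_inner_comm]
  have e2 : fderiv ℝ π y Z w - fderiv ℝ π y Z (π y w) = ⟪meanCurv g π y, w⟫ • fderiv ℝ g y Z := by
    rw [h.fderiv_π_mul hy, sub_sub_cancel]
    refine ext_inner_right ℝ fun v => ?_
    rw [h.π_symm y hy, h.fderiv_π_symm hy, h.umbilic hy _ (h.π_π y hy v) Z hZ, inner_smul_right,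
      real_inner_smul_left, h.π_symm y hy, hZ, real_inner_comm w, real_inner_comm v, mul_comm]
  rw [← e1, ← e2]; abel

/-- The nullity is spherical. The Codazzi argument for `H` puts the tangent part of `dH(Z)` in the
nullity, differentiating `τ H = H - η` shows that there is no normal part, and differentiating `π H
= 0` gives the component in the nullity. -/
theorem fderiv_meanCurv (Z : Euc n) (hZ : π y (fderiv ℝ g y Z) = fderiv ℝ g y Z) :
    fderiv ℝ (meanCurv g π) y Z = -(‖meanCurv g π y‖ ^ 2 • fderiv ℝ g y Z) := by
  set H := meanCurv g π with hH
  have hHs : ∀ z ∈ O, ContDiffAt ℝ ∞ H z := fun z hz => h.smooth_meanCurv hz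
  have hHd : HasFDerivAt H (fderiv ℝ H y) y := ((hHs y hy).differentiableAt (by simp)).hasFDerivAt
  have hHZ : ⟪H y, fderiv ℝ g y Z⟫ = 0 := by
    rw [← hZ, ← h.π_symm y hy, h.π_meanCurv hy, inner_zero_left]
  have e1 : π y (fderiv ℝ H y Z) = τ y (fderiv ℝ H y Z) := by
    refine h.π_eq_τ_of_forall hy fun X => ?_
    rw [h.codazzi_null hy hHs 1 (fun z hz X => by rw [one_smul]; exact h.fderiv_τ_meanCurv hz X) X Z hZ,
      hHZ, zero_smul, neg_zero]
  have e2 : fderiv ℝ H y Z - τ y (fderiv ℝ H y Z) = 0 := by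
    have h1 := (h.hasFDerivAt_τ hy).clm_apply hHd
    have h2 := hHd.sub (h.hasFDerivAt_η hy)
    have h3 := h1.congr_of_eventuallyEq (f₁ := fun z => H z - η z)
      (by filter_upwards [h.nhds hy] with z hz using (h.τ_meanCurv hz).symm)
    have h4 := congrArg (fun T => T Z) (h3.unique h2)
    simp at h4
    have h5 := h.fderiv_τ_meanCurv hy Z
    rw [hHZ, zero_smul] at h5
    have h6 : fderiv ℝ H y Z - τ y (fderiv ℝ H y Z) = (fderiv ℝ H y Z - fderiv ℝ η y Z) -
      (τ y (fderiv ℝ H y Z) + fderiv ℝ τ y Z (H y)) + (fderiv ℝ τ y Z (H y) + fderiv ℝ η y Z) := by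
      abel
    rw [h6, h4, h5]; abel
  have e3 : π y (fderiv ℝ H y Z) = -(‖H y‖ ^ 2 • fderiv ℝ g y Z) := by
    have h1 := (h.hasFDerivAt_π hy).clm_apply hHd
    have h3 := h1.congr_of_eventuallyEq (f₁ := fun z => (0 : Euc q))
      (by filter_upwards [h.nhds hy] with z hz using (h.π_meanCurv hz).symm)
    have h4 := congrArg (fun T => T Z) (h3.unique (hasFDerivAt_const 0 y))
    simp only [add_apply, ContinuousLinearMap.comp_apply,
      ContinuousLinearMap.flip_apply, zero_apply] at h4
    rw [h.fderiv_π_eq hy Z hZ, real_inner_comm, hHZ, zero_smul, zero_add,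
      real_inner_self_eq_norm_sq] at h4
    exact eq_neg_of_add_eq_zero_left h4
  rw [← e3, e1]
  exact sub_eq_zero.1 e2

end LocalDupin

end Submfd

end

noncomputable section
namespace Submfd
open Filter Topology Set

/-! ### Passage between a manifold and its charts. -/

section Charts

variable {k : ℕ} {M : Type*} [TopologicalSpace M] [ChartedSpace (Euc k) M]
  [IsManifold 𝓘(ℝ, Euc k) ∞ M] {V : Type*} [NormedAddCommGroup V] [NormedSpace ℝ V]

omit [IsManifold 𝓘(ℝ, Euc k) ∞ M] in
theorem contMDiffAt_of_comp_extChartAt_symm {F : M → V} {x : M}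
    (h : ContDiffAt ℝ ∞ (F ∘ (extChartAt 𝓘(ℝ, Euc k) x).symm) (extChartAt 𝓘(ℝ, Euc k) x x)) :
    ContMDiffAt 𝓘(ℝ, Euc k) 𝓘(ℝ, V) ∞ F x := by
  have h1 := h.contMDiffAt.comp x (contMDiffAt_extChartAt (I := 𝓘(ℝ, Euc k)) (x := x) (n := ∞))
  refine h1.congr_of_eventuallyEq ?_
  filter_upwards [extChartAt_source_mem_nhds (I := 𝓘(ℝ, Euc k)) x] with y hy
  simp only [Function.comp_apply, (extChartAt 𝓘(ℝ, Euc k) x).left_inv hy]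

theorem contMDiffAt_extChartAt_symm (x : M) {y : Euc k}
    (hy : y ∈ (extChartAt 𝓘(ℝ, Euc k) x).target) :
    ContMDiffAt 𝓘(ℝ, Euc k) 𝓘(ℝ, Euc k) ∞ (extChartAt 𝓘(ℝ, Euc k) x).symm y :=
  (contMDiffOn_extChartAt_symm x).contMDiffAt ((isOpen_extChartAt_target x).mem_nhds hy)

theorem contDiffAt_comp_extChartAt_symm {F : M → V} (hF : ContMDiff 𝓘(ℝ, Euc k) 𝓘(ℝ, V) ∞ F)
    (x : M) {y : Euc k} (hy : y ∈ (extChartAt 𝓘(ℝ, Euc k) x).target) :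
    ContDiffAt ℝ ∞ (F ∘ (extChartAt 𝓘(ℝ, Euc k) x).symm) y :=
  contMDiffAt_iff_contDiffAt.1 (hF.contMDiffAt.comp y (contMDiffAt_extChartAt_symm x hy))

variable (k) in
/-- The differential of the inverse of the chart at `x`. -/
def chartSymmDeriv (x : M) (y : Euc k) : Euc k →L[ℝ] Euc k :=
  mfderiv 𝓘(ℝ, Euc k) 𝓘(ℝ, Euc k) (extChartAt 𝓘(ℝ, Euc k) x).symm y

theorem chartSymmDeriv_surjective (x : M) {y : Euc k}
    (hy : y ∈ (extChartAt 𝓘(ℝ, Euc k) x).target) : Function.Surjective (chartSymmDeriv k x y) := by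
  have h := isInvertible_mfderivWithin_extChartAt_symm (I := 𝓘(ℝ, Euc k)) (x := x) hy
  rw [ModelWithCorners.range_eq_univ, mfderivWithin_univ] at h
  obtain ⟨e, he⟩ := h
  intro v
  refine ⟨e.symm v, ?_⟩
  change mfderiv 𝓘(ℝ, Euc k) 𝓘(ℝ, Euc k) (extChartAt 𝓘(ℝ, Euc k) x).symm y (e.symm v) = v
  rw [← he]
  exact e.apply_symm_apply v

theorem HasDD.comp_chart_symm {F : M → V} {F' : Euc k →L[ℝ] V} {x : M} {y : Euc k}
    (hy : y ∈ (extChartAt 𝓘(ℝ, Euc k) x).target)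
    (h : HasDD F F' ((extChartAt 𝓘(ℝ, Euc k) x).symm y)) :
    HasFDerivAt (F ∘ (extChartAt 𝓘(ℝ, Euc k) x).symm) (F' ∘L chartSymmDeriv k x y) y := by
  have h3 := (contMDiffAt_extChartAt_symm x hy).mdifferentiableAt (by simp)
  exact (h.hasMFDerivAt.comp y h3.hasMFDerivAt).hasFDerivAt

theorem fderiv_comp_chart_symm {F : M → V} (hF : ContMDiff 𝓘(ℝ, Euc k) 𝓘(ℝ, V) ∞ F)
    (x : M) {y : Euc k} (hy : y ∈ (extChartAt 𝓘(ℝ, Euc k) x).target) :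
    fderiv ℝ (F ∘ (extChartAt 𝓘(ℝ, Euc k) x).symm) y =
      dd k F ((extChartAt 𝓘(ℝ, Euc k) x).symm y) ∘L chartSymmDeriv k x y :=
  (HasDD.comp_chart_symm hy (hF.hasDD _)).fderiv

omit [IsManifold 𝓘(ℝ, Euc k) ∞ M] in
theorem fderiv_comp_chart_symm_self {F : M → V} (hF : ContMDiff 𝓘(ℝ, Euc k) 𝓘(ℝ, V) ∞ F) (x : M) :
    fderiv ℝ (F ∘ (extChartAt 𝓘(ℝ, Euc k) x).symm) (extChartAt 𝓘(ℝ, Euc k) x x) = dd k F x :=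
  HasFDerivAt.fderiv (hF.hasDD x)

end Charts

/-! ### The tangential projection and the second fundamental form. -/

section TangentialProjection

variable {k q : ℕ} {M : Type*} [TopologicalSpace M] [ChartedSpace (Euc k) M]
  [IsManifold 𝓘(ℝ, Euc k) ∞ M] {f : M → Euc q}

variable (k) in
/-- The orthogonal projection onto `f_* T_x M`. -/
def tproj (f : M → Euc q) (x : M) : Euc q →L[ℝ] Euc q :=
  (LinearMap.range (differential k f x).toLinearMap).starProjection

omit [IsManifold 𝓘(ℝ, Euc k) ∞ M] in
theorem normalSpace_starProjection (f : M → Euc q) (x : M) (w : Euc q) :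
    (normalSpace k f x).starProjection w = w - tproj k f x w := by
  rw [normalSpace, Submodule.starProjection_orthogonal]
  rfl

omit [IsManifold 𝓘(ℝ, Euc k) ∞ M] in
theorem tproj_differential (f : M → Euc q) (x : M) (X : Euc k) :
    tproj k f x (dd k f x X) = dd k f x X :=
  Submodule.starProjection_eq_self_iff.2 ⟨X, rfl⟩

omit [IsManifold 𝓘(ℝ, Euc k) ∞ M] in
theorem exists_differential_eq_tproj (f : M → Euc q) (x : M) (w : Euc q) :
    ∃ X, dd k f x X = tproj k f x w :=
  Submodule.starProjection_apply_mem (LinearMap.range (differential k f x).toLinearMap) w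

theorem fderiv_chart_injective (hf : IsSmoothImmersion k f) (x : M) {y : Euc k}
    (hy : y ∈ (extChartAt 𝓘(ℝ, Euc k) x).target) :
    Function.Injective (fderiv ℝ (f ∘ (extChartAt 𝓘(ℝ, Euc k) x).symm) y) := by
  rw [fderiv_comp_chart_symm hf.smooth x hy]
  refine (hf.injective _).comp ?_
  have := chartSymmDeriv_surjective x hy
  exact (LinearMap.injective_iff_surjective (f := (chartSymmDeriv k x y).toLinearMap)).2 this

theorem tproj_chart (hf : IsSmoothImmersion k f) (x : M) {y : Euc k}
    (hy : y ∈ (extChartAt 𝓘(ℝ, Euc k) x).target) :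
    tproj k f ((extChartAt 𝓘(ℝ, Euc k) x).symm y) = (LinearMap.range
      (fderiv ℝ (f ∘ (extChartAt 𝓘(ℝ, Euc k) x).symm) y).toLinearMap).starProjection := by
  rw [tproj]
  congr 1
  rw [fderiv_comp_chart_symm hf.smooth x hy]
  ext w
  constructor
  · rintro ⟨X, rfl⟩
    obtain ⟨Y, rfl⟩ := chartSymmDeriv_surjective x hy X
    exact ⟨Y, rfl⟩
  · rintro ⟨Y, rfl⟩
    exact ⟨_, rfl⟩

theorem contMDiff_tproj (hf : IsSmoothImmersion k f) :
    ContMDiff 𝓘(ℝ, Euc k) 𝓘(ℝ, Euc q →L[ℝ] Euc q) ∞ (tproj k f) := by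
  intro x
  refine contMDiffAt_of_comp_extChartAt_symm ?_
  have hx : ∀ᶠ y in 𝓝 (extChartAt 𝓘(ℝ, Euc k) x x), y ∈ (extChartAt 𝓘(ℝ, Euc k) x).target :=
    extChartAt_target_mem_nhds x
  have h1 : ContDiffAt ℝ ∞ (fderiv ℝ (f ∘ (extChartAt 𝓘(ℝ, Euc k) x).symm))
      (extChartAt 𝓘(ℝ, Euc k) x x) :=
    (contDiffAt_comp_extChartAt_symm hf.smooth x hx.self_of_nhds).fderiv_right (by simp)
  refine (h1.starProjection_range ?_).congr_of_eventuallyEq ?_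
  · filter_upwards [hx] with y hy using fderiv_chart_injective hf x hy
  · filter_upwards [hx] with y hy using tproj_chart hf x hy

/-- For a smooth field `T` tangent to `f`, the normal part of `dT(X)` is `dτ(X) T`. -/
theorem dd_tproj_apply_of_tangent (hf : IsSmoothImmersion k f) {T : M → Euc q} {x : M}
    {T' : Euc k →L[ℝ] Euc q} (hT : HasDD T T' x) (ht : ∀ᶠ y in 𝓝 x, tproj k f y (T y) = T y)
    (X : Euc k) : dd k (tproj k f) x X (T x) = T' X - tproj k f x (T' X) := by
  have h1 := ((contMDiff_tproj hf).hasDD x).clm_apply hT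
  have h2 := h1.congr (G := T) (by filter_upwards [ht] with y hy using hy.symm)
  have h4 := congrArg (fun T => T X) (h2.dd_eq.symm.trans hT.dd_eq)
  simp at h4
  exact eq_sub_of_add_eq' h4

/-- Differentiate `τ (f_* Y) = f_* Y` in the chart at `x`. From here on the second fundamental form
appears as a first derivative of `τ`, free of second derivatives in charts. -/
theorem secondFundamentalForm_eq (hf : IsSmoothImmersion k f) (x : M) (X Y : Euc k) :
    secondFundamentalForm f x X Y = dd k (tproj k f) x X (dd k f x Y) := by
  rw [secondFundamentalForm, normalSpace_starProjection]
  set e := extChartAt 𝓘(ℝ, Euc k) x with he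
  set g := f ∘ e.symm with hg
  have hx : ∀ᶠ y in 𝓝 (e x), y ∈ e.target := extChartAt_target_mem_nhds x
  have h0 : HasFDerivAt (fderiv ℝ g) (fderiv ℝ (fderiv ℝ g) (e x)) (e x) :=
    (((contDiffAt_comp_extChartAt_symm hf.smooth x hx.self_of_nhds).fderiv_right
      (m := ∞) (by simp)).differentiableAt (by simp)).hasFDerivAt
  have h1 := h0.clm_apply (hasFDerivAt_const Y (e x))
  have hτ : HasFDerivAt (tproj k f ∘ e.symm) (dd k (tproj k f) x) (e x) :=
    (contMDiff_tproj hf).hasDD x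
  have h2 := hτ.clm_apply h1
  have h3 := h2.congr_of_eventuallyEq (f₁ := fun z => fderiv ℝ g z Y) (by
    filter_upwards [hx] with y hy
    simp only [Function.comp_apply]
    rw [hg, fderiv_comp_chart_symm hf.smooth x hy]
    exact (tproj_differential f _ _).symm)
  have h4 := congrArg (fun T => T X) (h3.unique h1)
  have h5 : fderiv ℝ g (e x) = dd k f x := fderiv_comp_chart_symm_self hf.smooth x
  have h6 : (tproj k f ∘ e.symm) (e x) = tproj k f x := by
    simp only [Function.comp_apply, he, extChartAt_to_inv]
  rw [h6, h5] at h4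
  simp at h4
  exact eq_sub_of_add_eq' h4 ▸ rfl

theorem secondFundamentalForm_symm (hf : IsSmoothImmersion k f) (x : M) (X Y : Euc k) :
    secondFundamentalForm f x X Y = secondFundamentalForm f x Y X := by
  rw [secondFundamentalForm, secondFundamentalForm,
    ((contDiffAt_comp_extChartAt_symm hf.smooth x
      (mem_extChartAt_target x)).isSymmSndFDerivAt (by simpa using ENat.LEInfty.out)) X Y]

omit [IsManifold 𝓘(ℝ, Euc k) ∞ M] in
theorem normalDeriv_eq (f ξ : M → Euc q) (x : M) (X : Euc k) :
    normalDeriv f ξ x X = dd k ξ x X - tproj k f x (dd k ξ x X) :=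
  normalSpace_starProjection f x _

omit [IsManifold 𝓘(ℝ, Euc k) ∞ M] in
theorem mem_normalSpace_iff (f : M → Euc q) (x : M) (w : Euc q) :
    w ∈ normalSpace k f x ↔ tproj k f x w = 0 := by
  rw [normalSpace, tproj, Submodule.starProjection_apply_eq_zero_iff]

omit [IsManifold 𝓘(ℝ, Euc k) ∞ M] in
theorem tproj_symm (f : M → Euc q) (x : M) (v w : Euc q) :
    ⟪tproj k f x v, w⟫ = ⟪v, tproj k f x w⟫ :=
  Submodule.inner_starProjection_left_eq_right _ _ _

end TangentialProjection

theorem ContDiffAt.of_clm_apply {D E F : Type*} [NormedAddCommGroup D] [NormedSpace ℝ D]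
    [NormedAddCommGroup E] [NormedSpace ℝ E] [FiniteDimensional ℝ E] [NormedAddCommGroup F]
    [NormedSpace ℝ F] {r : WithTop ℕ∞} {f : D → E →L[ℝ] F} {x : D}
    (h : ∀ y, ContDiffAt ℝ r (fun x => f x y) x) : ContDiffAt ℝ r f x := by
  let d := Module.finrank ℝ E
  have hd : d = Module.finrank ℝ (Fin d → ℝ) := (Module.finrank_fin_fun ℝ).symm
  let e₁ := ContinuousLinearEquiv.ofFinrankEq hd
  let e₂ := (e₁.arrowCongr (1 : F ≃L[ℝ] F)).trans (ContinuousLinearEquiv.piRing (Fin d))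
  rw [← Function.id_comp f, ← e₂.symm_comp_self]
  exact e₂.symm.contDiff.contDiffAt.comp x (contDiffAt_pi.mpr fun i => h _)

/-! ### Smoothness of the projection onto the nullity. -/

section NullityProjection

variable {n q s : ℕ} {M : Type*} [TopologicalSpace M] [ChartedSpace (Euc n) M]
  [IsManifold 𝓘(ℝ, Euc n) ∞ M] {f η : M → Euc q}

variable (n) in
/-- The image `f_* E_η(x)` of the nullity. -/
def nullImage (f η : M → Euc q) (x : M) : Submodule ℝ (Euc q) :=
  (nullity n f η x).map (differential n f x).toLinearMap

variable (n) in
/-- The orthogonal projection onto `f_* E_η(x)`. -/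
def nullProj (f η : M → Euc q) (x : M) : Euc q →L[ℝ] Euc q := (nullImage n f η x).starProjection

theorem mem_nullity_iff (hf : IsSmoothImmersion n f) (x : M) (Z : Euc n) :
    Z ∈ nullity n f η x ↔
      ∀ X, dd n (tproj n f) x X (dd n f x Z) = ⟪dd n f x Z, dd n f x X⟫ • η x := by
  refine forall_congr' fun X => ?_
  rw [secondFundamentalForm_symm hf, secondFundamentalForm_eq hf]
  rfl

/-- These conditions are linear in the ambient vector `w` and have smooth coefficients, so `f_* E_η`
is a kernel of constant rank. -/
theorem mem_nullImage_iff (hf : IsSmoothImmersion n f) (x : M) (w : Euc q) :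
    w ∈ nullImage n f η x ↔ tproj n f x w = w ∧
      ∀ X, dd n (tproj n f) x X w = ⟪w, dd n f x X⟫ • η x := by
  constructor
  · rintro ⟨Z, hZ, rfl⟩
    exact ⟨tproj_differential f x Z, (mem_nullity_iff hf x Z).1 hZ⟩
  · rintro ⟨h1, h2⟩
    obtain ⟨Z, hZ⟩ := exists_differential_eq_tproj (k := n) f x w
    rw [h1] at hZ
    refine ⟨Z, (mem_nullity_iff hf x Z).2 fun X => ?_, hZ⟩
    rw [hZ]; exact h2 X

theorem differential_mem_nullImage_iff (hf : IsSmoothImmersion n f) (x : M) (Z : Euc n) :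
    dd n f x Z ∈ nullImage n f η x ↔ Z ∈ nullity n f η x := by
  rw [mem_nullImage_iff hf, mem_nullity_iff hf]
  exact ⟨fun h => h.2, fun h => ⟨tproj_differential f x Z, h⟩⟩

omit [IsManifold 𝓘(ℝ, Euc n) ∞ M] in
theorem finrank_nullImage (hf : IsSmoothImmersion n f) (hη : IsDupinPrincipalNormal n f η s) (x : M) :
    Module.finrank ℝ (nullImage n f η x) = s := by
  rw [← hη.multiplicity x, nullImage]
  exact LinearEquiv.finrank_eq (Submodule.equivMapOfInjective _ (hf.injective x) _).symm

/-- The operator of which `f_* E_η` is the kernel, in local coordinates. -/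
def nullOperator (g : Euc n → Euc q) (τ : Euc n → Euc q →L[ℝ] Euc q) (η : Euc n → Euc q)
    (y : Euc n) : Euc q →L[ℝ] (Euc n →L[ℝ] Euc q) × Euc q :=
  LinearMap.toContinuousLinearMap
    { toFun := fun w => ((fderiv ℝ τ y).flip w - ((innerSL ℝ w) ∘L fderiv ℝ g y).smulRight (η y),
        w - τ y w)
      map_add' := fun v w => by
        refine Prod.ext ?_ ?_
        · ext1 X
          simp [add_smul]; abel
        · simp; abel
      map_smul' := fun c w => by
        refine Prod.ext ?_ ?_
        · ext1 X
          simp [smul_sub, smul_smul]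
        · simp [smul_sub] }

theorem contMDiff_nullProj (hf : IsSmoothImmersion n f) (hη : IsDupinPrincipalNormal n f η s) :
    ContMDiff 𝓘(ℝ, Euc n) 𝓘(ℝ, Euc q →L[ℝ] Euc q) ∞ (nullProj n f η) := by
  intro x
  refine contMDiffAt_of_comp_extChartAt_symm ?_
  set e := extChartAt 𝓘(ℝ, Euc n) x with he
  have hx : ∀ᶠ y in 𝓝 (e x), y ∈ e.target := extChartAt_target_mem_nhds x
  have hτ := contMDiff_tproj hf
  have hA : ContDiffAt ℝ ∞ (nullOperator (f ∘ e.symm) (tproj n f ∘ e.symm) (η ∘ e.symm)) (e x) := by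
    have h1 : ContDiffAt ℝ ∞ (tproj n f ∘ e.symm) (e x) :=
      contDiffAt_comp_extChartAt_symm hτ x hx.self_of_nhds
    have h2 : ContDiffAt ℝ ∞ (fderiv ℝ (tproj n f ∘ e.symm)) (e x) := h1.fderiv_right (by simp)
    have h3 : ContDiffAt ℝ ∞ (fderiv ℝ (f ∘ e.symm)) (e x) :=
      (contDiffAt_comp_extChartAt_symm hf.smooth x hx.self_of_nhds).fderiv_right (by simp)
    have h4 : ContDiffAt ℝ ∞ (η ∘ e.symm) (e x) :=
      contDiffAt_comp_extChartAt_symm hη.isSection.smooth x hx.self_of_nhds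
    refine ContDiffAt.of_clm_apply ?_
    intro w
    refine ContDiffAt.prodMk ?_ (contDiffAt_const.sub (h1.clm_apply contDiffAt_const))
    refine ContDiffAt.of_clm_apply ?_
    intro X
    exact ((h2.clm_apply contDiffAt_const).clm_apply contDiffAt_const).sub
      ((contDiffAt_const.inner ℝ (h3.clm_apply contDiffAt_const)).smul h4)
  refine hA.starProjection_ker (s := s) (fun y => nullImage n f η (e.symm y)) ?_ ?_
  · filter_upwards [hx] with y hy
    ext w
    have hT := chartSymmDeriv_surjective x hy
    rw [mem_nullImage_iff hf, LinearMap.mem_ker, and_comm]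
    change _ ↔ ((fderiv ℝ (tproj n f ∘ e.symm) y).flip w - ((innerSL ℝ w) ∘L
      fderiv ℝ (f ∘ e.symm) y).smulRight (η (e.symm y)), w - tproj n f (e.symm y) w) = (0, 0)
    rw [Prod.mk.injEq, fderiv_comp_chart_symm hτ x hy, fderiv_comp_chart_symm hf.smooth x hy,
      sub_eq_zero (b := tproj n f (e.symm y) w), eq_comm (a := w)]
    refine and_congr ⟨fun h => ?_, fun h X => ?_⟩ Iff.rfl
    · ext1 X
      exact sub_eq_zero.2 (h _)
    · obtain ⟨Y, rfl⟩ := hT X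
      exact sub_eq_zero.1 (congrArg (fun T => T Y) h)
  · exact Eventually.of_forall fun y => finrank_nullImage hf hη _

end NullityProjection

end Submfd

end

/-! ### The structure equations on the manifold. -/

noncomputable section
namespace Submfd
open Filter Topology Set

/-- The fields attached to a Dupin principal normal `η` of the immersion `f`: the projection `τ`
onto the tangent spaces, the projection `π` onto the nullity of `η`, the mean curvature vector
field `H` of the nullity distribution, and their first order equations. -/
structure DupinFields (n : ℕ) {q : ℕ} {M : Type*} [TopologicalSpace M] [ChartedSpace (Euc n) M]
    (f η : M → Euc q) (τ π : M → Euc q →L[ℝ] Euc q) (H : M → Euc q) : Prop where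
  smooth_f : ContMDiff 𝓘(ℝ, Euc n) 𝓘(ℝ, Euc q) ∞ f
  smooth_η : ContMDiff 𝓘(ℝ, Euc n) 𝓘(ℝ, Euc q) ∞ η
  smooth_τ : ContMDiff 𝓘(ℝ, Euc n) 𝓘(ℝ, Euc q →L[ℝ] Euc q) ∞ τ
  smooth_π : ContMDiff 𝓘(ℝ, Euc n) 𝓘(ℝ, Euc q →L[ℝ] Euc q) ∞ π
  smooth_H : ContMDiff 𝓘(ℝ, Euc n) 𝓘(ℝ, Euc q) ∞ H
  inj : ∀ x, Function.Injective (dd n f x)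
  τ_f : ∀ x X, τ x (dd n f x X) = dd n f x X
  τ_range : ∀ x w, ∃ X, dd n f x X = τ x w
  τ_symm : ∀ x v w, ⟪τ x v, w⟫ = ⟪v, τ x w⟫
  π_symm : ∀ x v w, ⟪π x v, w⟫ = ⟪v, π x w⟫
  π_π : ∀ x w, π x (π x w) = π x w
  τ_π : ∀ x w, τ x (π x w) = π x w
  τ_η : ∀ x, τ x (η x) = 0
  π_H : ∀ x, π x (H x) = 0
  τ_H : ∀ x, τ x (H x) = H x - η x
  null : ∀ x w X, dd n τ x X (π x w) = ⟪π x w, dd n f x X⟫ • η x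
  of_null : ∀ x w, τ x w = w → (∀ X, dd n τ x X w = ⟪w, dd n f x X⟫ • η x) → π x w = w
  dτ_symm : ∀ x X Y, dd n τ x X (dd n f x Y) = dd n τ x Y (dd n f x X)
  dτ_H : ∀ x X, dd n τ x X (H x) + dd n η x X = ⟪H x, dd n f x X⟫ • η x
  dπ : ∀ x Z, π x (dd n f x Z) = dd n f x Z → ∀ w,
    dd n π x Z w = ⟪dd n f x Z, w⟫ • H x + ⟪H x, w⟫ • dd n f x Z
  dH : ∀ x Z, π x (dd n f x Z) = dd n f x Z → dd n H x Z = -(‖H x‖ ^ 2 • dd n f x Z)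

variable {n q s : ℕ} {M : Type*} [TopologicalSpace M] [ChartedSpace (Euc n) M]
  [IsManifold 𝓘(ℝ, Euc n) ∞ M] {f η : M → Euc q}

variable (n) in
/-- The mean curvature vector field of the nullity distribution. -/
def nullMeanCurv (f η : M → Euc q) (x : M) : Euc q :=
  (∑ k, ‖nullProj n f η x (EuclideanSpace.basisFun (Fin q) ℝ k)‖ ^ 2)⁻¹ •
    ∑ k, dd n (nullProj n f η) x
      (pinv (dd n f x) (nullProj n f η x (EuclideanSpace.basisFun (Fin q) ℝ k)))
      (nullProj n f η x (EuclideanSpace.basisFun (Fin q) ℝ k))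

omit [IsManifold 𝓘(ℝ, Euc n) ∞ M] in
theorem nullProj_symm (f η : M → Euc q) (x : M) (v w : Euc q) :
    ⟪nullProj n f η x v, w⟫ = ⟪v, nullProj n f η x w⟫ :=
  Submodule.inner_starProjection_left_eq_right _ _ _

omit [IsManifold 𝓘(ℝ, Euc n) ∞ M] in
theorem nullProj_mem (f η : M → Euc q) (x : M) (w : Euc q) :
    nullProj n f η x w ∈ nullImage n f η x :=
  Submodule.starProjection_apply_mem _ w

omit [IsManifold 𝓘(ℝ, Euc n) ∞ M] in
theorem nullProj_eq_self_iff {x : M} {w : Euc q} :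
    nullProj n f η x w = w ↔ w ∈ nullImage n f η x :=
  Submodule.starProjection_eq_self_iff

/-- In a whole chart domain, where second derivatives can be taken and exchanged, all tangent
vectors are related to those of `M` by the invertible differential of the inverse chart. -/
theorem localDupin_chart (hf : IsSmoothImmersion n f) (hη : IsDupinPrincipalNormal n f η s) (x : M) :
    LocalDupin (extChartAt 𝓘(ℝ, Euc n) x).target (f ∘ (extChartAt 𝓘(ℝ, Euc n) x).symm)
      (tproj n f ∘ (extChartAt 𝓘(ℝ, Euc n) x).symm) (nullProj n f η ∘ (extChartAt 𝓘(ℝ, Euc n) x).symm)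
      (η ∘ (extChartAt 𝓘(ℝ, Euc n) x).symm) where
  isOpen := isOpen_extChartAt_target x
  smooth_g y hy := contDiffAt_comp_extChartAt_symm hf.smooth x hy
  smooth_τ y hy := contDiffAt_comp_extChartAt_symm (contMDiff_tproj hf) x hy
  smooth_π y hy := contDiffAt_comp_extChartAt_symm (contMDiff_nullProj hf hη) x hy
  smooth_η y hy := contDiffAt_comp_extChartAt_symm hη.isSection.smooth x hy
  inj y hy := fderiv_chart_injective hf x hy
  τ_g y hy X := by
    rw [fderiv_comp_chart_symm hf.smooth x hy]
    exact tproj_differential f _ _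
  τ_range y hy w := by
    obtain ⟨X, hX⟩ := exists_differential_eq_tproj (k := n) f
      ((extChartAt 𝓘(ℝ, Euc n) x).symm y) w
    obtain ⟨Y, rfl⟩ := chartSymmDeriv_surjective x hy X
    rw [fderiv_comp_chart_symm hf.smooth x hy]
    exact ⟨Y, hX⟩
  τ_symm y _ := tproj_symm f _
  τ_η y _ := (mem_normalSpace_iff f _ _).1 (hη.isSection.mem _)
  π_symm y _ := nullProj_symm f η _
  π_π y _ w := nullProj_eq_self_iff.2 (nullProj_mem f η _ w)
  τ_π y _ w := ((mem_nullImage_iff hf _ _).1 (nullProj_mem f η _ w)).1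
  null y hy w X := by
    rw [fderiv_comp_chart_symm hf.smooth x hy, fderiv_comp_chart_symm (contMDiff_tproj hf) x hy]
    exact ((mem_nullImage_iff hf _ _).1 (nullProj_mem f η _ w)).2 _
  of_null y hy w hw h := by
    refine nullProj_eq_self_iff.2 ((mem_nullImage_iff hf _ _).2 ⟨hw, fun X => ?_⟩)
    obtain ⟨Y, rfl⟩ := chartSymmDeriv_surjective x hy X
    have := h Y
    rwa [fderiv_comp_chart_symm hf.smooth x hy, fderiv_comp_chart_symm (contMDiff_tproj hf) x hy] at this
  dupin y hy Z hZ := by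
    rw [fderiv_comp_chart_symm hf.smooth x hy] at hZ
    rw [fderiv_comp_chart_symm hη.isSection.smooth x hy]
    have h1 := hη.parallel _ _ ((differential_mem_nullImage_iff hf _ _).1 (nullProj_eq_self_iff.1 hZ))
    rw [normalDeriv_eq, sub_eq_zero] at h1
    exact h1.symm
  π_ne y _ h0 := by
    have h1 := finrank_nullImage hf hη ((extChartAt 𝓘(ℝ, Euc n) x).symm y)
    have h2 : nullImage n f η ((extChartAt 𝓘(ℝ, Euc n) x).symm y) = ⊥ := by
      rw [eq_bot_iff]
      intro w hw
      rw [← nullProj_eq_self_iff] at hw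
      rw [Submodule.mem_bot, ← hw]
      exact congrArg (fun T => T w) h0
    rw [h2, finrank_bot] at h1
    have := hη.one_le
    omega

/-- The tangent vector representing `π e_k` changes with the coordinates by the differential of the
chart, and the directional derivative of `π` along it does not change. -/
theorem meanCurv_chart (hf : IsSmoothImmersion n f) (hη : IsDupinPrincipalNormal n f η s) (x : M)
    {y : Euc n} (hy : y ∈ (extChartAt 𝓘(ℝ, Euc n) x).target) :
    meanCurv (f ∘ (extChartAt 𝓘(ℝ, Euc n) x).symm)
      (nullProj n f η ∘ (extChartAt 𝓘(ℝ, Euc n) x).symm) y =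
    nullMeanCurv n f η ((extChartAt 𝓘(ℝ, Euc n) x).symm y) := by
  rw [meanCurv, nullMeanCurv]
  refine congrArg₂ _ rfl (Finset.sum_congr rfl fun k _ => ?_)
  set a := EuclideanSpace.basisFun (Fin q) ℝ k
  set p := (extChartAt 𝓘(ℝ, Euc n) x).symm y with hp
  have h1 := (localDupin_chart hf hη x).g_pinv hy a
  set v := pinv (fderiv ℝ (f ∘ (extChartAt 𝓘(ℝ, Euc n) x).symm) y)
    ((nullProj n f η ∘ (extChartAt 𝓘(ℝ, Euc n) x).symm) y a) with hv
  rw [fderiv_comp_chart_symm (contMDiff_nullProj hf hη) x hy]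
  rw [fderiv_comp_chart_symm hf.smooth x hy] at h1
  have h2 : pinv (dd n f p) (nullProj n f η p a) = chartSymmDeriv n x y v := by
    rw [← pinv_apply_self (dd n f p) (hf.injective p) (chartSymmDeriv n x y v)]
    exact congrArg _ h1.symm
  rw [h2]
  rfl

/-- Each identity is the local one at the centre of the chart at `x`, where derivatives in the chart
are by definition the differentials at `x`. -/
theorem dupinFields (hf : IsSmoothImmersion n f) (hη : IsDupinPrincipalNormal n f η s) :
    DupinFields n f η (tproj n f) (nullProj n f η) (nullMeanCurv n f η) := by
  have hτ := contMDiff_tproj hf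
  have hπ := contMDiff_nullProj hf hη
  have hx : ∀ x : M, extChartAt 𝓘(ℝ, Euc n) x x ∈ (extChartAt 𝓘(ℝ, Euc n) x).target :=
    fun x => mem_extChartAt_target x
  have hmc : ∀ x : M, meanCurv (f ∘ (extChartAt 𝓘(ℝ, Euc n) x).symm)
      (nullProj n f η ∘ (extChartAt 𝓘(ℝ, Euc n) x).symm) (extChartAt 𝓘(ℝ, Euc n) x x) =
      nullMeanCurv n f η x := fun x => by
    rw [meanCurv_chart hf hη x (hx x), extChartAt_to_inv]
  have hev : ∀ x : M, (nullMeanCurv n f η ∘ (extChartAt 𝓘(ℝ, Euc n) x).symm) =ᶠ[𝓝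
      (extChartAt 𝓘(ℝ, Euc n) x x)] meanCurv (f ∘ (extChartAt 𝓘(ℝ, Euc n) x).symm)
      (nullProj n f η ∘ (extChartAt 𝓘(ℝ, Euc n) x).symm) := fun x => by
    filter_upwards [extChartAt_target_mem_nhds (I := 𝓘(ℝ, Euc n)) x] with y hy
    exact (meanCurv_chart hf hη x hy).symm
  have hH : ContMDiff 𝓘(ℝ, Euc n) 𝓘(ℝ, Euc q) ∞ (nullMeanCurv n f η) := fun x =>
    contMDiffAt_of_comp_extChartAt_symm
      (((localDupin_chart hf hη x).smooth_meanCurv (hx x)).congr_of_eventuallyEq (hev x))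
  have hdH : ∀ x : M, fderiv ℝ (meanCurv (f ∘ (extChartAt 𝓘(ℝ, Euc n) x).symm)
      (nullProj n f η ∘ (extChartAt 𝓘(ℝ, Euc n) x).symm)) (extChartAt 𝓘(ℝ, Euc n) x x) =
      dd n (nullMeanCurv n f η) x := fun x => by
    rw [← (hev x).fderiv_eq]
    exact fderiv_comp_chart_symm_self hH x
  have e1 := fun x : M => fderiv_comp_chart_symm_self hf.smooth x
  have e2 := fun x : M => fderiv_comp_chart_symm_self hτ x
  have e3 := fun x : M => fderiv_comp_chart_symm_self hπ x
  have e4 := fun x : M => fderiv_comp_chart_symm_self hη.isSection.smooth x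
  have c : ∀ {A : Type} (F : M → A) (x : M),
      (F ∘ (extChartAt 𝓘(ℝ, Euc n) x).symm) (extChartAt 𝓘(ℝ, Euc n) x x) = F x := fun F x => by
    rw [Function.comp_apply, extChartAt_to_inv]
  refine
  { smooth_f := hf.smooth
    smooth_η := hη.isSection.smooth
    smooth_τ := hτ
    smooth_π := hπ
    smooth_H := hH
    inj := hf.injective
    τ_f := fun x X => tproj_differential f x X
    τ_range := fun x w => exists_differential_eq_tproj f x w
    τ_symm := tproj_symm f
    π_symm := nullProj_symm f η
    π_π := fun x w => nullProj_eq_self_iff.2 (nullProj_mem f η _ w)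
    τ_π := fun x w => ((mem_nullImage_iff hf _ _).1 (nullProj_mem f η _ w)).1
    τ_η := fun x => (mem_normalSpace_iff f _ _).1 (hη.isSection.mem _)
    π_H := fun x => by
      have := (localDupin_chart hf hη x).π_meanCurv (hx x)
      rwa [hmc, c] at this
    τ_H := fun x => by
      have := (localDupin_chart hf hη x).τ_meanCurv (hx x)
      rwa [hmc, c, c] at this
    null := fun x w X => ((mem_nullImage_iff hf _ _).1 (nullProj_mem f η _ w)).2 _
    of_null := fun x w h1 h2 => nullProj_eq_self_iff.2 ((mem_nullImage_iff hf _ _).2 ⟨h1, h2⟩)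
    dτ_symm := fun x X Y => by
      have := (localDupin_chart hf hη x).fderiv_τ_symm (hx x) X Y
      rwa [e1, e2] at this
    dτ_H := fun x X => by
      have := (localDupin_chart hf hη x).fderiv_τ_meanCurv (hx x) X
      rwa [e1, e2, e4, hmc, c] at this
    dπ := fun x Z hZ w => by
      have := (localDupin_chart hf hη x).fderiv_π_eq (hx x) Z (by rwa [e1, c]) w
      rwa [e1, e3, hmc] at this
    dH := fun x Z hZ => by
      have := (localDupin_chart hf hη x).fderiv_meanCurv (hx x) Z (by rwa [e1, c])
      rwa [e1, hmc, hdH] at this }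

end Submfd

end

/-! ### Restriction of the structure equations to a leaf of the conullity. -/

noncomputable section
namespace Submfd
open Filter Topology Set

/-- The restrictions to an integral manifold `h` of the conullity of the fields attached to a Dupin
principal normal `η`. -/
structure LeafFields (m : ℕ) {q : ℕ} {L : Type*} [TopologicalSpace L] [ChartedSpace (Euc m) L]
    (h η : L → Euc q) (τ π : L → Euc q →L[ℝ] Euc q) (H : L → Euc q) : Prop where
  smooth_h : ContMDiff 𝓘(ℝ, Euc m) 𝓘(ℝ, Euc q) ∞ h
  smooth_η : ContMDiff 𝓘(ℝ, Euc m) 𝓘(ℝ, Euc q) ∞ η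
  smooth_τ : ContMDiff 𝓘(ℝ, Euc m) 𝓘(ℝ, Euc q →L[ℝ] Euc q) ∞ τ
  smooth_π : ContMDiff 𝓘(ℝ, Euc m) 𝓘(ℝ, Euc q →L[ℝ] Euc q) ∞ π
  smooth_H : ContMDiff 𝓘(ℝ, Euc m) 𝓘(ℝ, Euc q) ∞ H
  inj : ∀ x, Function.Injective (dd m h x)
  τ_h : ∀ x X, τ x (dd m h x X) = dd m h x X
  π_h : ∀ x X, π x (dd m h x X) = 0
  range : ∀ x w, τ x w = w → π x w = 0 → ∃ X, dd m h x X = w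
  τ_symm : ∀ x v w, ⟪τ x v, w⟫ = ⟪v, τ x w⟫
  π_symm : ∀ x v w, ⟪π x v, w⟫ = ⟪v, π x w⟫
  τ_τ : ∀ x w, τ x (τ x w) = τ x w
  π_π : ∀ x w, π x (π x w) = π x w
  τ_π : ∀ x w, τ x (π x w) = π x w
  τ_η : ∀ x, τ x (η x) = 0
  π_H : ∀ x, π x (H x) = 0
  τ_H : ∀ x, τ x (H x) = H x - η x
  dτ_π : ∀ x w X, dd m τ x X (π x w) = 0
  eq_zero : ∀ x w, τ x w = w → π x w = 0 →
    (∀ X, dd m τ x X w = ⟪w, dd m h x X⟫ • η x) → w = 0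
  dτ_H : ∀ x X, dd m τ x X (H x) + dd m η x X = ⟪H x, dd m h x X⟫ • η x

/-- The differential of a map between manifolds. -/
def mdd (m n : ℕ) {L M : Type*} [TopologicalSpace L] [ChartedSpace (Euc m) L] [TopologicalSpace M]
    [ChartedSpace (Euc n) M] (j : L → M) (u : L) : Euc m →L[ℝ] Euc n :=
  mfderiv 𝓘(ℝ, Euc m) 𝓘(ℝ, Euc n) j u

section OfDupin

variable {n m q s : ℕ} {M : Type*} [TopologicalSpace M] [ChartedSpace (Euc n) M]
  {f η : M → Euc q} {L : Type*} [TopologicalSpace L] [ChartedSpace (Euc m) L] {j : L → M}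
  {τ π : M → Euc q →L[ℝ] Euc q} {H : M → Euc q}

namespace DupinFields

theorem τ_τ (D : DupinFields n f η τ π H) (x : M) (w : Euc q) : τ x (τ x w) = τ x w := by
  obtain ⟨X, hX⟩ := D.τ_range x w
  rw [← hX, D.τ_f]

theorem exists_dd_eq_π (D : DupinFields n f η τ π H) (x : M) (w : Euc q) :
    ∃ Z, dd n f x Z = π x w := by
  obtain ⟨Z, hZ⟩ := D.τ_range x (π x w)
  exact ⟨Z, hZ.trans (D.τ_π x w)⟩

end DupinFields

variable (n) in
/-- The integral manifolds of the kernel of `π ∘ f_*`. -/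
structure IsLeaf (m : ℕ) {L : Type*} [TopologicalSpace L] [ChartedSpace (Euc m) L]
    (f : M → Euc q) (π : M → Euc q →L[ℝ] Euc q) (j : L → M) : Prop where
  smooth : ContMDiff 𝓘(ℝ, Euc m) 𝓘(ℝ, Euc n) ∞ j
  inj : ∀ u, Function.Injective (mdd m n j u)
  range_iff : ∀ u Y, (∃ X : Euc m, mdd m n j u X = Y) ↔
    π (j u) (dd n f (j u) Y) = 0

theorem mem_conullity_iff (f η : M → Euc q) (x : M) (Y : Euc n) :
    Y ∈ conullity n f η x ↔ nullProj n f η x (dd n f x Y) = 0 := by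
  rw [nullProj, Submodule.starProjection_apply_eq_zero_iff, Submodule.mem_orthogonal']
  constructor
  · rintro h _ ⟨Z, hZ, rfl⟩
    exact h Z hZ
  · intro h Z hZ
    exact h _ ⟨Z, hZ, rfl⟩

theorem IsIntegralManifold.isLeaf (hj : IsIntegralManifold m (conullity n f η) j) :
    IsLeaf n m f (nullProj n f η) j where
  smooth := hj.smooth
  inj := hj.injective
  range_iff u Y := by
    exact (SetLike.ext_iff.1 (hj.range_eq u) Y).trans (mem_conullity_iff f η (j u) Y)

theorem dd_comp {V : Type*} [NormedAddCommGroup V] [NormedSpace ℝ V] {F : M → V}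
    (hF : ContMDiff 𝓘(ℝ, Euc n) 𝓘(ℝ, V) ∞ F)
    (hj : ContMDiff 𝓘(ℝ, Euc m) 𝓘(ℝ, Euc n) ∞ j) (u : L) (X : Euc m) :
    dd m (F ∘ j) u X = dd n F (j u) (mdd m n j u X) := by
  have h1 := (hF.hasDD (j u)).comp_right (hj.mdifferentiable (by simp) u).hasMFDerivAt
  have h2 : dd m (F ∘ j) u = _ := h1.dd_eq
  rw [h2]
  rfl

theorem DupinFields.leafFields (D : DupinFields n f η τ π H) (hj : IsLeaf n m f π j) :
    LeafFields m (f ∘ j) (η ∘ j) (τ ∘ j) (π ∘ j) (H ∘ j) where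
  smooth_h := D.smooth_f.comp hj.smooth
  smooth_η := D.smooth_η.comp hj.smooth
  smooth_τ := D.smooth_τ.comp hj.smooth
  smooth_π := D.smooth_π.comp hj.smooth
  smooth_H := D.smooth_H.comp hj.smooth
  inj u X Y h := by
    rw [dd_comp D.smooth_f hj.smooth, dd_comp D.smooth_f hj.smooth] at h
    exact hj.inj u (D.inj _ h)
  τ_h u X := by rw [dd_comp D.smooth_f hj.smooth]; exact D.τ_f _ _
  π_h u X := by
    rw [dd_comp D.smooth_f hj.smooth]
    exact (hj.range_iff u _).1 ⟨X, rfl⟩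
  range u w h1 h2 := by
    obtain ⟨Y, hY⟩ := D.τ_range (j u) w
    rw [show τ (j u) w = w from h1] at hY
    obtain ⟨X, hX⟩ := (hj.range_iff u Y).2 (by rw [hY]; exact h2)
    exact ⟨X, by rw [dd_comp D.smooth_f hj.smooth, hX, hY]⟩
  τ_symm u := D.τ_symm _
  π_symm u := D.π_symm _
  τ_τ u := D.τ_τ _
  π_π u := D.π_π _
  τ_π u := D.τ_π _
  τ_η u := D.τ_η _
  π_H u := D.π_H _
  τ_H u := D.τ_H _
  dτ_π u w X := by
    rw [dd_comp D.smooth_τ hj.smooth]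
    refine (D.null _ _ _).trans ?_
    rw [D.π_symm, (hj.range_iff u _).1 ⟨X, rfl⟩, inner_zero_right, zero_smul]
  eq_zero u w h1 h2 h3 := by
    obtain ⟨Y, hY⟩ := D.τ_range (j u) w
    rw [show τ (j u) w = w from h1] at hY
    refine (D.of_null (j u) w h1 fun X => ?_).symm.trans h2
    -- Split `X` into a leaf direction and a nullity direction `Z`. Along `Z` the nullity equation
    -- for `w` is automatic, by symmetry of the second fundamental form. So `w` lies in the nullity
    -- as well as in the conullity, and vanishes.
    obtain ⟨Z, hZ⟩ := D.exists_dd_eq_π (j u) (dd n f (j u) X)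
    obtain ⟨X', hX'⟩ := (hj.range_iff u (X - Z)).2 (by
      rw [map_sub, hZ, map_sub, D.π_π, sub_self])
    have e1 : X = mdd m n j u X' + Z := by rw [hX']; abel
    have e2 := h3 X'
    rw [dd_comp D.smooth_τ hj.smooth, dd_comp D.smooth_f hj.smooth] at e2
    have e3 : dd n τ (j u) Z w = ⟪w, dd n f (j u) Z⟫ • η (j u) := by
      rw [← hY, D.dτ_symm, hZ, D.null, real_inner_comm]
    rw [e1, map_add, map_add, inner_add_right, add_smul, ← e3]
    exact congrArg (· + _) e2
  dτ_H u X := by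
    rw [dd_comp D.smooth_τ hj.smooth, dd_comp D.smooth_f hj.smooth, dd_comp D.smooth_η hj.smooth]
    exact D.dτ_H _ _

end OfDupin

namespace LeafFields

variable {m q s : ℕ} {L : Type*} [TopologicalSpace L] [ChartedSpace (Euc m) L]
  {h η : L → Euc q} {τ π : L → Euc q →L[ℝ] Euc q} {H : L → Euc q}

theorem π_τ (D : LeafFields m h η τ π H) (x : L) (w : Euc q) : π x (τ x w) = π x w := by
  refine ext_inner_right ℝ fun v => ?_
  rw [D.π_symm, D.τ_symm, D.τ_π, D.π_symm]

theorem π_η (D : LeafFields m h η τ π H) (x : L) : π x (η x) = 0 := by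
  rw [← D.π_τ, D.τ_η, map_zero]

theorem inner_h (D : LeafFields m h η τ π H) (x : L) {w : Euc q} (hw : π x w = w) (X : Euc m) :
    ⟪w, dd m h x X⟫ = 0 := by
  rw [← hw, D.π_symm, D.π_h, inner_zero_right]

theorem inner_H (D : LeafFields m h η τ π H) (x : L) {w : Euc q} (hw : π x w = w) :
    ⟪w, H x⟫ = 0 := by
  rw [← hw, D.π_symm, D.π_H, inner_zero_right]

theorem inner_η_h (D : LeafFields m h η τ π H) (x : L) (X : Euc m) :
    ⟪η x, dd m h x X⟫ = 0 := by
  rw [← D.τ_h, ← D.τ_symm, D.τ_η, inner_zero_left]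

theorem dτ_mul (D : LeafFields m h η τ π H) (x : L) (X : Euc m) (w : Euc q) :
    dd m τ x X (τ x w) = dd m τ x X w - τ x (dd m τ x X w) := by
  have h1 := (D.smooth_τ.hasDD x).clm_apply (HasDD.const w x)
  have h2 := (D.smooth_τ.hasDD x).clm_apply h1
  have h3 := h2.congr (G := fun y => τ y w) (Eventually.of_forall fun y => (D.τ_τ y w).symm)
  have h4 := congrArg (fun T => T X) (h3.dd_eq.symm.trans h1.dd_eq)
  simp at h4
  exact eq_sub_of_add_eq' h4

theorem dτ_η (D : LeafFields m h η τ π H) (x : L) (X : Euc m) :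
    dd m τ x X (η x) = -τ x (dd m η x X) := by
  have h2 := (D.smooth_τ.hasDD x).clm_apply (D.smooth_η.hasDD x)
  have h3 := h2.congr (G := fun y => 0) (Eventually.of_forall fun y => (D.τ_η y).symm)
  have h4 := congrArg (fun T => T X) (h3.dd_eq.symm.trans (HasDD.const 0 x).dd_eq)
  simp at h4
  exact eq_neg_of_add_eq_zero_right h4

/-- The differential of a section of `N` has no component normal to `f`. -/
theorem τ_dd_section (D : LeafFields m h η τ π H) {b : L → Euc q} {b' : Euc m →L[ℝ] Euc q} {x : L}
    (hb : HasDD b b' x) (hπ : ∀ᶠ y in 𝓝 x, π y (b y) = b y) (X : Euc m) : τ x (b' X) = b' X := by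
  have h2 := (D.smooth_τ.hasDD x).clm_apply hb
  have h3 := h2.congr (G := b) (by
    filter_upwards [hπ] with y hy
    rw [← hy, D.τ_π])
  have h4 := congrArg (fun T => T X) (h3.dd_eq.symm.trans hb.dd_eq)
  have h5 : dd m τ x X (b x) = 0 := by rw [← hπ.self_of_nhds, D.dτ_π]
  simpa [h5] using h4

/-- Differentiate `τ H = H - η` and insert `dτ_H`. -/
theorem dd_H_sub (D : LeafFields m h η τ π H) (x : L) (X : Euc m) :
    dd m H x X - τ x (dd m H x X) = ⟪H x, dd m h x X⟫ • η x := by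
  have h1 := (D.smooth_τ.hasDD x).clm_apply (D.smooth_H.hasDD x)
  have h2 := h1.congr (G := fun y => H y - η y) (Eventually.of_forall fun y => (D.τ_H y).symm)
  have h4 := congrArg (fun T => T X) (h2.dd_eq.symm.trans
    ((D.smooth_H.hasDD x).sub (D.smooth_η.hasDD x)).dd_eq)
  simp at h4
  rw [← D.dτ_H, sub_eq_iff_eq_add]
  nth_rewrite 1 [sub_eq_iff_eq_add.1 h4.symm]
  abel

theorem dπ_sub (D : LeafFields m h η τ π H) (x : L) (X : Euc m) (w : Euc q) :
    τ x (dd m π x X w) = dd m π x X w := by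
  have h1 := (D.smooth_π.hasDD x).clm_apply (HasDD.const w x)
  have := D.τ_dd_section h1 (Eventually.of_forall fun y => D.π_π y w) X
  simpa using this

theorem isSmoothImmersion (D : LeafFields m h η τ π H) : IsSmoothImmersion m h :=
  ⟨D.smooth_h, D.inj⟩

/-- The tangential projection of the leaf. -/
theorem tproj_eq (D : LeafFields m h η τ π H) (x : L) : tproj m h x = τ x - π x := by
  ext1 w
  rw [tproj]
  refine Submodule.eq_starProjection_of_mem_of_inner_eq_zero ?_ ?_
  · obtain ⟨X, hX⟩ := D.range x ((τ x - π x) w) (by simp [D.τ_τ, D.τ_π])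
      (by simp [D.π_τ, D.π_π])
    exact ⟨X, hX⟩
  · rintro _ ⟨X, rfl⟩
    change ⟪w - (τ x w - π x w), dd m h x X⟫ = 0
    rw [inner_sub_left, inner_sub_left, D.τ_symm, D.π_symm, D.τ_h, D.π_h]
    simp

theorem mem_normalSpace (D : LeafFields m h η τ π H) (x : L) (w : Euc q) :
    w ∈ normalSpace m h x ↔ τ x w = π x w := by
  rw [mem_normalSpace_iff, D.tproj_eq, sub_apply, sub_eq_zero]

/-- The normal space of the leaf is the normal space of `f` together with the nullity, whence the
two contributions `1 - τ` and `π`. -/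
theorem normalDeriv_eq (D : LeafFields m h η τ π H) (ξ : L → Euc q) (x : L) (X : Euc m) :
    normalDeriv h ξ x X = dd m ξ x X - τ x (dd m ξ x X) + π x (dd m ξ x X) := by
  rw [Submfd.normalDeriv_eq, D.tproj_eq, sub_apply]
  abel

end LeafFields

end Submfd

end

noncomputable section
namespace Submfd
open Filter Topology Set

/-! ### The geometry of a sphere through the origin. -/

section Sphere

variable {V : Type*} [NormedAddCommGroup V] [InnerProductSpace ℝ V]

/-- The displacement `v ↦ 2 (|v|² H + v) / (1 + |H|² |v|²)` parametrizing the sphere through the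
origin with mean curvature vector `H`, by its tangent space at the origin. -/
def sphereDisp (H v : V) : V :=
  (1 + ‖H‖ ^ 2 * ‖v‖ ^ 2)⁻¹ • ((2 * ‖v‖ ^ 2) • H + (2 : ℝ) • v)

@[simp] theorem sphereDisp_zero (H : V) : sphereDisp H 0 = 0 := by simp [sphereDisp]

theorem contDiff_sphereDisp : ContDiff ℝ ∞ (fun p : V × V => sphereDisp p.1 p.2) := by
  refine ContDiff.smul (ContDiff.inv ?_ fun p => by positivity) ?_
  · exact contDiff_const.add ((contDiff_fst.norm_sq ℝ).mul (contDiff_snd.norm_sq ℝ))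
  · exact ((contDiff_const.mul (contDiff_snd.norm_sq ℝ)).smul contDiff_fst).add
      (contDiff_const.smul contDiff_snd)

theorem continuous_sphereDisp {X : Type*} [TopologicalSpace X] {a b : X → V} (ha : Continuous a)
    (hb : Continuous b) : Continuous (fun x => sphereDisp (a x) (b x)) :=
  contDiff_sphereDisp.continuous.comp (ha.prodMk hb)

theorem contMDiffAt_sphereDisp {E X K : Type*} [NormedAddCommGroup E] [NormedSpace ℝ E]
    [TopologicalSpace K] {I : ModelWithCorners ℝ E K} [TopologicalSpace X] [ChartedSpace K X]
    {a b : X → V} {x : X} (ha : ContMDiffAt I 𝓘(ℝ, V) ∞ a x) (hb : ContMDiffAt I 𝓘(ℝ, V) ∞ b x) :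
    ContMDiffAt I 𝓘(ℝ, V) ∞ (fun x => sphereDisp (a x) (b x)) x :=
  (contDiff_sphereDisp (V := V)).contMDiff.contMDiffAt.comp x (ha.prodMk_space hb)

theorem contDiff_sphereDisp_right (H : V) : ContDiff ℝ ∞ (sphereDisp H) :=
  contDiff_sphereDisp.comp (contDiff_const.prodMk contDiff_id)

theorem fderiv_sphereDisp (H v w : V) : fderiv ℝ (sphereDisp H) v w =
    ((1 + ‖H‖ ^ 2 * ‖v‖ ^ 2) ^ 2)⁻¹ • ((4 * ⟪v, w⟫) • H + (2 * (1 + ‖H‖ ^ 2 * ‖v‖ ^ 2)) • w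
      - (4 * ‖H‖ ^ 2 * ⟪v, w⟫) • v) := by
  have h0 : (1 + ‖H‖ ^ 2 * ‖v‖ ^ 2) ≠ 0 := by positivity
  have h1 : HasFDerivAt (fun v : V => ‖v‖ ^ 2) (2 • innerSL ℝ v) v :=
    (hasStrictFDerivAt_norm_sq v).hasFDerivAt
  have h2 := (hasDerivAt_inv h0).comp_hasFDerivAt v ((h1.const_mul (‖H‖ ^ 2)).const_add 1)
  have h3 := (((h1.const_mul 2).smul_const H)).add ((hasFDerivAt_id v).const_smul (2 : ℝ))
  have h4 := h2.smul h3
  have h5 : fderiv ℝ (sphereDisp H) v = _ := h4.fderiv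
  rw [h5]
  simp
  match_scalars <;> field_simp <;> ring

theorem fderiv_sphereDisp_zero (H w : V) : fderiv ℝ (sphereDisp H) 0 w = (2 : ℝ) • w := by
  rw [fderiv_sphereDisp]; simp

/-- The tangent projection of the sphere with mean curvature vector `H`, tangent to the range of
the projection `π` at the origin, at the point `d`. -/
theorem sphere_tangent {H v w : V} {π : V →L[ℝ] V} (hH : π H = 0) (hv : π v = v) (hw : π w = w)
    (hvH : ⟪v, H⟫ = 0) (hwH : ⟪w, H⟫ = 0) {δ : V} (hδ : δ = fderiv ℝ (sphereDisp H) v w) :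
    π δ + ⟪sphereDisp H v, δ⟫ • H + ⟪H, δ⟫ • sphereDisp H v
      - (‖H‖ ^ 2 * ⟪sphereDisp H v, δ⟫) • sphereDisp H v = δ := by
  have hD : (1 + ‖H‖ ^ 2 * ‖v‖ ^ 2) ≠ 0 := by positivity
  rw [fderiv_sphereDisp] at hδ
  set D := 1 + ‖H‖ ^ 2 * ‖v‖ ^ 2 with hDdef
  have e1 : ⟪H, δ⟫ = 4 * ⟪v, w⟫ * ‖H‖ ^ 2 / D ^ 2 := by
    rw [hδ, real_inner_smul_right, inner_sub_right, inner_add_right, real_inner_smul_right,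
      real_inner_smul_right, real_inner_smul_right, real_inner_self_eq_norm_sq,
      real_inner_comm w H, real_inner_comm v H, hwH, hvH]
    field_simp; ring
  have e2 : ⟪sphereDisp H v, δ⟫ = 4 * ⟪v, w⟫ / D ^ 2 := by
    have e3 : ⟪v, δ⟫ = (2 * ⟪v, w⟫ * D - 4 * ‖H‖ ^ 2 * ⟪v, w⟫ * ‖v‖ ^ 2) / D ^ 2 := by
      rw [hδ, real_inner_smul_right, inner_sub_right, inner_add_right, real_inner_smul_right,
        real_inner_smul_right, real_inner_smul_right, real_inner_self_eq_norm_sq, hvH]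
      field_simp; ring
    rw [sphereDisp, real_inner_smul_left, inner_add_left, real_inner_smul_left,
      real_inner_smul_left, e1, e3]
    field_simp; rw [hDdef]; ring
  have e3 : π δ = (D ^ 2)⁻¹ • ((2 * D) • w - (4 * ‖H‖ ^ 2 * ⟪v, w⟫) • v) := by
    rw [hδ, map_smul, map_sub, map_add, map_smul, map_smul, map_smul, hH, hw, hv, smul_zero,
      zero_add]
  rw [e1, e2, e3, hδ]
  module

end Sphere

/-! ### Recovering the tangent projection of a sphere from its invariants. -/

section Reconstruction

variable {q : ℕ}

/-- The quantities `|H|²`, `H + |H|² y` and `π - (H ⊗ y + y ⊗ H + |H|² y ⊗ y)`, which are constant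
along a sphere with mean curvature vector `H` and tangent projection `π` at the point `y`. -/
def sphereInvariants (p : Euc q × Euc q × (Euc q →L[ℝ] Euc q)) :
    ℝ × Euc q × (Euc q →L[ℝ] Euc q) :=
  (‖p.2.1‖ ^ 2, p.2.1 + ‖p.2.1‖ ^ 2 • p.1, p.2.2 - ((innerSL ℝ p.1).smulRight p.2.1 +
    (innerSL ℝ p.2.1).smulRight p.1 + ‖p.2.1‖ ^ 2 • (innerSL ℝ p.1).smulRight p.1))

/-- The tangent projection of a sphere at the point `y`, in terms of its invariants. -/
def sphereProj (p : Euc q × ℝ × Euc q × (Euc q →L[ℝ] Euc q)) : Euc q →L[ℝ] Euc q :=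
  p.2.2.2 + ((innerSL ℝ p.1).smulRight (p.2.2.1 - p.2.1 • p.1) +
    (innerSL ℝ (p.2.2.1 - p.2.1 • p.1)).smulRight p.1 + p.2.1 • (innerSL ℝ p.1).smulRight p.1)

theorem sphereProj_apply (y d H : Euc q) (π : Euc q →L[ℝ] Euc q) (w : Euc q) :
    sphereProj (y + d, sphereInvariants (y, H, π)) w =
      π w + ⟪d, w⟫ • H + ⟪H, w⟫ • d - (‖H‖ ^ 2 * ⟪d, w⟫) • d := by
  simp only [sphereProj, sphereInvariants, add_apply, sub_apply, smul_apply,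
    ContinuousLinearMap.smulRight_apply, innerSL_apply_apply, inner_add_left, inner_sub_left,
    real_inner_smul_left]
  module

theorem contDiff_sphereInvariants : ContDiff ℝ ∞ (sphereInvariants (q := q)) := by
  have h1 : ContDiff ℝ ∞ (fun p : Euc q × Euc q × (Euc q →L[ℝ] Euc q) => p.1) := contDiff_fst
  have h2 : ContDiff ℝ ∞ (fun p : Euc q × Euc q × (Euc q →L[ℝ] Euc q) => p.2.1) := by fun_prop
  refine (h2.norm_sq ℝ).prodMk ((h2.add ((h2.norm_sq ℝ).smul h1)).prodMk ?_)
  refine contDiff_clm_apply_iff.2 fun w => ?_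
  have h3 : ContDiff ℝ ∞ (fun p : Euc q × Euc q × (Euc q →L[ℝ] Euc q) => p.2.2 w) := by fun_prop
  have h4 := h1.inner ℝ (contDiff_const (c := w))
  have h5 := h2.inner ℝ (contDiff_const (c := w))
  exact h3.sub (((h4.smul h2).add (h5.smul h1)).add ((h2.norm_sq ℝ).smul (h4.smul h1)))

theorem contDiff_sphereProj : ContDiff ℝ ∞ (sphereProj (q := q)) := by
  have h1 : ContDiff ℝ ∞ (fun p : Euc q × ℝ × Euc q × (Euc q →L[ℝ] Euc q) => p.1) := contDiff_fst
  have hk : ContDiff ℝ ∞ (fun p : Euc q × ℝ × Euc q × (Euc q →L[ℝ] Euc q) => p.2.1) := by fun_prop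
  have h2 : ContDiff ℝ ∞ (fun p : Euc q × ℝ × Euc q × (Euc q →L[ℝ] Euc q) =>
      p.2.2.1 - p.2.1 • p.1) := by fun_prop
  refine contDiff_clm_apply_iff.2 fun w => ?_
  have h3 : ContDiff ℝ ∞ (fun p : Euc q × ℝ × Euc q × (Euc q →L[ℝ] Euc q) => p.2.2.2 w) := by
    fun_prop
  have h4 := h1.inner ℝ (contDiff_const (c := w))
  have h5 := h2.inner ℝ (contDiff_const (c := w))
  exact h3.add (((h4.smul h2).add (h5.smul h1)).add (hk.smul (h4.smul h1)))

end Reconstruction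

/-- A neighbourhood of `(x₀, 0)` contains a product with a ball, which is star-shaped about `0`.
This keeps radial curves in the domain of a local argument. -/
theorem eventually_forall_segment_mem {M V W : Type*} [TopologicalSpace M] [NormedAddCommGroup V]
    [NormedSpace ℝ V] [TopologicalSpace W] {F : M × V → W} (hF : Continuous F) (x₀ : M) {O : Set W}
    (hO : O ∈ 𝓝 (F (x₀, 0))) :
    ∀ᶠ p in 𝓝 ((x₀, 0) : M × V), ∀ t ∈ Icc (0 : ℝ) 1, F (p.1, t • p.2) ∈ O := by
  have hev : ∀ᶠ p in 𝓝 ((x₀, 0) : M × V), F p ∈ O := hF.continuousAt.preimage_mem_nhds hO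
  rw [nhds_prod_eq, eventually_prod_iff] at hev
  obtain ⟨A, hA, B, hB, hAB⟩ := hev
  obtain ⟨r, hr, hball⟩ := Metric.eventually_nhds_iff_ball.1 hB
  rw [nhds_prod_eq]
  filter_upwards [hA.prod_mk (Metric.ball_mem_nhds (0 : V) hr)] with p hp t ht
  refine hAB hp.1 (hball _ ?_)
  have hpr : p.2 ∈ Metric.ball (0 : V) r := hp.2
  rw [mem_ball_zero_iff] at hpr ⊢
  refine lt_of_le_of_lt ?_ hpr
  rw [norm_smul, Real.norm_of_nonneg ht.1]
  exact mul_le_of_le_one_left (norm_nonneg _) ht.2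

/-! ### The leaves of the nullity are open in spheres. -/

section Lift

variable {n q : ℕ} {M : Type*} [TopologicalSpace M] [ChartedSpace (Euc n) M]
  {f η : M → Euc q} {τ π : M → Euc q →L[ℝ] Euc q} {H : M → Euc q}

theorem DupinFields.contMDiff_invariants (D : DupinFields n f η τ π H) :
    ContMDiff 𝓘(ℝ, Euc n) 𝓘(ℝ, ℝ × Euc q × (Euc q →L[ℝ] Euc q)) ∞
      (fun x => sphereInvariants (f x, H x, π x)) :=
  contDiff_sphereInvariants.contMDiff.comp
    (D.smooth_f.prodMk_space (D.smooth_H.prodMk_space D.smooth_π))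

/-- The invariants of the leaves of the nullity are constant along the nullity. -/
theorem DupinFields.dd_invariants (D : DupinFields n f η τ π H) (x : M) (Z : Euc n)
    (hZ : π x (dd n f x Z) = dd n f x Z) :
    dd n (fun x => sphereInvariants (f x, H x, π x)) x Z = 0 := by
  have hHZ : ⟪H x, dd n f x Z⟫ = 0 := by
    rw [← hZ, ← D.π_symm, D.π_H, inner_zero_left]
  have hf := D.smooth_f.hasDD x
  have hH := D.smooth_H.hasDD x
  have hπ := D.smooth_π.hasDD x
  have hdH := D.dH x Z hZ
  -- Since `dH(Z) = -|H|²Z` is orthogonal to `H`, the function `|H|²` has zero derivative along `Z`;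
  -- then `d(H + |H|²f)(Z) = -|H|²Z + |H|²Z = 0`.
  have hκ := (HasDD.inner hH hH).congr (G := fun y => ‖H y‖ ^ 2)
    (Eventually.of_forall fun y => (real_inner_self_eq_norm_sq (H y)).symm)
  have hS := D.contMDiff_invariants.hasDD x
  have e1 : (dd n (fun x => sphereInvariants (f x, H x, π x)) x Z).1 = 0 := by
    have h1 := hS.clm_comp (ContinuousLinearMap.fst ℝ ℝ (Euc q × (Euc q →L[ℝ] Euc q)))
    have h2 := congrArg (fun T => T Z) (h1.dd_eq.symm.trans hκ.dd_eq)
    simp [hdH, hHZ, real_inner_smul_right] at h2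
    exact h2
  have e2 : (dd n (fun x => sphereInvariants (f x, H x, π x)) x Z).2.1 = 0 := by
    have h1 := hS.clm_comp ((ContinuousLinearMap.fst ℝ (Euc q) (Euc q →L[ℝ] Euc q)) ∘L
      ContinuousLinearMap.snd ℝ ℝ (Euc q × (Euc q →L[ℝ] Euc q)))
    have h2 := congrArg (fun T => T Z) (h1.dd_eq.symm.trans (hH.add (hκ.smul hf)).dd_eq)
    simp [hdH, hHZ, real_inner_smul_right] at h2
    exact h2
  have e3 : (dd n (fun x => sphereInvariants (f x, H x, π x)) x Z).2.2 = 0 := by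
    ext1 w
    have h1 := (hS.clm_comp ((ContinuousLinearMap.snd ℝ (Euc q) (Euc q →L[ℝ] Euc q)) ∘L
      ContinuousLinearMap.snd ℝ ℝ (Euc q × (Euc q →L[ℝ] Euc q)))).clm_apply (HasDD.const w x)
    have hw := HasDD.const (k := n) w x
    have h3 := (hπ.clm_apply hw).sub ((((hf.inner hw).smul hH).add ((hH.inner hw).smul hf)).add
      (hκ.smul ((hf.inner hw).smul hf)))
    have h2 := congrArg (fun T => T Z) (h1.dd_eq.symm.trans h3.dd_eq)
    simp [hdH, hHZ, D.dπ x Z hZ, real_inner_smul_right] at h2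
    refine h2.trans ?_
    rw [real_inner_comm w (dd n f x Z), zero_apply]
    module
  exact Prod.ext e1 (Prod.ext e2 e3)

/-- Near a point, the leaves of the nullity are open subsets of spheres. -/
theorem DupinFields.exists_lift [IsManifold 𝓘(ℝ, Euc n) ∞ M] (D : DupinFields n f η τ π H) (x₀ : M) :
    ∃ P : Euc q → M, (∀ᶠ y in 𝓝 (f x₀), ContMDiffAt 𝓘(ℝ, Euc q) 𝓘(ℝ, Euc n) ∞ P y) ∧
      (∀ᶠ x in 𝓝 x₀, P (f x) = x) ∧
      ∀ᶠ p : M × Euc q in 𝓝 (x₀, 0), π p.1 p.2 = p.2 →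
        f (P (f p.1 + sphereDisp (H p.1) p.2)) = f p.1 + sphereDisp (H p.1) p.2 ∧
        ∀ w, π (P (f p.1 + sphereDisp (H p.1) p.2)) w =
          π p.1 w + ⟪sphereDisp (H p.1) p.2, w⟫ • H p.1 + ⟪H p.1, w⟫ • sphereDisp (H p.1) p.2
            - (‖H p.1‖ ^ 2 * ⟪sphereDisp (H p.1) p.2, w⟫) • sphereDisp (H p.1) p.2 := by
  obtain ⟨P, hP1, hP2⟩ := IsSmoothImmersion.exists_leftInverse ⟨D.smooth_f, D.inj⟩ x₀
  refine ⟨P, hP1, hP2, ?_⟩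
  set S := fun x => sphereInvariants (f x, H x, π x) with hS
  have hSs : ContMDiff 𝓘(ℝ, Euc n) 𝓘(ℝ, ℝ × Euc q × (Euc q →L[ℝ] Euc q)) ∞ S :=
    D.contMDiff_invariants
  have hfS := D.smooth_f.prodMk_space hSs
  -- The first component retracts a neighbourhood of `f x₀` onto the image of `f`, and the second
  -- extends the invariants to it. A curve with `Γ c = (c, S x)` stays in the image and keeps the
  -- invariants of `x`.
  set Γ := fun y => (f (P y), S (P y)) with hΓ
  have hΓs : ∀ y, ContMDiffAt 𝓘(ℝ, Euc q) 𝓘(ℝ, Euc n) ∞ P y → ContDiffAt ℝ ∞ Γ y := fun y hy =>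
    contMDiffAt_iff_contDiffAt.1 (hfS.contMDiffAt.comp y hy)
  have hPx₀ : P (f x₀) = x₀ := hP2.self_of_nhds
  have hΓ₀ : Γ (f x₀) = (f x₀, S x₀) := by simp only [hΓ, hPx₀]
  have hPf : ∀ x, sphereProj (f x, S x) = π x := fun x => by
    ext1 w
    have := sphereProj_apply (f x) 0 (H x) (π x) w
    simpa using this
  have hfc : Tendsto f (𝓝 x₀) (𝓝 (f x₀)) := D.smooth_f.continuous.continuousAt
  have hPc : Tendsto P (𝓝 (f x₀)) (𝓝 x₀) := by
    have := hP1.self_of_nhds.continuousAt.tendsto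
    rwa [hPx₀] at this
  -- Since `Γ ∘ f = (f, S)` near the point, `dΓ` sends `f_* Z` to `(f_* Z, dS(Z))`, and the
  -- invariants are constant along the nullity.
  have hinv : ∀ᶠ w in 𝓝 (f x₀), ∀ v,
      fderiv ℝ Γ (Γ w).1 (sphereProj (Γ w) v) = (sphereProj (Γ w) v, 0) := by
    have h1 : ∀ᶠ x in 𝓝 x₀, ContMDiffAt 𝓘(ℝ, Euc q) 𝓘(ℝ, Euc n) ∞ P (f x) ∧
        ∀ᶠ x' in 𝓝 x, P (f x') = x' := (hfc.eventually hP1).and hP2.eventually_nhds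
    filter_upwards [hPc.eventually h1] with w hw v
    simp only [hΓ, hPf]
    set x := P w
    have h2 : HasFDerivAt Γ (fderiv ℝ Γ (f x)) (f x) :=
      ((hΓs _ hw.1).differentiableAt (by simp)).hasFDerivAt
    have h3 := (HasDD.comp_left h2 (D.smooth_f.hasDD x)).congr (G := fun y => (f y, S y)) (by
      filter_upwards [hw.2] with y hy
      simp only [hΓ, hy])
    obtain ⟨Z, hZ⟩ := D.exists_dd_eq_π x v
    have h4 := congrArg (fun T => T Z) (h3.dd_eq.symm.trans
      ((D.smooth_f.hasDD x).prodMk (hSs.hasDD x)).dd_eq)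
    simp only [ContinuousLinearMap.comp_apply, ContinuousLinearMap.prod_apply, hZ] at h4
    rw [h4, D.dd_invariants x Z (by rw [hZ, D.π_π])]
  have hΓ2 : ContDiffAt ℝ 2 Γ (f x₀) := (hΓs _ hP1.self_of_nhds).of_le ENat.LEInfty.out
  have hsp : ContDiffAt ℝ 1 (sphereProj (q := q)) (f x₀, S x₀) :=
    contDiff_sphereProj.contDiffAt.of_le ENat.LEInfty.out
  obtain ⟨O, hO, hOc⟩ := exists_nhds_forall_curve_eq Γ (f x₀) (S x₀) hΓ2 hΓ₀ sphereProj hsp hinv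
  have hdisp : Continuous (fun p : M × Euc q => f p.1 + sphereDisp (H p.1) p.2) :=
    (D.smooth_f.continuous.comp continuous_fst).add
      (continuous_sphereDisp (D.smooth_H.continuous.comp continuous_fst) continuous_snd)
  have hG : Continuous (fun p : M × Euc q => (f p.1 + sphereDisp (H p.1) p.2, S p.1)) :=
    hdisp.prodMk (hSs.continuous.comp continuous_fst)
  have hO' : O ∈ 𝓝 (f x₀ + sphereDisp (H x₀) 0, S x₀) := by rwa [sphereDisp_zero, add_zero]
  have hP2' : ∀ᶠ p : M × Euc q in 𝓝 (x₀, 0), P (f p.1) = p.1 :=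
    (continuous_fst.tendsto (x₀, (0 : Euc q))).eventually hP2
  filter_upwards [eventually_forall_segment_mem hG x₀ hO', hP2'] with p hpO hpP hπp
  obtain ⟨x, v⟩ := p
  simp only at hpO hpP hπp ⊢
  have hvH : ⟪v, H x⟫ = 0 := by rw [← hπp, D.π_symm, D.π_H, inner_zero_right]
  -- A radial curve on the sphere through `f x` with mean curvature vector `H x`. By
  -- `sphere_tangent` its velocity is fixed by the projection reconstructed from the invariants of
  -- `x`.
  set c : ℝ → Euc q := fun t => f x + sphereDisp (H x) (t • v) with hc
  set c' : ℝ → Euc q := fun t => fderiv ℝ (sphereDisp (H x)) (t • v) v with hc'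
  have hder : ∀ t, HasDerivAt c (c' t) t := fun t => by
    have h1 : HasDerivAt (fun t : ℝ => t • v) v t := by
      simpa using (hasDerivAt_id t).smul_const v
    exact ((((contDiff_sphereDisp_right (H x)).differentiable (by simp) (t • v)).hasFDerivAt).comp_hasDerivAt
      t h1).const_add (f x)
  have hc'c : Continuous c' := by
    have h1 := (contDiff_sphereDisp_right (H x)).continuous_fderiv (by simp)
    exact (h1.comp (continuous_id.smul continuous_const)).clm_apply continuous_const
  obtain ⟨B', hB'⟩ := (isCompact_Icc (a := (0 : ℝ)) (b := 1)).exists_bound_of_continuousOn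
    hc'c.continuousOn
  have hend := hOc c c' (S x) B' (fun t _ => hder t) hB' ?_ ?_ ?_ 1 ⟨zero_le_one, le_rfl⟩
  · have h1 : c 1 = f x + sphereDisp (H x) v := by simp only [hc, one_smul]
    rw [h1] at hend
    simp only [hΓ, Prod.mk.injEq] at hend
    refine ⟨hend.1, fun w => ?_⟩
    rw [← hPf, hend.1, hend.2]
    exact sphereProj_apply _ _ _ _ _
  · exact hpO
  · intro t _
    refine (sphereProj_apply (f x) (sphereDisp (H x) (t • v)) (H x) (π x) (c' t)).trans ?_
    exact sphere_tangent (D.π_H x) (by rw [map_smul, hπp]) hπp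
      (by rw [real_inner_smul_left, hvH, mul_zero]) hvH rfl
  · simp only [hΓ, hc, zero_smul, sphereDisp_zero, add_zero, hpP]

end Lift

end Submfd

end

noncomputable section
namespace Submfd
open Filter Topology Set

/-! ### The tube of spheres around a leaf of the conullity. -/

section Tube

variable {n m s q : ℕ} {M : Type*} [TopologicalSpace M] [ChartedSpace (Euc n) M]
  [IsManifold 𝓘(ℝ, Euc n) ∞ M] {f η : M → Euc q} {τ π : M → Euc q →L[ℝ] Euc q} {H : M → Euc q}
  {L : Type*} [TopologicalSpace L] [ChartedSpace (Euc m) L] [IsManifold 𝓘(ℝ, Euc m) ∞ L] {j : L → M}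

/-- The spheres containing the leaves of the nullity through the points of a leaf of the conullity
form a local parametrization of the ambient manifold. -/
theorem DupinFields.exists_tube (D : DupinFields n f η τ π H) (hj : IsLeaf n m f π j)
    (hms : m + s = n) (u₀ : L) {V : L × Euc s → Euc q}
    (hV : ∀ᶠ p in 𝓝 (u₀, (0 : Euc s)),
      ContMDiffAt (𝓘(ℝ, Euc m).prod 𝓘(ℝ, Euc s)) 𝓘(ℝ, Euc q) ∞ V p)
    (hπV : ∀ᶠ p in 𝓝 (u₀, (0 : Euc s)), π (j p.1) (V p) = V p)
    (hV0 : ∀ᶠ u in 𝓝 u₀, V (u, 0) = 0) {ι : Euc s →L[ℝ] Euc q}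
    (hι : HasFDerivAt (fun z => V (u₀, z)) ι 0) (hιi : Function.Injective ι)
    (hπι : ∀ z, π (j u₀) (ι z) = ι z) :
    ∃ Ψ : L × Euc s → M,
      IsLocalDiffeomorphAt (𝓘(ℝ, Euc m).prod 𝓘(ℝ, Euc s)) 𝓘(ℝ, Euc n) ∞ Ψ (u₀, 0) ∧
      (∀ᶠ u in 𝓝 u₀, Ψ (u, 0) = j u) ∧
      ∀ᶠ p in 𝓝 (u₀, (0 : Euc s)),
        f (Ψ p) = f (j p.1) + sphereDisp (H (j p.1)) (V p) ∧
        ∀ w, π (Ψ p) w = π (j p.1) w + ⟪sphereDisp (H (j p.1)) (V p), w⟫ • H (j p.1)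
          + ⟪H (j p.1), w⟫ • sphereDisp (H (j p.1)) (V p)
          - (‖H (j p.1)‖ ^ 2 * ⟪sphereDisp (H (j p.1)) (V p), w⟫) •
            sphereDisp (H (j p.1)) (V p) := by
  obtain ⟨P, hP1, hP2, hP3⟩ := D.exists_lift (j u₀)
  set Y : L × Euc s → Euc q := fun p => f (j p.1) + sphereDisp (H (j p.1)) (V p) with hY
  have hV00 : V (u₀, 0) = 0 := hV0.self_of_nhds
  have hY0 : Y (u₀, 0) = f (j u₀) := by simp [hY, hV00]
  have hYs : ∀ p, ContMDiffAt (𝓘(ℝ, Euc m).prod 𝓘(ℝ, Euc s)) 𝓘(ℝ, Euc q) ∞ V p →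
      ContMDiffAt (𝓘(ℝ, Euc m).prod 𝓘(ℝ, Euc s)) 𝓘(ℝ, Euc q) ∞ Y p := by
    intro p hp
    have hfst : ContMDiffAt (𝓘(ℝ, Euc m).prod 𝓘(ℝ, Euc s)) 𝓘(ℝ, Euc m) ∞ Prod.fst p :=
      contMDiffAt_fst
    have h1 : ContMDiffAt (𝓘(ℝ, Euc m).prod 𝓘(ℝ, Euc s)) 𝓘(ℝ, Euc q) ∞
        (fun p : L × Euc s => f (j p.1)) p :=
      (D.smooth_f.comp hj.smooth).contMDiffAt.comp p hfst
    have h2 : ContMDiffAt (𝓘(ℝ, Euc m).prod 𝓘(ℝ, Euc s)) 𝓘(ℝ, Euc q) ∞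
        (fun p : L × Euc s => H (j p.1)) p :=
      (D.smooth_H.comp hj.smooth).contMDiffAt.comp p hfst
    exact h1.add (contMDiffAt_sphereDisp h2 hp)
  have hVc : ContinuousAt V (u₀, 0) := hV.self_of_nhds.continuousAt
  have hYc : Tendsto Y (𝓝 (u₀, 0)) (𝓝 (f (j u₀))) := by
    have := (hYs _ hV.self_of_nhds).continuousAt.tendsto
    rwa [hY0] at this
  have hΨs : ∀ᶠ p in 𝓝 (u₀, (0 : Euc s)),
      ContMDiffAt (𝓘(ℝ, Euc m).prod 𝓘(ℝ, Euc s)) 𝓘(ℝ, Euc n) ∞ (P ∘ Y) p := by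
    filter_upwards [hV, hYc.eventually hP1] with p hp hp' using hp'.comp p (hYs p hp)
  have hjc : Tendsto (fun p : L × Euc s => (j p.1, V p)) (𝓝 (u₀, 0)) (𝓝 (j u₀, 0)) := by
    have h1 : ContinuousAt (fun p : L × Euc s => (j p.1, V p)) (u₀, 0) :=
      (hj.smooth.continuous.continuousAt.comp continuousAt_fst).prodMk hVc
    have := h1.tendsto
    rwa [hV00] at this
  have hlift := (hjc.eventually hP3).and hπV
  have hbase : ∀ᶠ u in 𝓝 u₀, P (Y (u, 0)) = j u := by
    filter_upwards [hV0, hj.smooth.continuous.continuousAt.eventually hP2] with u hu hu'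
    simp only [hY, hu, sphereDisp_zero, add_zero, hu']
  have hfΨ : ∀ᶠ p in 𝓝 (u₀, (0 : Euc s)), f (P (Y p)) = Y p := by
    filter_upwards [hlift] with p hp using (hp.1 hp.2).1
  refine ⟨P ∘ Y, ?_, hbase, ?_⟩
  swap
  · filter_upwards [hlift] with p hp using hp.1 hp.2
  have hΨd := (hΨs.self_of_nhds.mdifferentiableAt (by simp)).hasMFDerivAt
  set A : Euc m × Euc s →L[ℝ] Euc n :=
    mfderiv (𝓘(ℝ, Euc m).prod 𝓘(ℝ, Euc s)) 𝓘(ℝ, Euc n) (P ∘ Y) (u₀, (0 : Euc s)) with hA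
  have hΨ0 : (P ∘ Y) (u₀, 0) = j u₀ := hbase.self_of_nhds
  have hfd : HasMFDerivAt 𝓘(ℝ, Euc n) 𝓘(ℝ, Euc q) f ((P ∘ Y) (u₀, 0)) (dd n f (j u₀)) := by
    rw [hΨ0]; exact (D.smooth_f.hasDD _).hasMFDerivAt
  have hYd : HasMFDerivAt (𝓘(ℝ, Euc m).prod 𝓘(ℝ, Euc s)) 𝓘(ℝ, Euc q) Y (u₀, (0 : Euc s))
      (dd n f (j u₀) ∘L A) :=
    (hfd.comp _ hΨd).congr_of_eventuallyEq (by filter_upwards [hfΨ] with p hp using hp.symm)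
  -- At `(u₀, 0)` the differential is that of `j` along `L` and twice `ι` along the fibre. The
  -- projection `π` kills the former and fixes the latter, whence injectivity; equality of
  -- dimensions does the rest.
  have hA1 : ∀ X, dd n f (j u₀) (A (X, 0)) = dd m (f ∘ j) u₀ X := by
    intro X
    have h1 : HasMFDerivAt 𝓘(ℝ, Euc m) (𝓘(ℝ, Euc m).prod 𝓘(ℝ, Euc s))
        (fun u : L => (u, (0 : Euc s))) u₀
        ((ContinuousLinearMap.id ℝ (Euc m)).prod (0 : Euc m →L[ℝ] Euc s)) :=
      (hasMFDerivAt_id u₀).prodMk (hasMFDerivAt_const 0 u₀)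
    have h2 : HasMFDerivAt 𝓘(ℝ, Euc m) 𝓘(ℝ, Euc q) (f ∘ j) u₀ (dd n f (j u₀) ∘L A ∘L
        ((ContinuousLinearMap.id ℝ (Euc m)).prod (0 : Euc m →L[ℝ] Euc s))) :=
      (hYd.comp u₀ h1).congr_of_eventuallyEq (by
        filter_upwards [hV0] with u hu
        simp [hY, hu])
    rw [h2.hasDD.dd_eq]
    rfl
  have hA2 : ∀ Z, dd n f (j u₀) (A (0, Z)) = (2 : ℝ) • ι Z := by
    intro Z
    have h1 : HasMFDerivAt 𝓘(ℝ, Euc s) (𝓘(ℝ, Euc m).prod 𝓘(ℝ, Euc s))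
        (fun z : Euc s => (u₀, z)) 0
        ((0 : Euc s →L[ℝ] Euc m).prod (ContinuousLinearMap.id ℝ (Euc s))) :=
      (hasMFDerivAt_const u₀ (0 : Euc s)).prodMk (hasMFDerivAt_id (0 : Euc s))
    have h2 : HasFDerivAt (fun z : Euc s => Y (u₀, z)) (dd n f (j u₀) ∘L A ∘L
        ((0 : Euc s →L[ℝ] Euc m).prod (ContinuousLinearMap.id ℝ (Euc s)))) 0 :=
      (hYd.comp (0 : Euc s) h1).hasFDerivAt
    have h3 : HasFDerivAt (fun z => sphereDisp (H (j u₀)) (V (u₀, z)))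
        (fderiv ℝ (sphereDisp (H (j u₀))) (V (u₀, 0)) ∘L ι) 0 := by
      have h5 := ((contDiff_sphereDisp_right (H (j u₀))).differentiable (by simp)
        (V (u₀, 0))).hasFDerivAt
      exact HasFDerivAt.comp (0 : Euc s) h5 hι
    have h6 := h3.const_add (f (j u₀))
    have h4 := congrArg (fun T : Euc s →L[ℝ] Euc q => T Z) (h2.unique h6)
    rw [hV00] at h4
    refine Eq.trans ?_ (h4.trans (fderiv_sphereDisp_zero _ _))
    rfl
  have hinj : Function.Injective A := by
    rw [injective_iff_map_eq_zero]
    rintro ⟨X, Z⟩ h0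
    have h1 : dd n f (j u₀) (A (X, Z)) = dd m (f ∘ j) u₀ X + (2 : ℝ) • ι Z := by
      rw [← hA1, ← hA2, ← map_add, ← map_add, Prod.mk_add_mk, add_zero, zero_add]
    rw [h0, map_zero] at h1
    have DL := D.leafFields hj
    have h2 := congrArg (π (j u₀)) h1
    have h3 : π (j u₀) (dd m (f ∘ j) u₀ X) = 0 := DL.π_h u₀ X
    rw [map_zero, map_add, h3, map_smul, hπι, zero_add] at h2
    have h4 : ι Z = 0 := by simpa using h2.symm
    have hZ : Z = 0 := hιi (by rw [h4, map_zero])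
    rw [h4, smul_zero, add_zero] at h1
    have hX : X = 0 := DL.inj u₀ (by rw [← h1, map_zero])
    rw [hX, hZ]; rfl
  have hbij : Function.Bijective A := by
    refine ⟨hinj, ?_⟩
    refine (LinearMap.injective_iff_surjective_of_finrank_eq_finrank (f := A.toLinearMap) ?_).1 hinj
    rw [Module.finrank_prod]
    simp [hms]
  exact isLocalDiffeomorphAt_of_bijective_mfderiv hΨs hbij

end Tube

end Submfd

end

noncomputable section
namespace Submfd
open Filter Topology Set

/-! ### Inversion, reflection, and leaves as graphs. -/

section Inversion

variable {V : Type*} [NormedAddCommGroup V] [InnerProductSpace ℝ V]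

theorem norm_add_sq_of_inner_eq_zero {H ζ : V} (h : ⟪H, ζ⟫ = 0) : ‖H + ζ‖ ^ 2 = ‖H‖ ^ 2 + ‖ζ‖ ^ 2 := by
  rw [norm_add_sq_real, h]; ring

/-- The sphere is the image of the affine space through `H` parallel to its tangent space at the
origin, under the inversion `W ↦ 2W/|W|²`. In this form the displacement can be compared with the
Ribaucour transform. -/
theorem sphereDisp_eq_inversion {H v : V} (hv : v ≠ 0) (hvH : ⟪H, v⟫ = 0) :
    sphereDisp H v = (2 / ‖H + (‖v‖ ^ 2)⁻¹ • v‖ ^ 2) • (H + (‖v‖ ^ 2)⁻¹ • v) := by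
  have hn : ‖v‖ ≠ 0 := norm_ne_zero_iff.2 hv
  have h1 : ‖H + (‖v‖ ^ 2)⁻¹ • v‖ ^ 2 = ‖H‖ ^ 2 + (‖v‖ ^ 2)⁻¹ := by
    rw [norm_add_sq_of_inner_eq_zero (by rw [real_inner_smul_right, hvH, mul_zero]), norm_smul,
      norm_inv, norm_pow, norm_norm]
    field_simp
  have h2 : (1 + ‖H‖ ^ 2 * ‖v‖ ^ 2) ≠ 0 := by positivity
  have h3 : ‖H‖ ^ 2 + (‖v‖ ^ 2)⁻¹ = (1 + ‖H‖ ^ 2 * ‖v‖ ^ 2) / ‖v‖ ^ 2 := by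
    field_simp
    ring
  rw [h1, h3, sphereDisp]
  match_scalars <;> field_simp

theorem hasFDerivAt_inversion {W : V} (hW : W ≠ 0) :
    HasFDerivAt (fun w : V => (2 / ‖w‖ ^ 2) • w) ((2 / ‖W‖ ^ 2) • ContinuousLinearMap.id ℝ V
      - ((4 / (‖W‖ ^ 2) ^ 2) • innerSL ℝ W).smulRight W) W := by
  have h0 : ‖W‖ ^ 2 ≠ 0 := pow_ne_zero 2 (norm_ne_zero_iff.2 hW)
  have h1 : HasFDerivAt (fun v : V => ‖v‖ ^ 2) (2 • innerSL ℝ W) W :=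
    (hasStrictFDerivAt_norm_sq W).hasFDerivAt
  have h2 := (((hasDerivAt_inv h0).comp_hasFDerivAt W h1).const_mul 2).smul (hasFDerivAt_id W)
  refine (h2.congr_fderiv ?_).congr_of_eventuallyEq (Eventually.of_forall fun w => ?_)
  · ext1 w
    simp
    match_scalars <;> field_simp ; ring
  · simp [div_eq_mul_inv]

/-- Since `⟨H + ζ, a⟩ = ⟨ζ, a⟩`, the vector `a - ⟨ζ, a⟩d` is the reflection of `a` in the hyperplane
orthogonal to `H + ζ`. That reflection carries the tangent space of the sphere at the origin to the
one at `d`. -/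
theorem sphere_reflect {H ζ a d : V} {π : V →L[ℝ] V} (hH : π H = 0) (hζ : π ζ = ζ) (ha : π a = a)
    (hHζ : ⟪H, ζ⟫ = 0) (hHa : ⟪H, a⟫ = 0) (hc : ‖H + ζ‖ ≠ 0) (hd : d = (2 / ‖H + ζ‖ ^ 2) • (H + ζ)) :
    π (a - ⟪ζ, a⟫ • d) + ⟪d, a - ⟪ζ, a⟫ • d⟫ • H + ⟪H, a - ⟪ζ, a⟫ • d⟫ • d
      - (‖H‖ ^ 2 * ⟪d, a - ⟪ζ, a⟫ • d⟫) • d = a - ⟪ζ, a⟫ • d := by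
  set c := ‖H + ζ‖ ^ 2 with hcd
  have hc0 : c ≠ 0 := pow_ne_zero 2 hc
  have e1 : ⟪d, d⟫ = 4 / c := by
    rw [hd, real_inner_smul_left, real_inner_smul_right, real_inner_self_eq_norm_sq, ← hcd]
    field_simp; norm_num
  have e2 : ⟪d, a⟫ = 2 / c * ⟪ζ, a⟫ := by
    rw [hd, real_inner_smul_left, inner_add_left, hHa, zero_add]
  have e3 : ⟪H, d⟫ = 2 / c * ‖H‖ ^ 2 := by
    rw [hd, real_inner_smul_right, inner_add_right, hHζ, add_zero, real_inner_self_eq_norm_sq]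
  have e4 : π d = (2 / c) • ζ := by rw [hd, map_smul, map_add, hH, hζ, zero_add]
  rw [map_sub, map_smul, e4, ha, inner_sub_right, inner_sub_right, real_inner_smul_right,
    real_inner_smul_right, e1, e2, e3, hHa]
  have e5 : (2 / c) • ζ = d - (2 / c) • H := by rw [hd]; module
  rw [e5]
  match_scalars <;> field_simp <;> ring

/-- Here `dh + d'` stands for the derivative of `h + 2W/|W|²`, with `W = H + ζ`, along another leaf
of the conullity. Orthogonality to the reflected vector gives one scalar component of the
differential equation for `ζ`. -/
theorem inner_deriv_of_orthogonal {H ζ a d d' W' dh : V} (hHa : ⟪H, a⟫ = 0)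
    (hdha : ⟪dh, a⟫ = 0) (hdhζ : ⟪dh, ζ⟫ = 0) (hc : ‖H + ζ‖ ≠ 0)
    (hd : d = (2 / ‖H + ζ‖ ^ 2) • (H + ζ))
    (hd' : d' = (2 / ‖H + ζ‖ ^ 2) • W' - (4 * ⟪H + ζ, W'⟫ / (‖H + ζ‖ ^ 2) ^ 2) • (H + ζ))
    (horth : ⟪dh + d', a - ⟪ζ, a⟫ • d⟫ = 0) : ⟪W', a⟫ = ⟪ζ, a⟫ * ⟪H, dh⟫ := by
  set W := H + ζ with hW
  have hc0 : ‖W‖ ^ 2 ≠ 0 := pow_ne_zero 2 hc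
  have e1 : ⟪W, a⟫ = ⟪ζ, a⟫ := by rw [hW, inner_add_left, hHa, zero_add]
  have e2 : ⟪dh, W⟫ = ⟪H, dh⟫ := by rw [hW, inner_add_right, hdhζ, add_zero, real_inner_comm]
  rw [hd, hd', inner_add_left, inner_sub_right, inner_sub_left, inner_sub_right, inner_sub_right,
    hdha] at horth
  simp only [real_inner_smul_left, real_inner_smul_right, e1, e2, real_inner_self_eq_norm_sq] at horth
  have h3 : (2 / ‖W‖ ^ 2) * (⟪W', a⟫ - ⟪ζ, a⟫ * ⟪H, dh⟫) = 0 := by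
    rw [← horth, real_inner_comm W W']
    field_simp
    ring
  rcases mul_eq_zero.1 h3 with h4 | h4
  · exact absurd h4 (by positivity)
  · exact sub_eq_zero.1 h4

end Inversion

section LocalDiffeomorphisms

variable {E F A B K K' : Type*} [NormedAddCommGroup E] [NormedSpace ℝ E] [NormedAddCommGroup F]
  [NormedSpace ℝ F] [TopologicalSpace K] [TopologicalSpace K'] {I : ModelWithCorners ℝ E K}
  {J : ModelWithCorners ℝ F K'} [TopologicalSpace A] [ChartedSpace K A] [TopologicalSpace B]
  [ChartedSpace K' B]

theorem _root_.IsLocalDiffeomorphAt.eventually {f : A → B} {a : A}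
    (hf : IsLocalDiffeomorphAt I J ∞ f a) : ∀ᶠ x in 𝓝 a, IsLocalDiffeomorphAt I J ∞ f x := by
  obtain ⟨Φ, ha, hΦ⟩ := hf
  filter_upwards [Φ.open_source.mem_nhds ha] with x hx using ⟨Φ, hx, hΦ⟩

theorem _root_.IsLocalDiffeomorphAt.exists_inverse {f : A → B} {a : A}
    (hf : IsLocalDiffeomorphAt I J ∞ f a) : ∃ g : B → A,
      (∀ᶠ y in 𝓝 (f a), ContMDiffAt J I ∞ g y) ∧ g (f a) = a ∧
      (∀ᶠ y in 𝓝 (f a), f (g y) = y) ∧ ∀ᶠ x in 𝓝 a, g (f x) = x := by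
  obtain ⟨Φ, ha, hΦ⟩ := hf
  have hfa : f a ∈ Φ.target := by rw [hΦ ha]; exact Φ.map_source ha
  have h1 : ∀ x ∈ Φ.source, Φ.symm (f x) = x := fun x hx => by
    rw [hΦ hx]; exact Φ.left_inv hx
  refine ⟨Φ.symm, ?_, h1 a ha, ?_, ?_⟩
  · filter_upwards [Φ.open_target.mem_nhds hfa] with y hy
    exact Φ.contMDiffOn_invFun.contMDiffAt (Φ.open_target.mem_nhds hy)
  · filter_upwards [Φ.open_target.mem_nhds hfa] with y hy
    exact (hΦ (Φ.map_target hy)).trans (Φ.right_inv hy)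
  · filter_upwards [Φ.open_source.mem_nhds ha] with x hx using h1 x hx

end LocalDiffeomorphisms

/-- A submanifold transversal to the second factor of a local parametrization of `M` by a product is
locally a graph over the first factor. -/
theorem exists_graph_of_transversal {n m s : ℕ} {M : Type*} [TopologicalSpace M]
    [ChartedSpace (Euc n) M] {L U : Type*} [TopologicalSpace L] [ChartedSpace (Euc m) L]
    [IsManifold 𝓘(ℝ, Euc m) ∞ L] [TopologicalSpace U] [ChartedSpace (Euc m) U]
    [IsManifold 𝓘(ℝ, Euc m) ∞ U] {Ψ : L × Euc s → M} {u₀ : L} {z₀ : Euc s}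
    (hΨ : IsLocalDiffeomorphAt (𝓘(ℝ, Euc m).prod 𝓘(ℝ, Euc s)) 𝓘(ℝ, Euc n) ∞ Ψ (u₀, z₀))
    {g : U → M} (hg : ContMDiff 𝓘(ℝ, Euc m) 𝓘(ℝ, Euc n) ∞ g) {p : U} (hp : g p = Ψ (u₀, z₀))
    {Ψ' : Euc m × Euc s →L[ℝ] Euc n}
    (hΨ' : HasMFDerivAt (𝓘(ℝ, Euc m).prod 𝓘(ℝ, Euc s)) 𝓘(ℝ, Euc n) Ψ (u₀, z₀) Ψ')
    (htr : ∀ X Z, mdd m n g p X = Ψ' (0, Z) → X = 0) :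
    ∃ (σ : L → U) (z : L → Euc s), (∀ᶠ u in 𝓝 u₀, ContMDiffAt 𝓘(ℝ, Euc m) 𝓘(ℝ, Euc m) ∞ σ u ∧
      ContMDiffAt 𝓘(ℝ, Euc m) 𝓘(ℝ, Euc s) ∞ z u) ∧ z u₀ = z₀ ∧
      ∀ᶠ u in 𝓝 u₀, g (σ u) = Ψ (u, z u) := by
  obtain ⟨Φ, hΦs, hΦ0, hΦr, -⟩ := hΨ.exists_inverse
  rw [← hp] at hΦs hΦ0 hΦr
  set γ : U → L × Euc s := Φ ∘ g with hγ
  have hgc : Tendsto g (𝓝 p) (𝓝 (g p)) := hg.continuous.continuousAt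
  have hγs : ∀ᶠ x in 𝓝 p, ContMDiffAt 𝓘(ℝ, Euc m) (𝓘(ℝ, Euc m).prod 𝓘(ℝ, Euc s)) ∞ γ x := by
    filter_upwards [hgc.eventually hΦs] with x hx using hx.comp x hg.contMDiffAt
  have hγp : γ p = (u₀, z₀) := hΦ0
  set γ' : Euc m →L[ℝ] Euc m × Euc s :=
    mfderiv 𝓘(ℝ, Euc m) (𝓘(ℝ, Euc m).prod 𝓘(ℝ, Euc s)) γ p with hγ'
  have hγd : HasMFDerivAt 𝓘(ℝ, Euc m) (𝓘(ℝ, Euc m).prod 𝓘(ℝ, Euc s)) γ p γ' :=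
    (hγs.self_of_nhds.mdifferentiableAt (by simp)).hasMFDerivAt
  have hgd : mdd m n g p = Ψ' ∘L γ' := by
    have h1 : HasMFDerivAt (𝓘(ℝ, Euc m).prod 𝓘(ℝ, Euc s)) 𝓘(ℝ, Euc n) Ψ (γ p) Ψ' := by rwa [hγp]
    have h2 : HasMFDerivAt 𝓘(ℝ, Euc m) 𝓘(ℝ, Euc n) g p (Ψ' ∘L γ') :=
      (h1.comp p hγd).congr_of_eventuallyEq (by
        filter_upwards [hgc.eventually hΦr] with x hx using hx.symm)
    exact h2.mfderiv
  have hfst : HasMFDerivAt 𝓘(ℝ, Euc m) 𝓘(ℝ, Euc m) (Prod.fst ∘ γ) p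
      (ContinuousLinearMap.fst ℝ (Euc m) (Euc s) ∘L γ') :=
    HasMFDerivAt.comp p (hasMFDerivAt_fst (γ p)) hγd
  have hinj : Function.Injective (ContinuousLinearMap.fst ℝ (Euc m) (Euc s) ∘L γ') := by
    rw [injective_iff_map_eq_zero]
    intro X hX
    refine htr X (γ' X).2 ?_
    rw [hgd]
    refine congrArg Ψ' (Prod.ext ?_ rfl)
    exact hX
  -- Transversality to the fibres makes the projection to `L` injective on tangent vectors, and the
  -- dimensions agree.
  have hloc : IsLocalDiffeomorphAt 𝓘(ℝ, Euc m) 𝓘(ℝ, Euc m) ∞ (Prod.fst ∘ γ) p := by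
    refine isLocalDiffeomorphAt_of_bijective_mfderiv ?_ ?_
    · filter_upwards [hγs] with x hx using contMDiffAt_fst.comp x hx
    · rw [hfst.mfderiv]
      exact ⟨hinj, (LinearMap.injective_iff_surjective (f :=
        (ContinuousLinearMap.fst ℝ (Euc m) (Euc s) ∘L γ').toLinearMap)).1 hinj⟩
  obtain ⟨σ, hσs, hσ0, hσr, -⟩ := hloc.exists_inverse
  have hγ1 : (Prod.fst ∘ γ) p = u₀ := by rw [Function.comp_apply, hγp]
  rw [hγ1] at hσs hσ0 hσr
  have hσc : Tendsto σ (𝓝 u₀) (𝓝 p) := by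
    have := hσs.self_of_nhds.continuousAt.tendsto
    rwa [hσ0] at this
  refine ⟨σ, fun u => (γ (σ u)).2, ?_, ?_, ?_⟩
  · filter_upwards [hσs, hσc.eventually hγs] with u hu hu'
    exact ⟨hu, contMDiffAt_snd.comp u (hu'.comp u hu)⟩
  · simp only [hσ0, hγp]
  · filter_upwards [hσr, hσc.eventually (hgc.eventually hΦr)] with u hu hu'
    rw [← hu']
    exact congrArg Ψ (Prod.ext hu rfl)

/-! ### Sections of the nullity bundle cut out by neighbouring leaves. -/

section LeafSections

variable {n m s q : ℕ} {M : Type*} [TopologicalSpace M] [ChartedSpace (Euc n) M]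
  [IsManifold 𝓘(ℝ, Euc n) ∞ M] {f η : M → Euc q} {τ π : M → Euc q →L[ℝ] Euc q} {H : M → Euc q}
  {L : Type*} [TopologicalSpace L] [ChartedSpace (Euc m) L] [IsManifold 𝓘(ℝ, Euc m) ∞ L] {j : L → M}

/-- The sections of the nullity bundle along a leaf of the conullity obtained from the other
leaves. -/
theorem DupinFields.exists_leaf_section (D : DupinFields n f η τ π H) (hj : IsLeaf n m f π j)
    (hms : m + s = n)
    (hint : ∀ x : M, ∃ (U : TopologicalSpace.Opens (Euc m)) (g : U → M) (p : U),
      IsLeaf n m f π g ∧ g p = x) (u₀ : L) (ι : Euc s →ₗᵢ[ℝ] Euc q)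
    (hι : ∀ w, π (j u₀) w = w ↔ ∃ z, ι z = w) :
    ∃ R : ℝ, ∀ a, π (j u₀) a = a → R < ‖a‖ → ∃ ζ : L → Euc q,
      (∀ᶠ u in 𝓝 u₀, ContMDiffAt 𝓘(ℝ, Euc m) 𝓘(ℝ, Euc q) ∞ ζ u) ∧ ζ u₀ = a ∧
      ∀ᶠ u in 𝓝 u₀, π (j u) (ζ u) = ζ u ∧ ∀ X, π (j u) (dd m ζ u X + dd m (H ∘ j) u X) =
        ⟪H (j u), dd m (f ∘ j) u X⟫ • ζ u := by
  have DL := D.leafFields hj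
  set V : L × Euc s → Euc q := fun p => π (j p.1) (ι p.2) with hV
  have hπι : ∀ z, π (j u₀) (ι z) = ι z := fun z => (hι _).2 ⟨z, rfl⟩
  have hVs : ∀ p, ContMDiffAt (𝓘(ℝ, Euc m).prod 𝓘(ℝ, Euc s)) 𝓘(ℝ, Euc q) ∞ V p := fun p => by
    have h1 : ContMDiffAt (𝓘(ℝ, Euc m).prod 𝓘(ℝ, Euc s)) 𝓘(ℝ, Euc q →L[ℝ] Euc q) ∞
        (fun p : L × Euc s => π (j p.1)) p :=
      DL.smooth_π.contMDiffAt.comp p contMDiffAt_fst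
    have h2 : ContMDiffAt (𝓘(ℝ, Euc m).prod 𝓘(ℝ, Euc s)) 𝓘(ℝ, Euc q) ∞
        (fun p : L × Euc s => ι p.2) p :=
      ι.toContinuousLinearMap.contMDiff.contMDiffAt.comp p contMDiffAt_snd
    exact h1.clm_apply h2
  have hιd : HasFDerivAt (fun z => V (u₀, z)) ι.toContinuousLinearMap 0 := by
    have : (fun z => V (u₀, z)) = ι.toContinuousLinearMap := funext hπι
    rw [this]
    exact ι.toContinuousLinearMap.hasFDerivAt
  obtain ⟨Ψ, hΨ, -, hΨf⟩ := D.exists_tube hj hms u₀ (Eventually.of_forall hVs)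
    (Eventually.of_forall fun p => D.π_π _ _) (Eventually.of_forall fun u => by simp [hV]) hιd
    ι.injective hπι
  have hgood := hΨ.eventually.and hΨf.eventually_nhds
  have hz : Tendsto (fun z : Euc s => (u₀, z)) (𝓝 0) (𝓝 (u₀, 0)) :=
    (Continuous.prodMk_right u₀).tendsto 0
  obtain ⟨r, hr, hball⟩ := Metric.eventually_nhds_iff_ball.1 (hz.eventually hgood)
  -- Inversion turns `‖a‖ > r⁻¹` into `‖z₀‖ < r`, so that the point of the sphere lies inside the
  -- tube.
  refine ⟨r⁻¹, fun a ha hRa => ?_⟩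
  have ha0 : 0 < ‖a‖ := (inv_pos.2 hr).trans hRa
  obtain ⟨z₁, hz₁⟩ := (hι a).1 ha
  set z₀ := (‖a‖ ^ 2)⁻¹ • z₁ with hz₀
  have hz₁n : ‖z₁‖ = ‖a‖ := by rw [← hz₁, ι.norm_map]
  have hz₀n : ‖z₀‖ = ‖a‖⁻¹ := by
    rw [hz₀, norm_smul, hz₁n, norm_inv, norm_pow, norm_norm]
    field_simp
  have hz₀r : z₀ ∈ Metric.ball (0 : Euc s) r := by
    rw [mem_ball_zero_iff, hz₀n]
    exact inv_lt_of_inv_lt₀ hr hRa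
  obtain ⟨hΨ1, hΨ2⟩ := hball z₀ hz₀r
  have hV₀ : V (u₀, z₀) = (‖a‖ ^ 2)⁻¹ • a := by
    change π (j u₀) (ι z₀) = _
    rw [hπι, hz₀, map_smul, hz₁]
  -- Integrability of the conullity enters here: a leaf passes through a point of the tube that need
  -- not lie on `L`.
  obtain ⟨U, g, p, hg, hgp⟩ := hint (Ψ (u₀, z₀))
  have DU := D.leafFields hg
  have hΨd := (hΨ1.contMDiffAt.mdifferentiableAt (by simp)).hasMFDerivAt
  set Ψ' : Euc m × Euc s →L[ℝ] Euc n :=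
    mfderiv (𝓘(ℝ, Euc m).prod 𝓘(ℝ, Euc s)) 𝓘(ℝ, Euc n) Ψ (u₀, z₀) with hΨ'
  have hfib : ∀ Z, dd n f (Ψ (u₀, z₀)) (Ψ' (0, Z)) =
      fderiv ℝ (sphereDisp (H (j u₀))) (V (u₀, z₀)) (ι Z) := by
    intro Z
    have h1 : HasMFDerivAt 𝓘(ℝ, Euc s) (𝓘(ℝ, Euc m).prod 𝓘(ℝ, Euc s))
        (fun z : Euc s => (u₀, z)) z₀
        ((0 : Euc s →L[ℝ] Euc m).prod (ContinuousLinearMap.id ℝ (Euc s))) :=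
      (hasMFDerivAt_const u₀ z₀).prodMk (hasMFDerivAt_id z₀)
    have h2 : HasFDerivAt (fun z : Euc s => f (Ψ (u₀, z))) (dd n f (Ψ (u₀, z₀)) ∘L Ψ' ∘L
        ((0 : Euc s →L[ℝ] Euc m).prod (ContinuousLinearMap.id ℝ (Euc s)))) z₀ :=
      ((D.smooth_f.hasDD _).hasMFDerivAt.comp z₀ (hΨd.comp z₀ h1)).hasFDerivAt
    have h3 : HasFDerivAt (fun z => sphereDisp (H (j u₀)) (V (u₀, z)))
        (fderiv ℝ (sphereDisp (H (j u₀))) (V (u₀, z₀)) ∘L ι.toContinuousLinearMap) z₀ := by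
      have h5 := ((contDiff_sphereDisp_right (H (j u₀))).differentiable (by simp)
        (V (u₀, z₀))).hasFDerivAt
      have h6 : HasFDerivAt (fun z => V (u₀, z)) ι.toContinuousLinearMap z₀ := by
        have : (fun z => V (u₀, z)) = ι.toContinuousLinearMap := funext hπι
        rw [this]
        exact ι.toContinuousLinearMap.hasFDerivAt
      exact HasFDerivAt.comp z₀ h5 h6
    have h7 : Tendsto (fun z : Euc s => (u₀, z)) (𝓝 z₀) (𝓝 (u₀, z₀)) :=
      (Continuous.prodMk_right u₀).tendsto z₀
    have h8 := (h3.const_add (f (j u₀))).congr_of_eventuallyEq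
      (f₁ := fun z : Euc s => f (Ψ (u₀, z))) (by
        filter_upwards [h7.eventually hΨ2] with z hz using hz.1)
    have h4 := congrArg (fun T : Euc s →L[ℝ] Euc q => T Z) (h2.unique h8)
    exact h4
  have hHι : ∀ z, ⟪ι z, H (j u₀)⟫ = 0 := fun z => DL.inner_H u₀ (hπι z)
  -- Fibre directions are tangent to the sphere, so `π` fixes their images at this point, while it
  -- annihilates the directions of the leaf.
  have htr : ∀ X Z, mdd m n g p X = Ψ' (0, Z) → X = 0 := by
    intro X Z hXZ
    have h1 : dd m (f ∘ g) p X = fderiv ℝ (sphereDisp (H (j u₀))) (V (u₀, z₀)) (ι Z) := by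
      rw [dd_comp D.smooth_f hg.smooth, hXZ, ← hfib, hgp]
    have h2 := DU.π_h p X
    have h3 : π (g p) (dd m (f ∘ g) p X) = dd m (f ∘ g) p X := by
      rw [hgp, hΨ2.self_of_nhds.2]
      exact sphere_tangent (D.π_H _) (D.π_π _ _) (hπι Z)
        (DL.inner_H u₀ (D.π_π _ _)) (hHι Z) h1
    refine DU.inj p ?_
    rw [map_zero, ← h3]
    exact h2
  obtain ⟨σ, z, hσz, hz0, hgσ⟩ := exists_graph_of_transversal hΨ1 hg.smooth hgp hΨd htr
  set v : L → Euc q := fun u => V (u, z u) with hv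
  have hv0 : v u₀ = (‖a‖ ^ 2)⁻¹ • a := by rw [hv]; simp only [hz0, hV₀]
  have hane : a ≠ 0 := norm_pos_iff.1 ha0
  have hvne0 : v u₀ ≠ 0 := by
    rw [hv0]
    exact smul_ne_zero (inv_ne_zero (pow_ne_zero 2 ha0.ne')) hane
  have hvs : ∀ᶠ u in 𝓝 u₀, ContMDiffAt 𝓘(ℝ, Euc m) 𝓘(ℝ, Euc q) ∞ v u := by
    filter_upwards [hσz] with u hu using (hVs _).comp u (contMDiffAt_id.prodMk hu.2)
  have hvne : ∀ᶠ u in 𝓝 u₀, v u ≠ 0 :=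
    hvs.self_of_nhds.continuousAt.eventually_ne hvne0
  set ζ : L → Euc q := fun u => (‖v u‖ ^ 2)⁻¹ • v u with hζ
  have hζs : ∀ᶠ u in 𝓝 u₀, ContMDiffAt 𝓘(ℝ, Euc m) 𝓘(ℝ, Euc q) ∞ ζ u := by
    filter_upwards [hvs, hvne] with u hu hu'
    have h1 : ContDiffAt ℝ ∞ (fun w : Euc q => (‖w‖ ^ 2)⁻¹ • w) (v u) :=
      ((contDiffAt_id.norm_sq ℝ).inv (pow_ne_zero 2 (norm_ne_zero_iff.2 hu'))).smul contDiffAt_id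
    exact h1.contMDiffAt.comp u hu
  have hζ0 : ζ u₀ = a := by
    simp only [hζ, hv0, norm_smul, norm_inv, norm_pow, norm_norm, smul_smul]
    have : ((‖a‖ ^ 2)⁻¹ * ‖a‖) ^ 2 = (‖a‖ ^ 2)⁻¹ := by field_simp
    rw [this, inv_inv, mul_inv_cancel₀ (pow_ne_zero 2 ha0.ne'), one_smul]
  have hzc : Tendsto (fun u => (u, z u)) (𝓝 u₀) (𝓝 (u₀, z₀)) := by
    have h1 : ContinuousAt (fun u => (u, z u)) u₀ :=
      continuousAt_id.prodMk hσz.self_of_nhds.2.continuousAt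
    have h2 := h1.tendsto
    rwa [hz0] at h2
  refine ⟨ζ, hζs, hζ0, ?_⟩
  filter_upwards [hσz, hζs, hvne.eventually_nhds, hgσ.eventually_nhds,
    (hzc.eventually hΨ2).eventually_nhds] with u huσ huζ huv hug huΨ
  have hπv : π (j u) (v u) = v u := D.π_π _ _
  have hπζ : π (j u) (ζ u) = ζ u := by simp only [hζ, map_smul, hπv]
  refine ⟨hπζ, fun X => ?_⟩
  have hWne : ∀ u', v u' ≠ 0 → H (j u') + ζ u' ≠ 0 := by
    intro u' hu' h0
    have h1 : π (j u') (v u') = v u' := D.π_π _ _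
    have h2 := congrArg (π (j u')) h0
    simp only [hζ, map_add, D.π_H, map_smul, h1, zero_add, map_zero, smul_eq_zero, inv_eq_zero] at h2
    rcases h2 with h2 | h2
    · exact hu' (by simpa using h2)
    · exact hu' h2
  have hdisp : ∀ u', v u' ≠ 0 → sphereDisp (H (j u')) (V (u', z u')) =
      (2 / ‖H (j u') + ζ u'‖ ^ 2) • (H (j u') + ζ u') := by
    intro u' hu'
    refine sphereDisp_eq_inversion hu' ?_
    rw [real_inner_comm]
    exact DL.inner_H u' (D.π_π _ _)
  have hW : HasDD (fun u' => H (j u') + ζ u') (dd m (H ∘ j) u + dd m ζ u) u :=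
    (DL.smooth_H.hasDD u).add huζ.hasDD
  have hlhs : HasDD (fun u' => f (g (σ u'))) (dd m (f ∘ g) (σ u) ∘L mdd m m σ u) u :=
    (DU.smooth_h.hasDD (σ u)).comp_right (huσ.1.mdifferentiableAt (by simp)).hasMFDerivAt
  have hrhs := (DL.smooth_h.hasDD u).add (HasDD.comp_left
    (hasFDerivAt_inversion (hWne u huv.self_of_nhds)) hW)
  have heq := hrhs.congr (G := fun u' => f (g (σ u'))) (by
    filter_upwards [huv, hug, huΨ] with u' h1 h2 h3
    rw [h2, h3.1, hdisp u' h1]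
    rfl)
  have hder := congrArg (fun T => T X) (hlhs.dd_eq.symm.trans heq.dd_eq)
  refine ext_inner_right ℝ fun b => ?_
  rw [D.π_symm, real_inner_smul_left]
  have hπa : π (j u) (π (j u) b) = π (j u) b := D.π_π _ _
  have hHa : ⟪H (j u), π (j u) b⟫ = 0 := by rw [real_inner_comm]; exact DL.inner_H u hπa
  have hHζ : ⟪H (j u), ζ u⟫ = 0 := by rw [real_inner_comm]; exact DL.inner_H u hπζ
  have hζb : ⟪ζ u, π (j u) b⟫ = ⟪ζ u, b⟫ := by rw [← D.π_symm, hπζ]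
  have hn0 : ‖H (j u) + ζ u‖ ≠ 0 := norm_ne_zero_iff.2 (hWne u huv.self_of_nhds)
  have hd := hdisp u huv.self_of_nhds
  -- The equation is tested against an arbitrary `b`. The reflection of `π b` lies in the nullity at
  -- the corresponding point of the other leaf, hence is orthogonal to that leaf.
  have key := inner_deriv_of_orthogonal (W' := dd m ζ u X + dd m (H ∘ j) u X)
    (d' := (2 / ‖H (j u) + ζ u‖ ^ 2) • (dd m ζ u X + dd m (H ∘ j) u X) -
      (4 * ⟪H (j u) + ζ u, dd m ζ u X + dd m (H ∘ j) u X⟫ / (‖H (j u) + ζ u‖ ^ 2) ^ 2) •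
        (H (j u) + ζ u)) hHa
    (by rw [real_inner_comm]; exact DL.inner_h u hπa X)
    (by rw [real_inner_comm]; exact DL.inner_h u hπζ X) hn0 hd rfl ?_
  · rw [key, hζb, mul_comm]
  · have h1 : dd m (f ∘ j) u X + ((2 / ‖H (j u) + ζ u‖ ^ 2) • (dd m ζ u X + dd m (H ∘ j) u X) -
      (4 * ⟪H (j u) + ζ u, dd m ζ u X + dd m (H ∘ j) u X⟫ / (‖H (j u) + ζ u‖ ^ 2) ^ 2) •
        (H (j u) + ζ u)) = dd m (f ∘ g) (σ u) (mdd m m σ u X) := by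
      refine Eq.trans ?_ hder.symm
      simp only [add_comm (dd m ζ u X), add_apply, sub_apply, smul_apply, smul_eq_mul,
        ContinuousLinearMap.comp_apply, ContinuousLinearMap.smulRight_apply,
        ContinuousLinearMap.id_apply, innerSL_apply_apply, div_mul_eq_mul_div, Function.comp_def]
    rw [h1]
    have h2 := sphere_reflect (D.π_H (j u)) hπζ hπa hHζ hHa hn0 hd
    rw [← huΨ.self_of_nhds.2, ← hug.self_of_nhds] at h2
    rw [← h2, ← D.π_symm]
    have h3 : π (g (σ u)) (dd m (f ∘ g) (σ u) (mdd m m σ u X)) = 0 := DU.π_h _ _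
    rw [h3, inner_zero_left]

end LeafSections

end Submfd

end

/-! ### The linear system for the pair and its local solutions. -/

noncomputable section
namespace Submfd
open Filter Topology Set

variable {m q s : ℕ} {L : Type*} [TopologicalSpace L] [ChartedSpace (Euc m) L]
  {h η : L → Euc q} {τ π : L → Euc q →L[ℝ] Euc q} {H : L → Euc q}

/-- The linear system at `u` satisfied by a pair `(φ, b)` determining a Ribaucour transform whose
leaf at infinity is `h`; parallel sections of the bundle `N` are the solutions with `φ = 0`. -/
structure IsSolAt (m : ℕ) {L : Type*} [TopologicalSpace L] [ChartedSpace (Euc m) L] (h : L → Euc q)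
    (π : L → Euc q →L[ℝ] Euc q) (H : L → Euc q) (φ : L → ℝ) (b : L → Euc q) (u : L) : Prop where
  smooth_φ : ContMDiffAt 𝓘(ℝ, Euc m) 𝓘(ℝ, ℝ) ∞ φ u
  smooth_b : ContMDiffAt 𝓘(ℝ, Euc m) 𝓘(ℝ, Euc q) ∞ b u
  mem : π u (b u) = b u
  dφ : ∀ X, dd m φ u X = -(φ u * ⟪H u, dd m h u X⟫)
  db : ∀ X, π u (dd m b u X) = φ u • π u (dd m H u X)

namespace IsSolAt

variable {φ φ' : L → ℝ} {b b' : L → Euc q} {u : L}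

theorem congr (hs : IsSolAt m h π H φ b u) (hφ : φ' =ᶠ[𝓝 u] φ) (hb : b' =ᶠ[𝓝 u] b) :
    IsSolAt m h π H φ' b' u where
  smooth_φ := hs.smooth_φ.congr_of_eventuallyEq hφ
  smooth_b := hs.smooth_b.congr_of_eventuallyEq hb
  mem := by rw [hb.eq_of_nhds, hs.mem]
  dφ X := by rw [dd_congr hφ, hφ.eq_of_nhds, hs.dφ]
  db X := by rw [dd_congr hb, hφ.eq_of_nhds, hs.db]

theorem add (h1 : IsSolAt m h π H φ b u) (h2 : IsSolAt m h π H φ' b' u) :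
    IsSolAt m h π H (fun u => φ u + φ' u) (fun u => b u + b' u) u where
  smooth_φ := h1.smooth_φ.add h2.smooth_φ
  smooth_b := h1.smooth_b.add h2.smooth_b
  mem := by rw [map_add, h1.mem, h2.mem]
  dφ X := by
    rw [(h1.smooth_φ.hasDD.add h2.smooth_φ.hasDD).dd_eq, add_apply, h1.dφ, h2.dφ]
    ring
  db X := by
    rw [(h1.smooth_b.hasDD.add h2.smooth_b.hasDD).dd_eq, add_apply, map_add, h1.db, h2.db,
      add_smul]

theorem smul (c : ℝ) (h1 : IsSolAt m h π H φ b u) :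
    IsSolAt m h π H (fun u => c * φ u) (fun u => c • b u) u where
  smooth_φ := contMDiffAt_const.mul h1.smooth_φ
  smooth_b := (contDiff_const_smul c).contMDiff.contMDiffAt.comp u h1.smooth_b
  mem := by rw [map_smul, h1.mem]
  dφ X := by
    have := (h1.smooth_φ.hasDD.const_smul c).dd_eq
    simp only [smul_eq_mul] at this
    rw [this, smul_apply, h1.dφ, smul_eq_mul]
    ring
  db X := by
    rw [(h1.smooth_b.hasDD.const_smul c).dd_eq, smul_apply, map_smul, h1.db, smul_smul]

theorem sub (h1 : IsSolAt m h π H φ b u) (h2 : IsSolAt m h π H φ' b' u) :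
    IsSolAt m h π H (fun u => φ u - φ' u) (fun u => b u - b' u) u := by
  refine (h1.add (h2.smul (-1))).congr ?_ ?_
  · exact Eventually.of_forall fun v => by ring
  · exact Eventually.of_forall fun v => by
      change _ = b v + (-1 : ℝ) • b' v
      module

theorem zero (u : L) : IsSolAt m h π H (fun _ => 0) (fun _ => 0) u where
  smooth_φ := contMDiffAt_const
  smooth_b := contMDiffAt_const
  mem := map_zero _
  dφ X := by rw [(HasDD.const (0 : ℝ) u).dd_eq]; simp
  db X := by rw [(HasDD.const (0 : Euc q) u).dd_eq]; simp

theorem sum {ι : Type*} (t : Finset ι) (c : ι → ℝ) {ξ : ι → L → Euc q}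
    (hξ : ∀ i, IsSolAt m h π H (fun _ => 0) (ξ i) u) :
    IsSolAt m h π H (fun _ => 0) (fun u => ∑ i ∈ t, c i • ξ i u) u := by
  classical
  induction t using Finset.induction_on with
  | empty => simpa using zero u
  | insert i t hi ih =>
    have := ((hξ i).smul (c i)).add ih
    simpa [Finset.sum_insert hi] using this

/-- Two sections of the bundle which are parallel have constant inner product. -/
theorem hasDD_inner (hπ : ∀ x v w, ⟪π x v, w⟫ = ⟪v, π x w⟫)
    (h1 : IsSolAt m h π H (fun _ => 0) b u) (h2 : IsSolAt m h π H (fun _ => 0) b' u) :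
    HasDD (fun u => ⟪b u, b' u⟫) (0 : Euc m →L[ℝ] ℝ) u := by
  have h3 := HasDD.inner h1.smooth_b.hasDD h2.smooth_b.hasDD
  convert h3 using 1
  ext1 X
  simp only [add_apply, ContinuousLinearMap.comp_apply, innerSL_apply_apply, zero_apply]
  rw [← h1.mem, hπ, h2.db, ← h2.mem, hπ, h1.db]
  simp

/-- The quotient of the functions of two solutions is constant. -/
theorem hasDD_div (h1 : IsSolAt m h π H φ b u) (h2 : IsSolAt m h π H φ' b' u) (h0 : φ' u ≠ 0) :
    HasDD (fun u => φ u / φ' u) (0 : Euc m →L[ℝ] ℝ) u := by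
  have h3 := h1.smooth_φ.hasDD.smul (HasDD.comp_left (hasDerivAt_inv h0).hasFDerivAt
    h2.smooth_φ.hasDD)
  refine (h3.congr (G := fun u => φ u / φ' u) (Eventually.of_forall fun v => ?_)).congr_fderiv ?_
  · simp [div_eq_mul_inv]
  · ext1 X
    simp [h1.dφ, h2.dφ]
    field_simp
    ring

end IsSolAt

variable [IsManifold 𝓘(ℝ, Euc m) ∞ L]

/-- A solution of the system is determined by its value at a point. -/
theorem IsSolAt.eventually_eq_zero (hπ : ∀ x v w, ⟪π x v, w⟫ = ⟪v, π x w⟫) {φ φ' : L → ℝ}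
    {b b' : L → Euc q} {u : L} (hs : ∀ᶠ v in 𝓝 u, IsSolAt m h π H φ b v)
    (hs' : ∀ᶠ v in 𝓝 u, IsSolAt m h π H φ' b' v) (h0 : φ' u ≠ 0) (hφ : φ u = 0) (hb : b u = 0) :
    ∀ᶠ v in 𝓝 u, φ v = 0 ∧ b v = 0 := by
  have hne : ∀ᶠ v in 𝓝 u, φ' v ≠ 0 := hs'.self_of_nhds.smooth_φ.continuousAt.eventually_ne h0
  -- The quotient of `φ` by the nonvanishing `φ'` is constant, hence zero. Then `b` is parallel, its
  -- norm is constant, and it vanishes too.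
  have h1 : ∀ᶠ v in 𝓝 u, φ v = 0 := by
    have := eventually_eq_of_hasDD_zero (F := fun u => φ u / φ' u) (by
      filter_upwards [hs, hs', hne] with v a b c using a.hasDD_div b c)
    filter_upwards [this, hne] with v hv hv'
    rw [hφ, zero_div, div_eq_zero_iff] at hv
    exact hv.resolve_right hv'
  have h2 : ∀ᶠ v in 𝓝 u, IsSolAt m h π H (fun _ => 0) b v := by
    filter_upwards [hs, h1.eventually_nhds] with v hv hv'
    exact hv.congr (by filter_upwards [hv'] with w hw using hw.symm) EventuallyEq.rfl
  have h3 := eventually_eq_of_hasDD_zero (F := fun u => ⟪b u, b u⟫) (by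
    filter_upwards [h2] with v hv using hv.hasDD_inner hπ hv)
  filter_upwards [h1, h3] with v hv hv'
  refine ⟨hv, ?_⟩
  rwa [hb, inner_zero_left, inner_self_eq_zero] at hv'

theorem IsSolAt.eventually_eq (hπ : ∀ x v w, ⟪π x v, w⟫ = ⟪v, π x w⟫) {φ₁ φ₂ φ' : L → ℝ}
    {b₁ b₂ b' : L → Euc q} {u : L} (hs₁ : ∀ᶠ v in 𝓝 u, IsSolAt m h π H φ₁ b₁ v)
    (hs₂ : ∀ᶠ v in 𝓝 u, IsSolAt m h π H φ₂ b₂ v)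
    (hs' : ∀ᶠ v in 𝓝 u, IsSolAt m h π H φ' b' v) (h0 : φ' u ≠ 0) (hφ : φ₁ u = φ₂ u)
    (hb : b₁ u = b₂ u) : ∀ᶠ v in 𝓝 u, φ₁ v = φ₂ v ∧ b₁ v = b₂ v := by
  have := IsSolAt.eventually_eq_zero hπ (φ := fun v => φ₁ v - φ₂ v) (b := fun v => b₁ v - b₂ v)
    (by filter_upwards [hs₁, hs₂] with v a b using a.sub b) hs' h0 (sub_eq_zero.2 hφ)
    (sub_eq_zero.2 hb)
  simpa only [sub_eq_zero] using this

/-- A local solution and a local parallel orthonormal frame. -/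
structure IsLocalFrameAt (m : ℕ) {L : Type*} [TopologicalSpace L] [ChartedSpace (Euc m) L]
    (h : L → Euc q) (π : L → Euc q →L[ℝ] Euc q) (H : L → Euc q) (φ : L → ℝ) (b : L → Euc q)
    {s : ℕ} (ξ : Fin s → L → Euc q) (u : L) : Prop where
  sol : IsSolAt m h π H φ b u
  ne_zero : φ u ≠ 0
  sol_ξ : ∀ i, IsSolAt m h π H (fun _ => 0) (ξ i) u
  orthonormal : Orthonormal ℝ (fun i => ξ i u)

/-- `s + 1` sections coming from leaves in general position determine a local frame. -/
theorem LeafFields.exists_localFrame (D : LeafFields m h η τ π H) (hs : 1 ≤ s) (u₀ : L)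
    (ι : Euc s →ₗᵢ[ℝ] Euc q) (hι : ∀ z, π u₀ (ι z) = ι z)
    (hsec : ∃ R : ℝ, ∀ a, π u₀ a = a → R < ‖a‖ → ∃ ζ : L → Euc q,
      (∀ᶠ u in 𝓝 u₀, ContMDiffAt 𝓘(ℝ, Euc m) 𝓘(ℝ, Euc q) ∞ ζ u) ∧ ζ u₀ = a ∧
      ∀ᶠ u in 𝓝 u₀, π u (ζ u) = ζ u ∧ ∀ X, π u (dd m ζ u X + dd m H u X) =
        ⟪H u, dd m h u X⟫ • ζ u) :
    ∃ (φ : L → ℝ) (b : L → Euc q) (ξ : Fin s → L → Euc q),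
      ∀ᶠ u in 𝓝 u₀, IsLocalFrameAt m h π H φ b ξ u := by
  obtain ⟨R, hR⟩ := hsec
  set e : Fin s → Euc q := fun i => ι (EuclideanSpace.basisFun (Fin s) ℝ i) with he
  have heo : Orthonormal ℝ e := (EuclideanSpace.basisFun (Fin s) ℝ).orthonormal.comp_linearIsometry ι
  have hen : ∀ i, ‖e i‖ = 1 := heo.1
  let i₀ : Fin s := ⟨0, hs⟩
  -- With `|R| + 2`, the vectors `a₀ + e i` still have norm at least `|R| + 1 > R`, so all `s + 1`
  -- initial values are admissible.
  set a₀ : Euc q := (|R| + 2) • e i₀ with ha₀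
  have ha₀n : ‖a₀‖ = |R| + 2 := by
    rw [ha₀, norm_smul, hen, mul_one, Real.norm_of_nonneg (by positivity)]
  have hRle := le_abs_self R
  obtain ⟨ζ₀, hζ₀s, hζ₀0, hζ₀⟩ := hR a₀ (by rw [ha₀, map_smul, hι]) (by rw [ha₀n]; linarith)
  have hex : ∀ i, ∃ ζ : L → Euc q,
      (∀ᶠ u in 𝓝 u₀, ContMDiffAt 𝓘(ℝ, Euc m) 𝓘(ℝ, Euc q) ∞ ζ u) ∧ ζ u₀ = a₀ + e i ∧
      ∀ᶠ u in 𝓝 u₀, π u (ζ u) = ζ u ∧ ∀ X, π u (dd m ζ u X + dd m H u X) =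
        ⟪H u, dd m h u X⟫ • ζ u := fun i => by
    refine hR _ (by rw [ha₀, map_add, map_smul, hι, hι]) ?_
    have h1 := norm_sub_le (a₀ + e i) (e i)
    rw [add_sub_cancel_right, ha₀n, hen] at h1
    linarith
  choose ζ hζs hζ0 hζ using hex
  -- The system for `ζ` is affine, so the inhomogeneous term `π dH` disappears from differences: `π
  -- dχ(X) = ⟨H, X⟩χ`.
  set χ : Fin s → L → Euc q := fun i u => ζ i u - ζ₀ u with hχ
  have hχ0 : ∀ i, χ i u₀ = e i := fun i => by simp only [hχ, hζ0, hζ₀0, add_sub_cancel_left]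
  set G : Fin s → Fin s → L → ℝ := fun i k u => ⟪χ i u, χ k u⟫ with hG
  have hG0 : G i₀ i₀ u₀ = 1 := by simp only [hG, hχ0, real_inner_self_eq_norm_sq, hen, one_pow]
  have hχs : ∀ i, ∀ᶠ u in 𝓝 u₀, ContMDiffAt 𝓘(ℝ, Euc m) 𝓘(ℝ, Euc q) ∞ (χ i) u := fun i => by
    filter_upwards [hζs i, hζ₀s] with u h1 h2 using h1.sub h2
  have hχπ : ∀ i, ∀ᶠ u in 𝓝 u₀, π u (χ i u) = χ i u ∧
      ∀ X, π u (dd m (χ i) u X) = ⟪H u, dd m h u X⟫ • χ i u := fun i => by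
    filter_upwards [hζ i, hζ₀, hζs i, hζ₀s] with u h1 h2 h3 h4
    refine ⟨by simp only [hχ, map_sub, h1.1, h2.1], fun X => ?_⟩
    have h5 := (h3.hasDD.sub h4.hasDD).dd_eq
    have h6 : dd m (χ i) u X = (dd m (ζ i) u X + dd m H u X) - (dd m ζ₀ u X + dd m H u X) := by
      rw [hχ, h5, sub_apply]; abel
    rw [h6, map_sub, h1.2, h2.2, hχ, smul_sub]
  have hGd : ∀ i k, ∀ᶠ u in 𝓝 u₀, ∀ X, dd m (G i k) u X = 2 * ⟪H u, dd m h u X⟫ * G i k u := by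
    intro i k
    filter_upwards [hχs i, hχs k, hχπ i, hχπ k] with u h1 h2 h3 h4 X
    rw [(HasDD.inner h1.hasDD h2.hasDD).dd_eq]
    simp only [add_apply, ContinuousLinearMap.comp_apply, innerSL_apply_apply, hG]
    have e1 : ⟪χ i u, dd m (χ k) u X⟫ = ⟪H u, dd m h u X⟫ * ⟪χ i u, χ k u⟫ := by
      rw [← h3.1, D.π_symm, h4.2, real_inner_smul_right, h3.1]
    have e2 : ⟪χ k u, dd m (χ i) u X⟫ = ⟪H u, dd m h u X⟫ * ⟪χ i u, χ k u⟫ := by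
      rw [← h4.1, D.π_symm, h3.2, real_inner_smul_right, h4.1,
        real_inner_comm (χ i u) (χ k u)]
    rw [e1, e2]; ring
  have hGs : ∀ i k, ∀ᶠ u in 𝓝 u₀, ContMDiffAt 𝓘(ℝ, Euc m) 𝓘(ℝ, ℝ) ∞ (G i k) u := by
    intro i k
    filter_upwards [hχs i, hχs k] with u h1 h2
    exact (contDiff_inner (𝕜 := ℝ) (E := Euc q)).contMDiff.contMDiffAt.comp u (h1.prodMk_space h2)
  have hpos : ∀ᶠ u in 𝓝 u₀, 0 < G i₀ i₀ u :=
    (hGs i₀ i₀).self_of_nhds.continuousAt.eventually (lt_mem_nhds (by rw [hG0]; exact one_pos))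
  -- All inner products satisfy `dG = 2⟨H,·⟩G`, so the inverse length of one `χ` solves `dφ =
  -- -φ⟨H,·⟩`. Scaling by `φ` makes every `χ` parallel.
  set φ : L → ℝ := fun u => (√(G i₀ i₀ u))⁻¹ with hφ
  have hφne : ∀ᶠ u in 𝓝 u₀, φ u ≠ 0 := by
    filter_upwards [hpos] with u hu using inv_ne_zero (Real.sqrt_pos.2 hu).ne'
  have hφs : ∀ᶠ u in 𝓝 u₀, ContMDiffAt 𝓘(ℝ, Euc m) 𝓘(ℝ, ℝ) ∞ φ u := by
    filter_upwards [hGs i₀ i₀, hpos] with u h1 h2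
    have h3 : ContDiffAt ℝ ∞ (fun x : ℝ => (√x)⁻¹) (G i₀ i₀ u) :=
      (Real.contDiffAt_sqrt h2.ne').inv (Real.sqrt_pos.2 h2).ne'
    exact h3.contMDiffAt.comp u h1
  have hφd : ∀ᶠ u in 𝓝 u₀, ∀ X, dd m φ u X = -(φ u * ⟪H u, dd m h u X⟫) := by
    filter_upwards [hGs i₀ i₀, hpos, hGd i₀ i₀] with u h1 h2 h3 X
    have h4 := (Real.hasDerivAt_sqrt h2.ne').inv (Real.sqrt_pos.2 h2).ne'
    have h5 := (HasDD.comp_left h4.hasFDerivAt h1.hasDD).dd_eq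
    rw [show dd m φ u = _ from h5]
    have h6 : (√(G i₀ i₀ u)) ≠ 0 := (Real.sqrt_pos.2 h2).ne'
    have h7 : G i₀ i₀ u = √(G i₀ i₀ u) ^ 2 := (Real.sq_sqrt h2.le).symm
    simp [h3]
    rw [show φ u = (√(G i₀ i₀ u))⁻¹ from rfl]
    generalize √(G i₀ i₀ u) = r at h6 h7 ⊢
    rw [h7]
    field_simp
  have hφ0 : φ u₀ = 1 := by simp [hφ, hG0]
  set ξ : Fin s → L → Euc q := fun i u => φ u • χ i u with hξ
  have hξs : ∀ i, ∀ᶠ u in 𝓝 u₀, IsSolAt m h π H (fun _ => 0) (ξ i) u := fun i => by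
    filter_upwards [hφs, hφd, hχs i, hχπ i] with u h1 h2 h3 h4
    refine ⟨contMDiffAt_const, h1.smul h3, by simp only [hξ, map_smul, h4.1], fun X => ?_, fun X => ?_⟩
    · rw [(HasDD.const (0 : ℝ) u).dd_eq]; simp
    · rw [show dd m (ξ i) u = _ from (h1.hasDD.smul h3.hasDD).dd_eq, add_apply, smul_apply,
        ContinuousLinearMap.smulRight_apply, map_add, map_smul, map_smul, h4.1, h4.2, h2, zero_smul]
      module
  -- In the derivative of `-φ ζ₀` the term from `dφ` cancels the term `⟨H, X⟩ζ₀`, and `φ π dH`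
  -- remains.
  have hbs : ∀ᶠ u in 𝓝 u₀, IsSolAt m h π H φ (fun u => -(φ u • ζ₀ u)) u := by
    filter_upwards [hφs, hφd, hζ₀s, hζ₀] with u h1 h2 h3 h4
    refine ⟨h1, (h1.smul h3).neg, by simp only [map_neg, map_smul, h4.1], h2, fun X => ?_⟩
    rw [(h1.hasDD.smul h3.hasDD).neg.dd_eq, neg_apply, add_apply, smul_apply,
      ContinuousLinearMap.smulRight_apply, map_neg, map_add, map_smul, map_smul, h4.1, h2,
      eq_sub_of_add_eq ((map_add (π u) _ _).symm.trans (h4.2 X))]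
    module
  have hinner : ∀ᶠ u in 𝓝 u₀, ∀ i k, ⟪ξ i u, ξ k u⟫ = ⟪ξ i u₀, ξ k u₀⟫ := by
    refine eventually_all.2 fun i => eventually_all.2 fun k => ?_
    refine eventually_eq_of_hasDD_zero (k := m) (F := fun u => ⟪ξ i u, ξ k u⟫) ?_
    filter_upwards [hξs i, hξs k] with u h1 h2 using h1.hasDD_inner D.π_symm h2
  refine ⟨φ, fun u => -(φ u • ζ₀ u), ξ, ?_⟩
  filter_upwards [hbs, hφne, eventually_all.2 hξs, hinner] with u h1 h2 h3 h4
  refine ⟨h1, h2, h3, ?_⟩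
  classical
  rw [orthonormal_iff_ite] at heo ⊢
  intro i k
  rw [h4, ← heo i k]
  simp only [hξ, hφ0, one_smul, hχ0]

end Submfd

end

/-! ### Global solutions on a simply connected leaf. -/

noncomputable section
namespace Submfd
open Filter Topology Set

variable {m q s : ℕ} {L : Type*} [TopologicalSpace L] [ChartedSpace (Euc m) L]
  {h η : L → Euc q} {τ π : L → Euc q →L[ℝ] Euc q} {H : L → Euc q}

/-- An orthonormal family of `s` vectors in an `s`-dimensional subspace is a basis of it. -/
theorem sum_inner_smul_of_orthonormal {ι : Euc s →ₗᵢ[ℝ] Euc q} {ξ : Fin s → Euc q}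
    (hξ : Orthonormal ℝ ξ) (hι : ∀ i, ∃ z, ι z = ξ i) (z : Euc s) :
    ∑ i, ⟪ξ i, ι z⟫ • ξ i = ι z := by
  choose c hc using hι
  have hco : Orthonormal ℝ c := by
    rw [← ι.orthonormal_comp_iff]
    convert hξ using 1
    exact funext hc
  have hcard : Fintype.card (Fin s) = Module.finrank ℝ (Euc s) := by simp
  let B := (basisOfLinearIndependentOfCardEqFinrank' c hco.linearIndependent hcard)
  have hB : ⇑B = c := coe_basisOfLinearIndependentOfCardEqFinrank' _ _ _
  let B' := B.toOrthonormalBasis (by rw [hB]; exact hco)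
  have hB' : ⇑B' = c := by rw [Module.Basis.coe_toOrthonormalBasis, hB]
  have h1 := B'.sum_repr' z
  rw [hB'] at h1
  conv_rhs => rw [← h1]
  rw [map_sum]
  refine Finset.sum_congr rfl fun i _ => ?_
  rw [map_smul, ← hc, ι.inner_map_map]

/-- The vectors fixed by `π` form a bundle of rank `s`. -/
def HasRank (π : L → Euc q →L[ℝ] Euc q) (s : ℕ) : Prop :=
  ∀ u, ∃ ι : Euc s →ₗᵢ[ℝ] Euc q, ∀ w, π u w = w ↔ ∃ z, ι z = w

omit [TopologicalSpace L] [ChartedSpace (Euc m) L] in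
theorem HasRank.sum_inner_smul (hr : HasRank π s) {u : L} {ξ : Fin s → Euc q}
    (hξ : Orthonormal ℝ ξ) (hπ : ∀ i, π u (ξ i) = ξ i) {w : Euc q} (hw : π u w = w) :
    ∑ i, ⟪ξ i, w⟫ • ξ i = w := by
  obtain ⟨ι, hι⟩ := hr u
  obtain ⟨z, rfl⟩ := (hι w).1 hw
  exact sum_inner_smul_of_orthonormal hξ (fun i => (hι _).1 (hπ i)) z

variable [IsManifold 𝓘(ℝ, Euc m) ∞ L]

/-- On a simply connected leaf, the solutions of the system extend to the whole leaf. -/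
theorem exists_global_solution [SimplyConnectedSpace L] (hπ : ∀ x v w, ⟪π x v, w⟫ = ⟪v, π x w⟫)
    (hr : HasRank π s)
    (hloc : ∀ u₀, ∃ (φ : L → ℝ) (b : L → Euc q) (ξ : Fin s → L → Euc q),
      ∀ᶠ u in 𝓝 u₀, IsLocalFrameAt m h π H φ b ξ u)
    (u₀ : L) (c₀ : ℝ) (b₀ : Euc q) (hb₀ : π u₀ b₀ = b₀) :
    ∃ (φ : L → ℝ) (b : L → Euc q), φ u₀ = c₀ ∧ b u₀ = b₀ ∧ ∀ u, IsSolAt m h π H φ b u := by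
  choose φ b ξ hfr using hloc
  have : LocallyPathConnectedSpace L := ChartedSpace.locallyPathConnectedSpace (Euc m) L
  let F := ℝ × Euc s
  -- The fibre consists of the constant coefficients of a solution in a local frame. The discrete
  -- topology makes continuous sections those with locally constant coefficients, that is,
  -- solutions.
  let _ : TopologicalSpace F := ⊥
  have : DiscreteTopology F := ⟨rfl⟩
  set P : L → Set (ℝ × Euc q) := fun u => {w | π u w.2 = w.2} with hP
  set U : L → Set L := fun i => interior {u | IsLocalFrameAt m h π H (φ i) (b i) (ξ i) u} with hU
  set e : L → L → F → ℝ × Euc q :=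
    fun i u a => (a.1 * φ i u, a.1 • b i u + ∑ k, a.2 k • ξ i k u) with he
  have hUf : ∀ i, ∀ u ∈ U i, IsLocalFrameAt m h π H (φ i) (b i) (ξ i) u := fun i u hu =>
    interior_subset (s := {u | IsLocalFrameAt m h π H (φ i) (b i) (ξ i) u}) hu
  have hUev : ∀ i, ∀ u ∈ U i, ∀ᶠ v in 𝓝 u, v ∈ U i := fun i u hu =>
    isOpen_interior.mem_nhds hu
  have hsol : ∀ i (a : F), ∀ u ∈ U i, IsSolAt m h π H (fun u => (e i u a).1)
      (fun u => (e i u a).2) u := by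
    intro i a u hu
    have h1 := ((hUf i u hu).sol.smul a.1).add
      (IsSolAt.sum Finset.univ (fun k => a.2 k) (hUf i u hu).sol_ξ)
    simpa [he] using h1
  have hbij : ∀ i, ∀ u ∈ U i, BijOn (e i u) univ (P u) := by
    intro i u hu
    have hf := hUf i u hu
    refine ⟨fun a _ => (hsol i a u hu).mem, ?_, ?_⟩
    · rintro ⟨a, x⟩ - ⟨a', x'⟩ - heq
      simp only [he, Prod.mk.injEq] at heq
      obtain rfl : a = a' := mul_right_cancel₀ hf.ne_zero heq.1
      refine Prod.ext rfl ?_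
      ext k
      have h1 := congrArg (fun w => ⟪ξ i k u, w⟫) (add_left_cancel heq.2)
      simpa only [hf.orthonormal.inner_right_fintype] using h1
    · rintro ⟨c, w⟩ hw
      have hw' : π u w = w := hw
      set a := c / φ i u with ha
      have h1 : π u (w - a • b i u) = w - a • b i u := by
        rw [map_sub, map_smul, hw', hf.sol.mem]
      have h2 := hr.sum_inner_smul hf.orthonormal (fun k => (hf.sol_ξ k).mem) h1
      refine ⟨(a, WithLp.toLp 2 fun k => ⟪ξ i k u, w - a • b i u⟫), mem_univ _, ?_⟩
      refine Prod.ext ?_ ?_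
      · exact div_mul_cancel₀ c hf.ne_zero
      · change a • b i u + ∑ k, ⟪ξ i k u, w - a • b i u⟫ • ξ i k u = w
        rw [h2]; abel
  obtain ⟨w, hw0, hw⟩ := exists_global_section P U (fun i => isOpen_interior)
    (fun i => mem_interior_iff_mem_nhds.2 (hfr i)) e hbij (by
      rintro i k u ⟨hui, huk⟩ a a' heq
      -- Two solutions that agree at a point agree nearby, so coefficient vectors in different
      -- frames are identified in a locally constant way.
      have h1 := IsSolAt.eventually_eq hπ
        (by filter_upwards [hUev i u hui] with v hv using hsol i a v hv)
        (by filter_upwards [hUev k u huk] with v hv using hsol k a' v hv)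
        (by filter_upwards [hUev i u hui] with v hv using (hUf i v hv).sol)
        (hUf i u hui).ne_zero (congrArg Prod.fst heq) (congrArg Prod.snd heq)
      filter_upwards [h1] with v hv using Prod.ext hv.1 hv.2) u₀ (c₀, b₀) hb₀
  refine ⟨fun u => (w u).1, fun u => (w u).2, congrArg Prod.fst hw0, congrArg Prod.snd hw0, fun u => ?_⟩
  have hu : u ∈ U u := mem_interior_iff_mem_nhds.2 (hfr u)
  obtain ⟨a, ha⟩ := hw u u hu
  refine (hsol u a u hu).congr ?_ ?_
  · filter_upwards [ha] with v hv using congrArg Prod.fst hv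
  · filter_upwards [ha] with v hv using congrArg Prod.snd hv

/-- On a connected leaf, the function of a solution which is not zero at some point vanishes
nowhere. -/
theorem IsSolAt.ne_zero [PreconnectedSpace L]
    (hloc : ∀ u₀, ∃ (φ : L → ℝ) (b : L → Euc q) (ξ : Fin s → L → Euc q),
      ∀ᶠ u in 𝓝 u₀, IsLocalFrameAt m h π H φ b ξ u)
    {φ : L → ℝ} {b : L → Euc q} (hs : ∀ u, IsSolAt m h π H φ b u) {u₀ : L} (h0 : φ u₀ ≠ 0) (u : L) :
    φ u ≠ 0 := by
  -- Near each point `φ` is a constant multiple of a nonvanishing local solution, so its zero set is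
  -- open and closed.
  have hlc : IsLocallyConstant (fun u => φ u = 0) := by
    refine (IsLocallyConstant.iff_eventually_eq _).2 fun v => ?_
    obtain ⟨φ', b', ξ', hf⟩ := hloc v
    have := eventually_eq_of_hasDD_zero (k := m) (F := fun u => φ u / φ' u) (by
      filter_upwards [hf] with w hw using (hs w).hasDD_div hw.sol hw.ne_zero)
    filter_upwards [this, hf] with w h1 h2
    refine propext ⟨fun h3 => ?_, fun h3 => ?_⟩
    · rw [h3, zero_div, eq_comm, div_eq_zero_iff] at h1
      exact h1.resolve_right hf.self_of_nhds.ne_zero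
    · rw [h3, zero_div, div_eq_zero_iff] at h1
      exact h1.resolve_right h2.ne_zero
  have := hlc.apply_eq_of_isPreconnected isPreconnected_univ (mem_univ u) (mem_univ u₀)
  exact fun h1 => h0 (by rw [← this]; exact h1)

/-- The global solutions on a simply connected leaf. -/
theorem exists_global_frame [SimplyConnectedSpace L] (hπ : ∀ x v w, ⟪π x v, w⟫ = ⟪v, π x w⟫)
    (hr : HasRank π s)
    (hloc : ∀ u₀, ∃ (φ : L → ℝ) (b : L → Euc q) (ξ : Fin s → L → Euc q),
      ∀ᶠ u in 𝓝 u₀, IsLocalFrameAt m h π H φ b ξ u) :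
    ∃ (φ : L → ℝ) (b : L → Euc q) (ξ : Fin s → L → Euc q),
      ∀ u, IsLocalFrameAt m h π H φ b ξ u := by
  obtain ⟨u₀⟩ : Nonempty L := inferInstance
  obtain ⟨φ₀, b₀, ξ₀, hf₀⟩ := hloc u₀
  have hf₀' := hf₀.self_of_nhds
  obtain ⟨φ, b, hφ, -, hsol⟩ := exists_global_solution hπ hr hloc u₀ (φ₀ u₀) (b₀ u₀) hf₀'.sol.mem
  have hex : ∀ i, ∃ ξ : L → Euc q, ξ u₀ = ξ₀ i u₀ ∧ ∀ u, IsSolAt m h π H (fun _ => 0) ξ u := by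
    intro i
    obtain ⟨ψ, ξ, hψ, hξ, hs⟩ := exists_global_solution hπ hr hloc u₀ 0 (ξ₀ i u₀) (hf₀'.sol_ξ i).mem
    refine ⟨ξ, hξ, fun u => (hs u).congr (Eventually.of_forall fun v => ?_) EventuallyEq.rfl⟩
    -- The scalar part of this solution is zero at `u₀`; were it nonzero at some point, it would
    -- vanish nowhere.
    by_contra hne
    exact IsSolAt.ne_zero hloc hs (fun h => hne h.symm) u₀ hψ
  choose ξ hξ0 hξ using hex
  refine ⟨φ, b, ξ, fun u => ⟨hsol u, ?_, fun i => hξ i u, ?_⟩⟩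
  · exact IsSolAt.ne_zero hloc hsol (by rw [hφ]; exact hf₀'.ne_zero) u
  · classical
    have h1 := hf₀'.orthonormal
    rw [orthonormal_iff_ite] at h1 ⊢
    intro i k
    rw [← h1 i k, ← hξ0, ← hξ0]
    exact eq_of_hasDD_zero (k := m) (F := fun u => ⟪ξ i u, ξ k u⟫)
      (fun v => (hξ i v).hasDD_inner hπ (hξ k v)) u u₀

end Submfd

end

noncomputable section
namespace Submfd
open Filter Topology Set

/-! ### The Lie bracket as a commutator. -/

section Bracket

variable {k : ℕ} {M : Type*} [TopologicalSpace M] [ChartedSpace (Euc k) M]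
  [IsManifold 𝓘(ℝ, Euc k) ∞ M]
  {V : Type*} [NormedAddCommGroup V] [NormedSpace ℝ V]

theorem le_infty_aux (n : ℕ) : ((n : ℕ∞) : WithTop ℕ∞) ≤ ∞ := by
  exact_mod_cast le_top

/-- The Lie bracket is the commutator of derivations. -/
theorem hasDD_dd_apply {a : M → V} {x : M}
    (ha : ∀ᶠ y in 𝓝 x, ContMDiffAt 𝓘(ℝ, Euc k) 𝓘(ℝ, V) ∞ a y)
    {X Y : Π x : M, TangentSpace 𝓘(ℝ, Euc k) x} (hX : IsSmoothVectorField X)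
    (hY : IsSmoothVectorField Y) :
    HasDD (fun y => dd k a y (Y y)) (dd k (fun y => dd k a y (Y y)) x) x ∧
    dd k (fun y => dd k a y (Y y)) x (X x) - dd k (fun y => dd k a y (X y)) x (Y x) =
      dd k a x (VectorField.mlieBracket 𝓘(ℝ, Euc k) X Y x) := by
  have : IsManifold 𝓘(ℝ, Euc k) 2 M := IsManifold.of_le (n := ∞) (le_infty_aux 2)
  have : IsManifold 𝓘(ℝ, Euc k) 1 M := IsManifold.of_le (n := ∞) (le_infty_aux 1)
  set e := extChartAt 𝓘(ℝ, Euc k) x with he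
  set g : Euc k → V := a ∘ e.symm with hg
  set P : (Π x : M, TangentSpace 𝓘(ℝ, Euc k) x) → Euc k → Euc k := fun Z =>
    VectorField.mpullbackWithin 𝓘(ℝ, Euc k) 𝓘(ℝ, Euc k) e.symm Z (range 𝓘(ℝ, Euc k)) with hP
  have hd : ∀ Z : Π x : M, TangentSpace 𝓘(ℝ, Euc k) x, IsSmoothVectorField Z →
      HasFDerivAt (P Z) (fderiv ℝ (P Z) (e x)) (e x) := by
    intro Z hZ
    have h1 : DifferentiableWithinAt ℝ (P Z) (e.symm ⁻¹' univ ∩ range 𝓘(ℝ, Euc k)) (e x) :=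
      (((hZ x).mdifferentiableAt (by simp)).mdifferentiableWithinAt
      (s := univ)).differentiableWithinAt_mpullbackWithin_vectorField
    rw [ModelWithCorners.range_eq_univ, preimage_univ, univ_inter] at h1
    exact (differentiableWithinAt_univ.1 h1).hasFDerivAt
  have hchart : ∀ (Z : Π x : M, TangentSpace 𝓘(ℝ, Euc k) x), ∀ y ∈ e.target,
      chartSymmDeriv k x y (P Z y) = Z (e.symm y) := by
    intro Z y hy
    have h1 := isInvertible_mfderivWithin_extChartAt_symm (I := 𝓘(ℝ, Euc k)) hy
    have h2 : P Z y = (mfderivWithin 𝓘(ℝ, Euc k) 𝓘(ℝ, Euc k) e.symm (range 𝓘(ℝ, Euc k)) y).inverse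
      (Z (e.symm y)) := rfl
    have h3 : chartSymmDeriv k x y =
      mfderivWithin 𝓘(ℝ, Euc k) 𝓘(ℝ, Euc k) e.symm (range 𝓘(ℝ, Euc k)) y := by
      rw [ModelWithCorners.range_eq_univ, mfderivWithin_univ]; rfl
    rw [h2, h3]
    obtain ⟨T, hT⟩ := h1
    rw [← hT, ContinuousLinearMap.inverse_equiv]
    exact T.apply_symm_apply _
  have hself : ∀ Z : Π x : M, TangentSpace 𝓘(ℝ, Euc k) x, P Z (e x) = Z x := by
    intro Z
    have h1 := hchart Z (e x) (mem_extChartAt_target x)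
    have h3 : chartSymmDeriv k x (e x) = ContinuousLinearMap.id ℝ (Euc k) := by
      have := mfderivWithin_range_extChartAt_symm (I := 𝓘(ℝ, Euc k)) (x := x)
      rw [ModelWithCorners.range_eq_univ, mfderivWithin_univ] at this
      exact this
    rw [h3] at h1
    refine h1.trans ?_
    let Z' : M → Euc k := Z
    exact congrArg Z' (extChartAt_to_inv x)
  have htend : Tendsto e.symm (𝓝 (e x)) (𝓝 x) := by
    have := (continuousAt_extChartAt_symm (I := 𝓘(ℝ, Euc k)) x).tendsto
    rwa [extChartAt_to_inv] at this
  have hx : ∀ᶠ y in 𝓝 (e x), y ∈ e.target := extChartAt_target_mem_nhds x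
  have hgs : ContDiffAt ℝ ∞ g (e x) := by
    have h1 := htend.eventually ha
    exact contMDiffAt_iff_contDiffAt.1 (h1.self_of_nhds.comp (e x)
      (contMDiffAt_extChartAt_symm x (mem_extChartAt_target x)))
  have hg2 : HasFDerivAt (fderiv ℝ g) (fderiv ℝ (fderiv ℝ g) (e x)) (e x) :=
    ((hgs.fderiv_right (m := ∞) (by simp)).differentiableAt (by simp)).hasFDerivAt
  have hga : fderiv ℝ g (e x) = dd k a x := HasFDerivAt.fderiv ha.self_of_nhds.hasDD
  have hD : ∀ Z : Π x : M, TangentSpace 𝓘(ℝ, Euc k) x, IsSmoothVectorField Z →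
      HasDD (fun y => dd k a y (Z y)) (fderiv ℝ g (e x) ∘L fderiv ℝ (P Z) (e x) +
        (fderiv ℝ (fderiv ℝ g) (e x)).flip (P Z (e x))) x := by
    intro Z hZ
    refine (hg2.clm_apply (hd Z hZ)).congr_of_eventuallyEq ?_
    filter_upwards [hx, htend.eventually ha] with y hy hy'
    rw [hg, (HasDD.comp_chart_symm hy hy'.hasDD).fderiv, ContinuousLinearMap.comp_apply,
      hchart Z y hy]
    rfl
  refine ⟨(hD Y hY).dd_eq.symm ▸ hD Y hY, ?_⟩
  rw [(hD X hX).dd_eq, (hD Y hY).dd_eq]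
  have hbr : VectorField.mlieBracket 𝓘(ℝ, Euc k) X Y x =
      fderiv ℝ (P Y) (e x) (P X (e x)) - fderiv ℝ (P X) (e x) (P Y (e x)) := by
    have h0 := VectorField.mlieBracketWithin_apply (I := 𝓘(ℝ, Euc k)) (V := X) (W := Y)
      (s := univ) (x₀ := x)
    rw [VectorField.mlieBracketWithin_univ, mfderiv_extChartAt_self] at h0
    refine h0.trans ?_
    change (ContinuousLinearMap.id ℝ (Euc k)).inverse (VectorField.lieBracketWithin ℝ (P X) (P Y)
      (e.symm ⁻¹' univ ∩ range 𝓘(ℝ, Euc k)) (e x)) = _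
    rw [ModelWithCorners.range_eq_univ, preimage_univ, univ_inter,
      VectorField.lieBracketWithin_univ, ContinuousLinearMap.inverse_id]
    rfl
  -- In the chart, symmetry of the second derivative of `a` leaves only the first derivative of `a`
  -- applied to the bracket of the pulled back fields.
  have hsymm := (hgs.isSymmSndFDerivAt (by simpa using ENat.LEInfty.out)) (X x) (Y x)
  have key : ∀ (A : Euc k →L[ℝ] V) (S T : Euc k →L[ℝ] Euc k) (B : Euc k →L[ℝ] Euc k →L[ℝ] V)
      (v w : Euc k), B v w = B w v →
      (A ∘L T + B.flip w) v - (A ∘L S + B.flip v) w = A (T v - S w) := by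
    intro A S T B v w h
    simp [h]
  rw [hbr, hself, hself, hga]
  exact key _ _ _ _ _ _ hsymm

end Bracket

/-! ### The nullity along the leaf is a parallel flat normal subbundle. -/

section FirstAssertion

variable {m q s : ℕ} {L : Type*} [TopologicalSpace L] [ChartedSpace (Euc m) L]
  {h η : L → Euc q} {τ π : L → Euc q →L[ℝ] Euc q} {H : L → Euc q}

namespace LeafFields

/-- The derivative of a section of `N` is tangent to `f` by `τ_dd_section`, so its part normal to
the leaf is its component in `N`. This is why `N` is parallel. -/
theorem normalDeriv_of_hasDD (D : LeafFields m h η τ π H) {b : L → Euc q} {b' : Euc m →L[ℝ] Euc q}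
    {x : L} (hb : HasDD b b' x) (hπ : ∀ᶠ y in 𝓝 x, π y (b y) = b y) (X : Euc m) :
    normalDeriv h b x X = π x (b' X) := by
  rw [D.normalDeriv_eq, hb.dd_eq, D.τ_dd_section hb hπ]
  abel

theorem isNormalSubbundle (D : LeafFields m h η τ π H) {N : L → Submodule ℝ (Euc q)}
    (hN : ∀ u, (N u).starProjection = π u) (hr : ∀ u, Module.finrank ℝ (N u) = s) :
    IsNormalSubbundle m h N s where
  le_normal u w hw := by
    have h1 : π u w = w := by rw [← hN, Submodule.starProjection_eq_self_iff]; exact hw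
    rw [D.mem_normalSpace, h1, ← h1, D.τ_π]
  rank := hr
  smooth := by
    have : (fun x => (N x).starProjection) = π := funext hN
    rw [this]
    exact D.smooth_π

theorem isParallel (D : LeafFields m h η τ π H) {N : L → Submodule ℝ (Euc q)}
    (hN : ∀ u, (N u).starProjection = π u) : IsParallel m h N := by
  intro ξ hξ x X
  rw [D.normalDeriv_of_hasDD (hξ.smooth.hasDD x) (Eventually.of_forall fun y => by
    rw [← hN, Submodule.starProjection_eq_self_iff]; exact hξ.mem y), ← hN]
  exact Submodule.starProjection_apply_mem _ _

/-- In a local parallel orthonormal frame the normal connection differentiates the coefficient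
functions, and on functions the Lie bracket is the commutator of derivations. -/
theorem isFlat [IsManifold 𝓘(ℝ, Euc m) ∞ L] (D : LeafFields m h η τ π H) (hrk : HasRank π s)
    (hloc : ∀ u₀, ∃ (φ : L → ℝ) (b : L → Euc q) (ξ : Fin s → L → Euc q),
      ∀ᶠ u in 𝓝 u₀, IsLocalFrameAt m h π H φ b ξ u)
    {N : L → Submodule ℝ (Euc q)} (hN : ∀ u, (N u).starProjection = π u) : IsFlat m h N := by
  intro X Y hX hY ξ hξ x
  obtain ⟨φ, b, e, hf⟩ := hloc x
  have hπξ : ∀ y, π y (ξ y) = ξ y := fun y => by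
    rw [← hN, Submodule.starProjection_eq_self_iff]; exact hξ.mem y
  have ha : ∀ i, ∀ᶠ y in 𝓝 x, ContMDiffAt 𝓘(ℝ, Euc m) 𝓘(ℝ, ℝ) ∞ (fun y => ⟪e i y, ξ y⟫) y := by
    intro i
    filter_upwards [hf] with y hy
    exact contDiff_inner.contMDiff.contMDiffAt.comp y
      (((hy.sol_ξ i).smooth_b).prodMk_space hξ.smooth.contMDiffAt)
  have hnd : ∀ᶠ y in 𝓝 x, ∀ Z, normalDeriv h ξ y Z =
      ∑ i, dd m (fun y => ⟪e i y, ξ y⟫) y Z • e i y := by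
    filter_upwards [hf] with y hy Z
    rw [D.normalDeriv_of_hasDD (hξ.smooth.hasDD y) (Eventually.of_forall hπξ),
      ← hrk.sum_inner_smul hy.orthonormal (fun i => (hy.sol_ξ i).mem) (D.π_π y _)]
    refine Finset.sum_congr rfl fun i _ => ?_
    have h1 := HasDD.inner (hy.sol_ξ i).smooth_b.hasDD (hξ.smooth.hasDD y)
    have h2 : ⟪ξ y, dd m (e i) y Z⟫ = 0 := by
      rw [← hπξ y, D.π_symm, (hy.sol_ξ i).db, zero_smul, inner_zero_right]
    congr 1
    rw [h1.dd_eq, ← D.π_symm, (hy.sol_ξ i).mem]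
    simp [h2]
  have hcov : ∀ Z : Π x : L, TangentSpace 𝓘(ℝ, Euc m) x, IsSmoothVectorField Z → ∀ W : Euc m,
      normalDeriv h (fun y => normalDeriv h ξ y (Z y)) x W =
        ∑ i, dd m (fun y => dd m (fun y => ⟪e i y, ξ y⟫) y (Z y)) x W • e i x := by
    intro Z hZ W
    have h1 : HasDD (fun y => ∑ i, dd m (fun y => ⟪e i y, ξ y⟫) y (Z y) • e i y)
        (∑ i, (dd m (fun y => ⟪e i y, ξ y⟫) x (Z x) • dd m (e i) x +
          (dd m (fun y => dd m (fun y => ⟪e i y, ξ y⟫) y (Z y)) x).smulRight (e i x))) x :=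
      HasDD.sum fun i _ => (hasDD_dd_apply (ha i) hZ hZ).1.smul
        (hf.self_of_nhds.sol_ξ i).smooth_b.hasDD
    rw [D.normalDeriv_of_hasDD (h1.congr (hnd.mono fun y hy => hy (Z y)))]
    · rw [sum_apply, map_sum]
      refine Finset.sum_congr rfl fun i _ => ?_
      have h2 := (hf.self_of_nhds.sol_ξ i).db W
      have h3 := (hf.self_of_nhds.sol_ξ i).mem
      simp [h2, h3]
    · filter_upwards [hnd, hf] with y hy hy'
      have h2 : ∀ W : Euc m, π y (normalDeriv h ξ y W) = normalDeriv h ξ y W := fun W => by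
        rw [hy, map_sum]
        exact Finset.sum_congr rfl fun i _ => by rw [map_smul, (hy'.sol_ξ i).mem]
      exact h2 (Z y)
  refine (congrArg₂ (· - ·) (congrArg₂ (· - ·) (hcov Y hY (X x)) (hcov X hX (Y x)))
    (hnd.self_of_nhds (VectorField.mlieBracket 𝓘(ℝ, Euc m) X Y x))).trans ?_
  simp only [← Finset.sum_sub_distrib]
  refine Finset.sum_eq_zero fun i _ => ?_
  rw [← sub_smul, ← sub_smul, (hasDD_dd_apply (ha i) hX hY).2, sub_self, zero_smul]

end LeafFields

end FirstAssertion

section Rank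

variable {n q s : ℕ} {M : Type*} [TopologicalSpace M] [ChartedSpace (Euc n) M]
  {f η : M → Euc q}

theorem exists_isometry_nullProj (hf : IsSmoothImmersion n f) (hη : IsDupinPrincipalNormal n f η s)
    (x : M) : ∃ ι : Euc s →ₗᵢ[ℝ] Euc q, ∀ w, nullProj n f η x w = w ↔ ∃ z, ι z = w := by
  have hr := finrank_nullImage hf hη x
  let B := (stdOrthonormalBasis ℝ (nullImage n f η x)).reindex (finCongr hr)
  refine ⟨(nullImage n f η x).subtypeₗᵢ.comp B.repr.symm.toLinearIsometry, fun w => ?_⟩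
  rw [nullProj, Submodule.starProjection_eq_self_iff]
  constructor
  · intro hw
    exact ⟨B.repr ⟨w, hw⟩, by simp⟩
  · rintro ⟨z, rfl⟩
    exact (B.repr.symm z).2

theorem IsDupinPrincipalNormal.le (hη : IsDupinPrincipalNormal n f η s) (x : M) : s ≤ n := by
  rw [← hη.multiplicity x]
  simpa using Submodule.finrank_le (nullity n f η x)

end Rank

end Submfd

end

noncomputable section
namespace Submfd
open Filter Topology Set

/-! ### The Ribaucour pair attached to a solution. -/

section Pair

variable {m q s : ℕ} {L : Type*} [TopologicalSpace L] [ChartedSpace (Euc m) L]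
  {h η : L → Euc q} {τ π : L → Euc q →L[ℝ] Euc q} {H : L → Euc q}

theorem differential_gradient_eq {φ : L → ℝ} {u : L} (hinj : Function.Injective (dd m h u))
    {v : Euc q} (hv : ∃ X, dd m h u X = v) (hd : ∀ X, ⟪v, dd m h u X⟫ = dd m φ u X) :
    dd m h u (gradient m h φ u) = v := by
  obtain ⟨X₀, rfl⟩ := hv
  have h1 : ∀ X, ⟪dd m h u (gradient m h φ u) - dd m h u X₀, dd m h u X⟫ = 0 := by
    intro X
    have h2 : ⟪dd m h u (gradient m h φ u), dd m h u X⟫ = dd m φ u X :=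
      metric_gradient h φ u hinj X
    rw [inner_sub_left, hd, h2, sub_self]
  have h3 := h1 (gradient m h φ u - X₀)
  rw [map_sub, inner_self_eq_zero, sub_eq_zero] at h3
  exact h3

namespace LeafFields

variable {φ : L → ℝ} {b : L → Euc q} {u : L}

theorem τ_b (D : LeafFields m h η τ π H) (hs : IsSolAt m h π H φ b u) : τ u (b u) = b u := by
  rw [← hs.mem, D.τ_π]

theorem τ_Hη (D : LeafFields m h η τ π H) (u : L) : τ u (H u - η u) = H u - η u := by
  rw [map_sub, D.τ_H, D.τ_η, sub_zero]

theorem differential_gradient (D : LeafFields m h η τ π H)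
    (hφ : ∀ X, dd m φ u X = -(φ u * ⟪H u, dd m h u X⟫)) :
    dd m h u (gradient m h φ u) = -(φ u • (H u - η u)) := by
  refine differential_gradient_eq (D.inj u) (D.range u _ ?_ ?_) fun X => ?_
  · rw [map_neg, map_smul, D.τ_Hη]
  · rw [map_neg, map_smul, map_sub, D.π_H, D.π_η, sub_zero, smul_zero, neg_zero]
  · rw [hφ, inner_neg_left, real_inner_smul_left, inner_sub_left, D.inner_η_h, sub_zero]

/-- The equation for `dφ` says that `h_* ∇φ = -φ(H - η)`, and the multiples of `η` cancel. -/
theorem combescure_eq (D : LeafFields m h η τ π H) (hs : IsSolAt m h π H φ b u) :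
    combescure m h φ (fun u => b u - φ u • η u) u = b u - φ u • H u := by
  rw [combescure, differential_eq_dd, D.differential_gradient hs.dφ]
  module

/-- The sum is the part normal to the leaf of `d(b - φH)(X)`. Its component in `N` vanishes by the
equation for `db`. In the component normal to `f`, the multiple of `η` from `dφ` cancels the one
from `dd_H_sub`. -/
theorem ribaucour_eqn [IsManifold 𝓘(ℝ, Euc m) ∞ L] (D : LeafFields m h η τ π H)
    (hs : ∀ u, IsSolAt m h π H φ b u) (u : L) (X : Euc m) :
    secondFundamentalForm h u (gradient m h φ u) X +
      normalDeriv h (fun u => b u - φ u • η u) u X = 0 := by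
  have hT : HasDD (fun u => -(φ u • (H u - η u))) _ u :=
    ((hs u).smooth_φ.hasDD.smul ((D.smooth_H.hasDD u).sub (D.smooth_η.hasDD u))).neg
  have hβ : HasDD (fun u => b u - φ u • η u) _ u :=
    (hs u).smooth_b.hasDD.sub ((hs u).smooth_φ.hasDD.smul (D.smooth_η.hasDD u))
  have h1 := dd_tproj_apply_of_tangent D.isSmoothImmersion hT (Eventually.of_forall fun y => by
    rw [D.tproj_eq, sub_apply, map_neg, map_smul, D.τ_Hη, map_neg, map_smul,
      map_sub, D.π_H, D.π_η, sub_zero, smul_zero, neg_zero, sub_zero]) X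
  rw [secondFundamentalForm_symm D.isSmoothImmersion, secondFundamentalForm_eq D.isSmoothImmersion,
    D.differential_gradient (hs u).dφ, h1, Submfd.normalDeriv_eq, hβ.dd_eq, D.tproj_eq]
  have e1 : τ u (dd m H u X) = dd m H u X - ⟪H u, dd m h u X⟫ • η u := by
    rw [← D.dd_H_sub]; abel
  have e2 := D.τ_dd_section (hs u).smooth_b.hasDD (Eventually.of_forall fun y => (hs y).mem) X
  have e3 := (hs u).db X
  have e4 := (hs u).dφ X
  simp only [add_apply, sub_apply, neg_apply, smul_apply, ContinuousLinearMap.smulRight_apply,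
    map_add, map_sub, map_neg, map_smul, e1, e2, e3, e4, D.τ_H, D.τ_η, D.π_H, D.π_η]
  module

/-- The pair `(φ, b - φη)` attached to a solution of the system. -/
def ribaucourPair [IsManifold 𝓘(ℝ, Euc m) ∞ L] (D : LeafFields m h η τ π H)
    (hs : ∀ u, IsSolAt m h π H φ b u) (hφ : ∀ u, φ u ≠ 0) (hF : ∀ u, b u - φ u • H u ≠ 0) :
    RibaucourPair m h where
  φ := φ
  β u := b u - φ u • η u
  smooth_φ u := (hs u).smooth_φ
  isSection_β :=
    { smooth := fun u => (hs u).smooth_b.sub ((hs u).smooth_φ.smul D.smooth_η.contMDiffAt)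
      mem := fun u => by
        rw [D.mem_normalSpace, map_sub, map_sub, map_smul, map_smul, D.τ_η, D.π_η, (hs u).mem,
          D.τ_b (hs u)] }
  eqn := D.ribaucour_eqn hs
  φ_ne_zero := hφ
  combescure_ne_zero u := by rw [D.combescure_eq (hs u)]; exact hF u

/-- The complement of `N` in the normal bundle of the leaf is the restriction of the normal bundle
of `f`. -/
theorem normalCompl_starProjection (D : LeafFields m h η τ π H) {N : L → Submodule ℝ (Euc q)}
    (hN : ∀ u, (N u).starProjection = π u) (u : L) (w : Euc q) :
    (normalCompl m h N u).starProjection w = w - τ u w := by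
  have hN' : ∀ v, v ∈ (N u)ᗮ ↔ π u v = 0 := fun v => by
    rw [← hN, Submodule.starProjection_apply_eq_zero_iff]
  have hmem : w - τ u w ∈ normalCompl m h N u := by
    refine Submodule.mem_inf.2 ⟨?_, ?_⟩
    · rw [hN', map_sub, D.π_τ, sub_self]
    · rw [D.mem_normalSpace, map_sub, map_sub, D.π_τ, D.τ_τ, sub_self, sub_self]
  refine Submodule.eq_starProjection_of_mem_of_inner_eq_zero hmem ?_
  · rintro v ⟨h1, h2⟩
    rw [SetLike.mem_coe, hN'] at h1
    rw [SetLike.mem_coe, D.mem_normalSpace, h1] at h2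
    rw [sub_sub_cancel, D.τ_symm, h2, inner_zero_right]

theorem sub_τ_secondFundamentalForm [IsManifold 𝓘(ℝ, Euc m) ∞ L] (D : LeafFields m h η τ π H)
    (u : L) (Z X : Euc m) :
    secondFundamentalForm h u Z X - τ u (secondFundamentalForm h u Z X) =
      dd m τ u X (dd m h u Z) := by
  rw [secondFundamentalForm_symm D.isSmoothImmersion, secondFundamentalForm_eq D.isSmoothImmersion]
  have h1 : dd m (tproj m h) u = dd m τ u - dd m π u := by
    have : tproj m h = fun u => τ u - π u := funext D.tproj_eq
    rw [this]
    exact ((D.smooth_τ.hasDD u).sub (D.smooth_π.hasDD u)).dd_eq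
  have h2 := D.dτ_mul u X (dd m h u Z)
  rw [D.τ_h] at h2
  rw [h1, sub_apply, sub_apply, map_sub, D.dπ_sub, sub_sub_sub_cancel_right, ← h2]

/-- Here `β̄ = η`, and the component of the second fundamental form of the leaf in the complement of
`N` is that of `f`. A vector of `E(w)` is thus a leaf vector satisfying the nullity equation, hence
zero. -/
theorem classNullity_ribaucourPair [IsManifold 𝓘(ℝ, Euc m) ∞ L] (D : LeafFields m h η τ π H)
    {N : L → Submodule ℝ (Euc q)} (hN : ∀ u, (N u).starProjection = π u)
    (hs : ∀ u, IsSolAt m h π H φ b u) (hφ : ∀ u, φ u ≠ 0) (hF : ∀ u, b u - φ u • H u ≠ 0) (u : L) :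
    classNullity (Quotient.mk (ribaucourSetoid m h N) (D.ribaucourPair hs hφ hF) :
      RibaucourClass m h N) u = {0} := by
  have hβ : betaBar N (D.ribaucourPair hs hφ hF) u = η u := by
    rw [betaBar, D.normalCompl_starProjection hN]
    change -((φ u)⁻¹ • (b u - φ u • η u - τ u (b u - φ u • η u))) = _
    rw [map_sub, map_smul, D.τ_η, D.τ_b (hs u)]
    simp [smul_smul, hφ u]
  change relativeNullity m h u (normalCompl m h N u) (betaBar N (D.ribaucourPair hs hφ hF) u) = _
  ext Z
  rw [hβ, mem_singleton_iff]
  constructor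
  · intro hZ
    have h1 := D.eq_zero u (dd m h u Z) (D.τ_h u Z) (D.π_h u Z) fun X => by
      rw [← D.sub_τ_secondFundamentalForm, ← D.normalCompl_starProjection hN]
      exact hZ X
    exact D.inj u (h1.trans (map_zero _).symm)
  · rintro rfl X
    rw [D.normalCompl_starProjection hN, D.sub_τ_secondFundamentalForm]
    simp [metric]

theorem isParallelFrame (D : LeafFields m h η τ π H) {N : L → Submodule ℝ (Euc q)}
    (hN : ∀ u, (N u).starProjection = π u) {ξ : Fin s → L → Euc q}
    (hξ : ∀ i u, IsSolAt m h π H (fun _ => 0) (ξ i) u) (ho : ∀ u, Orthonormal ℝ fun i => ξ i u) :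
    IsParallelFrame m h N ξ where
  parallel i := by
    refine ⟨⟨fun u => (hξ i u).smooth_b, fun u => ?_⟩, fun u X => ?_⟩
    · rw [← Submodule.starProjection_eq_self_iff, hN, (hξ i u).mem]
    · rw [D.normalDeriv_of_hasDD (hξ i u).smooth_b.hasDD (Eventually.of_forall fun y =>
        (hξ i y).mem), (hξ i u).db, zero_smul]
  orthonormal := ho

/-- Replace `b` by `b - tξ` for a regular value `t` of `⟨b, ξ⟩`, where `ξ` is one section of the
frame. At a zero of `b - tξ - φH` both `H` and `b - tξ` vanish, because `N` is orthogonal to `H`.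
There `⟨b, ξ⟩ = t`, and `d⟨b, ξ⟩ = φ⟨π dH, ξ⟩ = 0`, a contradiction. -/
theorem exists_ne_zero [SecondCountableTopology L] [IsManifold 𝓘(ℝ, Euc m) ∞ L]
    (D : LeafFields m h η τ π H) (i₀ : Fin s) {ξ : Fin s → L → Euc q}
    (hf : ∀ u, IsLocalFrameAt m h π H φ b ξ u) :
    ∃ b' : L → Euc q, (∀ u, IsLocalFrameAt m h π H φ b' ξ u) ∧ ∀ u, b' u - φ u • H u ≠ 0 := by
  have hG : ContMDiff 𝓘(ℝ, Euc m) 𝓘(ℝ, ℝ) ∞ (fun u => ⟪b u, ξ i₀ u⟫) := fun u =>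
    contDiff_inner.contMDiff.contMDiffAt.comp u
      ((hf u).sol.smooth_b.prodMk_space ((hf u).sol_ξ i₀).smooth_b)
  obtain ⟨t, ht⟩ := exists_forall_eq_imp_mfderiv_ne_zero _ hG
  have hb' : ∀ u, IsSolAt m h π H φ (fun u => b u - t • ξ i₀ u) u := fun u =>
    ((hf u).sol.sub (((hf u).sol_ξ i₀).smul t)).congr
      (Eventually.of_forall fun v => by simp) (Eventually.of_forall fun v => rfl)
  refine ⟨fun u => b u - t • ξ i₀ u, fun u => ⟨hb' u, (hf u).ne_zero, (hf u).sol_ξ,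
    (hf u).orthonormal⟩, fun u hu => ?_⟩
  have h1 : b u - t • ξ i₀ u = 0 := by
    have := congrArg (π u) hu
    rwa [map_zero, map_sub, (hb' u).mem, map_smul, D.π_H, smul_zero, sub_zero] at this
  have hH : H u = 0 := by
    simp only [h1, zero_sub, neg_eq_zero, smul_eq_zero] at hu
    exact hu.resolve_left (hf u).ne_zero
  -- Differentiating `π H = 0` gives `π dH = -dπ H`, which is zero where `H` is.
  have hdH : ∀ X, π u (dd m H u X) = 0 := by
    intro X
    have h2 := (D.smooth_π.hasDD u).clm_apply (D.smooth_H.hasDD u)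
    have h3 := h2.congr (G := fun _ => 0) (Eventually.of_forall fun y => (D.π_H y).symm)
    have h4 := congrArg (fun T => T X) (h3.dd_eq.symm.trans (HasDD.const 0 u).dd_eq)
    simpa [hH] using h4
  refine ht u ?_ ?_
  · rw [sub_eq_zero.1 h1, real_inner_smul_left, real_inner_self_eq_norm_sq,
      (hf u).orthonormal.1 i₀]
    simp
  · have h2 := HasDD.inner (hf u).sol.smooth_b.hasDD ((hf u).sol_ξ i₀).smooth_b.hasDD
    refine h2.dd_eq.trans ?_
    ext1 X
    have h3 : ⟪b u, dd m (ξ i₀) u X⟫ = 0 := by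
      rw [← (hf u).sol.mem, D.π_symm, ((hf u).sol_ξ i₀).db, zero_smul, inner_zero_right]
    have h4 : ⟪ξ i₀ u, dd m b u X⟫ = 0 := by
      rw [← ((hf u).sol_ξ i₀).mem, D.π_symm, (hf u).sol.db, hdH, smul_zero, inner_zero_right]
    simp [h3, h4]
    rfl

end LeafFields

end Pair

end Submfd

end

noncomputable section
namespace Submfd
open Filter Topology Set

/-! ### Gluing of local parametrizations. -/

section Gluing

variable {E F A B K K' : Type*} [NormedAddCommGroup E] [NormedSpace ℝ E] [NormedAddCommGroup F]
  [NormedSpace ℝ F] [TopologicalSpace K] [TopologicalSpace K'] {I : ModelWithCorners ℝ E K}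
  {J : ModelWithCorners ℝ F K'} [TopologicalSpace A] [ChartedSpace K A] [TopologicalSpace B]
  [ChartedSpace K' B]

theorem _root_.IsLocalDiffeomorphAt.congr_of_eventuallyEq {f g : A → B} {a : A}
    (hf : IsLocalDiffeomorphAt I J ∞ f a) (h : g =ᶠ[𝓝 a] f) : IsLocalDiffeomorphAt I J ∞ g a := by
  obtain ⟨Φ, ha, hΦ⟩ := hf
  obtain ⟨O, hO, hOo, haO⟩ := eventually_nhds_iff.1 h
  refine ⟨{ Φ.toOpenPartialHomeomorph.restrOpen O hOo with
    contMDiffOn_toFun := Φ.contMDiffOn_toFun.mono fun x hx => hx.1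
    contMDiffOn_invFun := Φ.contMDiffOn_invFun.mono fun x hx => hx.1 }, ⟨ha, haO⟩, fun x hx => ?_⟩
  exact (hO x hx.2).trans (hΦ hx.1)

variable {X : Type*} {s : ℕ}

/-- Local diffeomorphisms defined near the points of `A × {0}`, which agree there and lift the same
map through a locally injective map, can be glued. -/
theorem exists_glued_localDiffeomorph [T2Space B] {f : B → X} (hf : IsLocallyInjective f) {j : A → B}
    {Y : A × Euc s → X}
    (hloc : ∀ u₀, ∃ Ψ : A × Euc s → B,
      IsLocalDiffeomorphAt (I.prod 𝓘(ℝ, Euc s)) J ∞ Ψ (u₀, 0) ∧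
      (∀ᶠ u in 𝓝 u₀, Ψ (u, 0) = j u) ∧ ∀ᶠ p in 𝓝 (u₀, (0 : Euc s)), f (Ψ p) = Y p) :
    ∃ (W : Set (A × Euc s)) (Ψ : A × Euc s → B), IsOpen W ∧ (∀ u, (u, 0) ∈ W ∧ Ψ (u, 0) = j u) ∧
      IsLocalDiffeomorphOn (I.prod 𝓘(ℝ, Euc s)) J ∞ Ψ W ∧ ∀ p ∈ W, f (Ψ p) = Y p := by
  have hbox : ∀ u₀, ∃ (Ψ : A × Euc s → B) (U : Set A) (r : ℝ), IsOpen U ∧ u₀ ∈ U ∧ 0 < r ∧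
      (∀ u ∈ U, Ψ (u, 0) = j u) ∧ ∀ u ∈ U, ∀ z ∈ Metric.ball (0 : Euc s) r,
        IsLocalDiffeomorphAt (I.prod 𝓘(ℝ, Euc s)) J ∞ Ψ (u, z) ∧ f (Ψ (u, z)) = Y (u, z) := by
    intro u₀
    obtain ⟨Ψ, h1, h2, h3⟩ := hloc u₀
    have h4 := (h1.eventually.and h3)
    rw [nhds_prod_eq, eventually_prod_iff] at h4
    obtain ⟨p, hp, q, hq, h5⟩ := h4
    obtain ⟨r, hr, hrq⟩ := Metric.eventually_nhds_iff_ball.1 hq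
    obtain ⟨U, hU, hUo, hu₀⟩ := eventually_nhds_iff.1 (h2.and hp)
    exact ⟨Ψ, U, r, hUo, hu₀, hr, fun u hu => (hU u hu).1, fun u hu z hz =>
      h5 (hU u hu).2 (hrq z hz)⟩
  choose Ψ U r hUo hu₀ hr hj hbox using hbox
  -- For fixed `u`, both maps lift `Y` through the locally injective `f` over an intersection of
  -- balls, which is connected, and they agree at its centre.
  have hcons : ∀ a b u z, u ∈ U a → u ∈ U b → z ∈ Metric.ball (0 : Euc s) (r a) →
      z ∈ Metric.ball (0 : Euc s) (r b) → Ψ a (u, z) = Ψ b (u, z) := by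
    intro a b u z hua hub hza hzb
    set S := Metric.ball (0 : Euc s) (r a) ∩ Metric.ball (0 : Euc s) (r b)
    have hS : IsPreconnected S := ((convex_ball _ _).inter (convex_ball _ _)).isPreconnected
    have hc : ∀ c, u ∈ U c → ContinuousOn (fun z => Ψ c (u, z)) (Metric.ball 0 (r c)) :=
      fun c hc z hz => ((hbox c u hc z hz).1.contMDiffAt.continuousAt.comp
        (by fun_prop : ContinuousAt (fun z : Euc s => (u, z)) z)).continuousWithinAt
    have := (T2Space.isSeparatedMap f).eqOn_of_comp_eqOn hf hS ((hc a hua).mono inter_subset_left)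
      ((hc b hub).mono inter_subset_right) (fun z hz => by
        simp only [Function.comp_apply]
        rw [(hbox a u hua z hz.1).2, (hbox b u hub z hz.2).2])
      (a := 0) ⟨Metric.mem_ball_self (hr a), Metric.mem_ball_self (hr b)⟩
      (by rw [hj a u hua, hj b u hub])
    exact this ⟨hza, hzb⟩
  classical
  let W : Set (A × Euc s) := ⋃ a, U a ×ˢ Metric.ball 0 (r a)
  let Ψ' : A × Euc s → B := fun p =>
    if h : ∃ a, p ∈ U a ×ˢ Metric.ball 0 (r a) then Ψ h.choose p else j p.1
  have hΨ' : ∀ a, ∀ p ∈ U a ×ˢ Metric.ball 0 (r a), Ψ' p = Ψ a p := by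
    rintro a ⟨u, z⟩ hp
    have h : ∃ a, (u, z) ∈ U a ×ˢ Metric.ball 0 (r a) := ⟨a, hp⟩
    simp only [Ψ', dif_pos h]
    exact hcons _ _ _ _ h.choose_spec.1 hp.1 h.choose_spec.2 hp.2
  have ho : ∀ a, IsOpen (U a ×ˢ Metric.ball (0 : Euc s) (r a)) := fun a =>
    (hUo a).prod Metric.isOpen_ball
  refine ⟨W, Ψ', isOpen_iUnion ho, fun u => ?_, ?_, ?_⟩
  · have hu : (u, 0) ∈ U u ×ˢ Metric.ball (0 : Euc s) (r u) := ⟨hu₀ u, Metric.mem_ball_self (hr u)⟩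
    exact ⟨mem_iUnion.2 ⟨u, hu⟩, by rw [hΨ' u _ hu, hj u u (hu₀ u)]⟩
  · rintro ⟨⟨u, z⟩, hp⟩
    obtain ⟨a, ha⟩ := mem_iUnion.1 hp
    exact (hbox a u ha.1 z ha.2).1.congr_of_eventuallyEq
      (eventually_of_mem ((ho a).mem_nhds ha) (hΨ' a))
  · rintro ⟨u, z⟩ hp
    obtain ⟨a, ha⟩ := mem_iUnion.1 hp
    rw [hΨ' a _ ha]
    exact (hbox a u ha.1 z ha.2).2

end Gluing

/-! ### The tube in the inverted parameter of the Ribaucour transform. -/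

section Parametrization

variable {m q s : ℕ} {L : Type*} [TopologicalSpace L] [ChartedSpace (Euc m) L]
  {h η : L → Euc q} {τ π : L → Euc q →L[ℝ] Euc q} {H : L → Euc q} {φ : L → ℝ} {b : L → Euc q}
  {ξ : Fin s → L → Euc q}

/-- The section `∑ zᵢ ξᵢ`. -/
def frameSum (ξ : Fin s → L → Euc q) (p : L × Euc s) : Euc q := ∑ i, p.2 i • ξ i p.1

/-- The denominator of `tubeSection`. -/
def tubeDenom (b : L → Euc q) (ξ : Fin s → L → Euc q) (p : L × Euc s) : ℝ :=
  1 + 2 * ⟪b p.1, frameSum ξ p⟫ + ‖b p.1‖ ^ 2 * ‖p.2‖ ^ 2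

/-- The inversion of the section `-φ⁻¹ (b + ∑ yᵢ ξᵢ)`, where `z = y / ‖y‖²`. -/
def tubeSection (φ : L → ℝ) (b : L → Euc q) (ξ : Fin s → L → Euc q) (p : L × Euc s) : Euc q :=
  -((φ p.1 * (tubeDenom b ξ p)⁻¹) • (‖p.2‖ ^ 2 • b p.1 + frameSum ξ p))

omit [TopologicalSpace L] in
theorem norm_frameSum {u : L} (hξ : Orthonormal ℝ fun i => ξ i u) (z : Euc s) :
    ‖frameSum ξ (u, z)‖ ^ 2 = ‖z‖ ^ 2 := by
  rw [← real_inner_self_eq_norm_sq, frameSum, hξ.inner_sum, EuclideanSpace.norm_sq_eq]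
  simp [pow_two]

theorem IsLocalFrameAt.mem_frameSum {u : L} (hf : IsLocalFrameAt m h π H φ b ξ u) (z : Euc s) :
    π u (frameSum ξ (u, z)) = frameSum ξ (u, z) := by
  simp only [frameSum, map_sum, map_smul, (hf.sol_ξ _).mem]

theorem IsLocalFrameAt.mem_tubeSection {u : L} (hf : IsLocalFrameAt m h π H φ b ξ u) (z : Euc s) :
    π u (tubeSection φ b ξ (u, z)) = tubeSection φ b ξ (u, z) := by
  simp only [tubeSection, map_neg, map_smul, map_add, hf.mem_frameSum, hf.sol.mem]

-- The factor `‖z‖²` that would make the inversion singular at `z = 0` splits off, and the remaining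
-- denominator is `1` there; hence `tubeSection` is smooth across the leaf at infinity.
omit [TopologicalSpace L] in
theorem tube_norm_sq {u : L} (hξ : Orthonormal ℝ fun i => ξ i u) (z : Euc s) :
    ‖‖z‖ ^ 2 • b u + frameSum ξ (u, z)‖ ^ 2 = ‖z‖ ^ 2 * tubeDenom b ξ (u, z) := by
  rw [norm_add_sq_real, norm_frameSum hξ, norm_smul, real_inner_smul_left, tubeDenom]
  simp
  ring

/-- The sphere map along `tubeSection` is the Ribaucour transform. -/
theorem LeafFields.ribaucourMap_eq [IsManifold 𝓘(ℝ, Euc m) ∞ L] (D : LeafFields m h η τ π H)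
    (hf : ∀ u, IsLocalFrameAt m h π H φ b ξ u) (hF : ∀ u, b u - φ u • H u ≠ 0)
    {u : L} {z : Euc s} (hz : z ≠ 0) (hd : tubeDenom b ξ (u, z) ≠ 0) :
    shiftedCombescure (D.ribaucourPair (fun u => (hf u).sol) (fun u => (hf u).ne_zero) hF) ξ u
      ((‖z‖ ^ 2)⁻¹ • z) ≠ 0 ∧
    h u + sphereDisp (H u) (tubeSection φ b ξ (u, z)) =
      ribaucourMap (D.ribaucourPair (fun u => (hf u).sol) (fun u => (hf u).ne_zero) hF) ξ u
        ((‖z‖ ^ 2)⁻¹ • z) := by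
  have hz' : ‖z‖ ^ 2 ≠ 0 := by simpa using hz
  have hφ := (hf u).ne_zero
  set c : Euc q := ‖z‖ ^ 2 • b u + frameSum ξ (u, z) with hc
  have hcn : ‖c‖ ^ 2 = ‖z‖ ^ 2 * tubeDenom b ξ (u, z) := tube_norm_sq (hf u).orthonormal z
  have hcn0 : ‖c‖ ^ 2 ≠ 0 := by rw [hcn]; exact mul_ne_zero hz' hd
  have hπc : π u c = c := by rw [hc, map_add, map_smul, (hf u).mem_frameSum, (hf u).sol.mem]
  have hshift : shiftedCombescure (D.ribaucourPair (fun u => (hf u).sol) (fun u => (hf u).ne_zero) hF)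
      ξ u ((‖z‖ ^ 2)⁻¹ • z) = (‖z‖ ^ 2)⁻¹ • c - φ u • H u := by
    have h1 := D.combescure_eq (hf u).sol
    change combescure m h φ (fun u => b u - φ u • η u) u + _ = _
    rw [h1, hc, smul_add, smul_smul, inv_mul_cancel₀ hz', one_smul, frameSum, Finset.smul_sum]
    simp only [PiLp.smul_apply, smul_eq_mul, smul_smul]
    abel
  have hV : tubeSection φ b ξ (u, z) = -((φ u * (tubeDenom b ξ (u, z))⁻¹) • c) := rfl
  have hVn : ‖tubeSection φ b ξ (u, z)‖ ^ 2 = φ u ^ 2 * ‖z‖ ^ 2 * (tubeDenom b ξ (u, z))⁻¹ := by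
    rw [hV, norm_neg, norm_smul, mul_pow, hcn, Real.norm_eq_abs, sq_abs]
    field_simp
  have hVi : (‖tubeSection φ b ξ (u, z)‖ ^ 2)⁻¹ • tubeSection φ b ξ (u, z) =
      -((φ u)⁻¹ • (‖z‖ ^ 2)⁻¹ • c) := by
    rw [hVn, hV, smul_neg, smul_smul, smul_smul]
    congr 2
    field_simp
  have hne : (‖z‖ ^ 2)⁻¹ • c - φ u • H u ≠ 0 := by
    intro h0
    have h1 := congrArg (π u) h0
    rw [map_sub, map_smul, map_smul, D.π_H, smul_zero, sub_zero, map_zero, hπc, smul_eq_zero] at h1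
    rcases h1 with h1 | h1
    · exact inv_ne_zero hz' h1
    · exact hcn0 (by rw [h1]; simp)
  rw [ribaucourMap, hshift]
  refine ⟨hne, ?_⟩
  have hV0 : tubeSection φ b ξ (u, z) ≠ 0 := by
    intro h0
    have : ‖tubeSection φ b ξ (u, z)‖ ^ 2 = 0 := by rw [h0]; simp
    rw [hVn] at this
    simp [hφ, hz, hd] at this
  rw [sphereDisp_eq_inversion hV0 (by rw [real_inner_comm, D.inner_H u ((hf u).mem_tubeSection z)]),
    hVi]
  -- The vector to be inverted is `-φ⁻¹ F_t`, and `2W/|W|²` with `W = -φ⁻¹ F_t` is `-2φ F_t/|F_t|²`.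
  have hW : H u + -((φ u)⁻¹ • (‖z‖ ^ 2)⁻¹ • c) = -((φ u)⁻¹ • ((‖z‖ ^ 2)⁻¹ • c - φ u • H u)) := by
    rw [smul_sub, smul_smul (φ u)⁻¹ (φ u), inv_mul_cancel₀ hφ, one_smul]
    abel
  rw [hW]
  set w := (‖z‖ ^ 2)⁻¹ • c - φ u • H u with hw
  have hwn : ‖w‖ ≠ 0 := norm_ne_zero_iff.2 hne
  rw [norm_neg, norm_smul, mul_pow, norm_inv, Real.norm_eq_abs, inv_pow, sq_abs, sub_eq_add_neg,
    smul_neg, smul_smul]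
  congr 3
  change _ = 2 * φ u * (‖w‖ ^ 2)⁻¹
  field_simp

end Parametrization

end Submfd

end

noncomputable section
namespace Submfd
open Filter Topology Set

section Existence

variable {m q s : ℕ} {L : Type*} [TopologicalSpace L] [ChartedSpace (Euc m) L]
  {φ : L → ℝ} {b : L → Euc q} {ξ : Fin s → L → Euc q}

theorem contMDiff_frameSum (hξ : ∀ i, ContMDiff 𝓘(ℝ, Euc m) 𝓘(ℝ, Euc q) ∞ (ξ i)) :
    ContMDiff (𝓘(ℝ, Euc m).prod 𝓘(ℝ, Euc s)) 𝓘(ℝ, Euc q) ∞ (frameSum ξ) := by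
  refine contMDiff_finsetSum fun i _ => ?_
  have h1 : ContMDiff (𝓘(ℝ, Euc m).prod 𝓘(ℝ, Euc s)) 𝓘(ℝ, ℝ) ∞ (fun p : L × Euc s => p.2 i) :=
    (EuclideanSpace.proj i : Euc s →L[ℝ] ℝ).contMDiff.comp contMDiff_snd
  exact h1.smul ((hξ i).comp contMDiff_fst)

theorem contMDiff_tubeDenom (hb : ContMDiff 𝓘(ℝ, Euc m) 𝓘(ℝ, Euc q) ∞ b)
    (hξ : ∀ i, ContMDiff 𝓘(ℝ, Euc m) 𝓘(ℝ, Euc q) ∞ (ξ i)) :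
    ContMDiff (𝓘(ℝ, Euc m).prod 𝓘(ℝ, Euc s)) 𝓘(ℝ, ℝ) ∞ (tubeDenom b ξ) := by
  have hb' : ContMDiff (𝓘(ℝ, Euc m).prod 𝓘(ℝ, Euc s)) 𝓘(ℝ, Euc q) ∞
      (fun p : L × Euc s => b p.1) := hb.comp contMDiff_fst
  have h1 : ContMDiff (𝓘(ℝ, Euc m).prod 𝓘(ℝ, Euc s)) 𝓘(ℝ, ℝ) ∞
      (fun p : L × Euc s => ⟪b p.1, frameSum ξ p⟫) :=
    (contDiff_inner (𝕜 := ℝ)).contMDiff.comp (hb'.prodMk_space (contMDiff_frameSum hξ))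
  have h2 : ContMDiff (𝓘(ℝ, Euc m).prod 𝓘(ℝ, Euc s)) 𝓘(ℝ, ℝ) ∞ (fun p : L × Euc s => ‖b p.1‖ ^ 2) :=
    (contDiff_norm_sq ℝ).contMDiff.comp hb'
  have h3 : ContMDiff (𝓘(ℝ, Euc m).prod 𝓘(ℝ, Euc s)) 𝓘(ℝ, ℝ) ∞ (fun p : L × Euc s => ‖p.2‖ ^ 2) :=
    (contDiff_norm_sq ℝ).contMDiff.comp contMDiff_snd
  exact (contMDiff_const.add (contMDiff_const.mul h1)).add (h2.mul h3)

theorem contMDiffAt_tubeSection (hφ : ContMDiff 𝓘(ℝ, Euc m) 𝓘(ℝ, ℝ) ∞ φ)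
    (hb : ContMDiff 𝓘(ℝ, Euc m) 𝓘(ℝ, Euc q) ∞ b)
    (hξ : ∀ i, ContMDiff 𝓘(ℝ, Euc m) 𝓘(ℝ, Euc q) ∞ (ξ i)) {p : L × Euc s}
    (hd : tubeDenom b ξ p ≠ 0) :
    ContMDiffAt (𝓘(ℝ, Euc m).prod 𝓘(ℝ, Euc s)) 𝓘(ℝ, Euc q) ∞ (tubeSection φ b ξ) p := by
  have hb' : ContMDiff (𝓘(ℝ, Euc m).prod 𝓘(ℝ, Euc s)) 𝓘(ℝ, Euc q) ∞
      (fun p : L × Euc s => b p.1) := hb.comp contMDiff_fst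
  have hφ' : ContMDiff (𝓘(ℝ, Euc m).prod 𝓘(ℝ, Euc s)) 𝓘(ℝ, ℝ) ∞
      (fun p : L × Euc s => φ p.1) := hφ.comp contMDiff_fst
  have hz : ContMDiff (𝓘(ℝ, Euc m).prod 𝓘(ℝ, Euc s)) 𝓘(ℝ, ℝ) ∞
      (fun p : L × Euc s => ‖p.2‖ ^ 2) :=
    (contDiff_norm_sq ℝ).contMDiff.comp contMDiff_snd
  have h1 : ContMDiffAt (𝓘(ℝ, Euc m).prod 𝓘(ℝ, Euc s)) 𝓘(ℝ, ℝ) ∞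
      (fun p : L × Euc s => (tubeDenom b ξ p)⁻¹) p :=
    (contDiffAt_inv ℝ hd).contMDiffAt.comp p (contMDiff_tubeDenom hb hξ).contMDiffAt
  have h2 : ContMDiffAt (𝓘(ℝ, Euc m).prod 𝓘(ℝ, Euc s)) 𝓘(ℝ, Euc q) ∞
      (fun p : L × Euc s => (φ p.1 * (tubeDenom b ξ p)⁻¹) • (‖p.2‖ ^ 2 • b p.1 + frameSum ξ p)) p :=
    (hφ'.contMDiffAt.mul h1).smul
      ((hz.contMDiffAt.smul hb'.contMDiffAt).add (contMDiff_frameSum hξ).contMDiffAt)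
  exact contDiff_neg.contMDiff.contMDiffAt.comp p h2

omit [TopologicalSpace L] in
@[simp] theorem frameSum_zero (u : L) : frameSum ξ (u, 0) = 0 := by simp [frameSum]

omit [TopologicalSpace L] in
@[simp] theorem tubeDenom_zero (u : L) : tubeDenom b ξ (u, 0) = 1 := by simp [tubeDenom]

omit [TopologicalSpace L] in
theorem tubeSection_zero (u : L) : tubeSection φ b ξ (u, 0) = 0 := by simp [tubeSection]

/-- `z ↦ ∑ zᵢ ξᵢ(u)` as a linear map. -/
def frameMap (ξ : Fin s → L → Euc q) (u : L) : Euc s →L[ℝ] Euc q :=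
  ∑ i, (EuclideanSpace.proj i : Euc s →L[ℝ] ℝ).smulRight (ξ i u)

omit [TopologicalSpace L] in
theorem frameMap_apply (ξ : Fin s → L → Euc q) (u : L) (z : Euc s) :
    frameMap ξ u z = frameSum ξ (u, z) := by
  simp [frameMap, frameSum]

omit [TopologicalSpace L] in
theorem hasFDerivAt_tubeSection (u : L) :
    HasFDerivAt (fun z => tubeSection φ b ξ (u, z)) (-(φ u • frameMap ξ u)) 0 := by
  have h1 : HasFDerivAt (fun z : Euc s => ‖z‖ ^ 2 • b u + frameSum ξ (u, z)) (frameMap ξ u) 0 := by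
    have h2 : HasFDerivAt (fun z : Euc s => ‖z‖ ^ 2) (2 • innerSL ℝ (0 : Euc s)) 0 :=
      (hasStrictFDerivAt_norm_sq 0).hasFDerivAt
    have h3 := (h2.smul_const (b u)).add (frameMap ξ u).hasFDerivAt
    have h5 : (fun z : Euc s => ‖z‖ ^ 2 • b u + frameSum ξ (u, z)) =
        (fun z : Euc s => ‖z‖ ^ 2 • b u) + ⇑(frameMap ξ u) := by
      funext z
      rw [Pi.add_apply, frameMap_apply]
    rw [h5]
    refine h3.congr_fderiv ?_
    ext1 z
    simp
  have h4 : DifferentiableAt ℝ (fun z : Euc s => φ u * (tubeDenom b ξ (u, z))⁻¹) 0 := by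
    refine DifferentiableAt.const_mul (DifferentiableAt.inv ?_ (by simp)) _
    have : (fun z => tubeDenom b ξ (u, z)) =
        fun z => 1 + 2 * ⟪b u, frameMap ξ u z⟫ + ‖b u‖ ^ 2 * ‖z‖ ^ 2 := by
      funext z; rw [frameMap_apply]; rfl
    rw [this]
    have h5 : DifferentiableAt ℝ (fun z : Euc s => ‖z‖ ^ 2) 0 :=
      (hasStrictFDerivAt_norm_sq 0).hasFDerivAt.differentiableAt
    exact (((differentiableAt_const _).inner ℝ (frameMap ξ u).differentiableAt).const_mul 2
      |>.const_add 1).add (h5.const_mul _)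
  refine (h4.hasFDerivAt.smul h1).neg.congr_fderiv ?_
  ext1 z
  simp

variable {n : ℕ} {M : Type*} [TopologicalSpace M] [ChartedSpace (Euc n) M] {f η : M → Euc q}
  {τ π : M → Euc q →L[ℝ] Euc q} {H : M → Euc q} {j : L → M}

theorem DupinFields.isLocallyInjective [IsManifold 𝓘(ℝ, Euc n) ∞ M] (D : DupinFields n f η τ π H) :
    IsLocallyInjective f := by
  intro x
  obtain ⟨P, -, hP⟩ := IsSmoothImmersion.exists_leftInverse ⟨D.smooth_f, D.inj⟩ x
  obtain ⟨U, hU, hUo, hx⟩ := eventually_nhds_iff.1 hP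
  exact ⟨U, hUo, hx, fun y hy z hz h => by rw [← hU y hy, h, hU z hz]⟩

/-- The tubes along `tubeSection` are local diffeomorphisms, since the differential of `tubeSection`
at `z = 0` is `-φ` times the frame map. Glued together and restricted to the set where `tubeDenom`
does not vanish, they parametrize the transform. -/
theorem DupinFields.isRibaucourTransformNear [T2Space M] [IsManifold 𝓘(ℝ, Euc n) ∞ M]
    [IsManifold 𝓘(ℝ, Euc m) ∞ L] (D : DupinFields n f η τ π H) (hj : IsLeaf n m f π j)
    (hms : m + s = n) {N : L → Submodule ℝ (Euc q)} (hN : ∀ u, (N u).starProjection = π (j u))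
    (hf : ∀ u, IsLocalFrameAt m (f ∘ j) (π ∘ j) (H ∘ j) φ b ξ u)
    (hF : ∀ u, b u - φ u • (H ∘ j) u ≠ 0) :
    IsRibaucourTransformNear m n s f j N (Quotient.mk (ribaucourSetoid m (f ∘ j) N)
      ((D.leafFields hj).ribaucourPair (fun u => (hf u).sol) (fun u => (hf u).ne_zero) hF)) := by
  have DL := D.leafFields hj
  have hφs : ContMDiff 𝓘(ℝ, Euc m) 𝓘(ℝ, ℝ) ∞ φ := fun u => (hf u).sol.smooth_φ
  have hbs : ContMDiff 𝓘(ℝ, Euc m) 𝓘(ℝ, Euc q) ∞ b := fun u => (hf u).sol.smooth_b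
  have hξs : ∀ i, ContMDiff 𝓘(ℝ, Euc m) 𝓘(ℝ, Euc q) ∞ (ξ i) := fun i u =>
    ((hf u).sol_ξ i).smooth_b
  have hdc : Continuous (tubeDenom b ξ) := (contMDiff_tubeDenom hbs hξs).continuous
  have hd : ∀ u, ∀ᶠ p in 𝓝 (u, (0 : Euc s)), tubeDenom b ξ p ≠ 0 := fun u =>
    hdc.continuousAt.eventually_ne (by simp)
  have hξπ : ∀ u z, π (j u) (frameMap ξ u z) = frameMap ξ u z := fun u z => by
    rw [frameMap_apply]; exact (hf u).mem_frameSum z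
  obtain ⟨W, Ψ, hWo, hW0, hΨ, hfΨ⟩ := exists_glued_localDiffeomorph (I := 𝓘(ℝ, Euc m))
    (J := 𝓘(ℝ, Euc n)) (s := s) D.isLocallyInjective (j := j)
    (Y := fun p => f (j p.1) + sphereDisp (H (j p.1)) (tubeSection φ b ξ p)) (fun u₀ => by
      obtain ⟨Ψ, h1, h2, h3⟩ := D.exists_tube hj hms u₀ (V := tubeSection φ b ξ)
        ((hd u₀).mono fun p hp => contMDiffAt_tubeSection hφs hbs hξs hp)
        (Eventually.of_forall fun p => (hf p.1).mem_tubeSection p.2)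
        (Eventually.of_forall fun u => tubeSection_zero u) (hasFDerivAt_tubeSection u₀)
        (by
          rw [injective_iff_map_eq_zero]
          intro z hz
          have h1 : φ u₀ • frameSum ξ (u₀, z) = 0 := by
            rw [← frameMap_apply]
            simpa using hz
          rw [smul_eq_zero, or_iff_right (hf u₀).ne_zero] at h1
          have h2 := norm_frameSum (hf u₀).orthonormal z
          rw [h1] at h2
          simpa using h2.symm)
        (fun z => by simp [hξπ])
      exact ⟨Ψ, h1, h2, h3.mono fun p hp => hp.1⟩)
  refine ⟨_, ξ, W ∩ {p | tubeDenom b ξ p ≠ 0}, Ψ, rfl,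
    DL.isParallelFrame hN (fun i u => (hf u).sol_ξ i) fun u => (hf u).orthonormal,
    hWo.inter (isOpen_ne_fun hdc continuous_const), fun u => ⟨⟨(hW0 u).1, by simp⟩, (hW0 u).2⟩,
    fun p => hΨ ⟨p, p.2.1⟩, fun u z hz hz0 => ?_⟩
  have h1 := DL.ribaucourMap_eq hf hF hz0 hz.2
  exact ⟨h1.1, (hfΨ _ hz.1).trans h1.2⟩

end Existence

end Submfd

end

noncomputable section
namespace Submfd
open Filter Topology Set

/-! ### The part of `β` normal to `f` is determined by `f`. -/

section Uniqueness

variable {n m q s : ℕ} {M : Type*} [TopologicalSpace M] [ChartedSpace (Euc n) M] {f η : M → Euc q}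
  {τ π : M → Euc q →L[ℝ] Euc q} {H : M → Euc q}

/-- The normal part of the second derivative of a curve in a submanifold. -/
theorem DupinFields.normal_part_second_deriv [IsManifold 𝓘(ℝ, Euc n) ∞ M]
    (D : DupinFields n f η τ π H) {c : ℝ → M} (hc : ContinuousAt c 0) {γ γ' : ℝ → Euc q}
    {γ'' : Euc q} (hγ : ∀ᶠ t in 𝓝 0, HasDerivAt γ (γ' t) t) (hγ' : HasDerivAt γ' γ'' 0)
    (hcγ : ∀ᶠ t in 𝓝 0, f (c t) = γ t) {X : Euc n} (hX : dd n f (c 0) X = γ' 0) :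
    dd n τ (c 0) X (γ' 0) = γ'' - τ (c 0) γ'' := by
  obtain ⟨P, hP1, hP2⟩ := IsSmoothImmersion.exists_leftInverse ⟨D.smooth_f, D.inj⟩ (c 0)
  have hγ0 : f (c 0) = γ 0 := hcγ.self_of_nhds
  have hγc : ContinuousAt γ 0 := hγ.self_of_nhds.continuousAt
  have hP0 : P (f (c 0)) = c 0 := hP2.self_of_nhds
  rw [hγ0] at hP1 hP0
  have hT : HasFDerivAt (fun y => τ (P y)) (fderiv ℝ (fun y => τ (P y)) (γ 0)) (γ 0) := by
    refine (ContDiffAt.differentiableAt (n := ∞) ?_ (by simp)).hasFDerivAt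
    exact contMDiffAt_iff_contDiffAt.1 (D.smooth_τ.contMDiffAt.comp _ hP1.self_of_nhds)
  have hdτ : dd n τ (c 0) = fderiv ℝ (fun y => τ (P y)) (γ 0) ∘L dd n f (c 0) := by
    rw [← hγ0] at hT ⊢
    exact ((HasDD.comp_left hT (D.smooth_f.hasDD (c 0))).congr (G := τ) (by
      filter_upwards [hP2] with y hy using by simp only [hy])).dd_eq
  have hfix : ∀ᶠ t in 𝓝 0, f (P (γ t)) = γ t := by
    filter_upwards [hcγ, hc.eventually hP2] with t h1 h2
    rw [← h1, h2]
  -- Only continuity of `c` is known, so the tangency of `γ'` is deduced from `f ∘ P` fixing the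
  -- curve. Differentiating this identity at `0` gives the claim.
  have htan : ∀ᶠ t in 𝓝 0, τ (P (γ t)) (γ' t) = γ' t := by
    filter_upwards [hfix.eventually_nhds, hγ, hγc.eventually hP1] with t h1 h2 h3
    have h4 : HasFDerivAt (fun y => f (P y))
        (dd n f (P (γ t)) ∘L (mfderiv 𝓘(ℝ, Euc q) 𝓘(ℝ, Euc n) P (γ t))) (γ t) :=
      ((D.smooth_f.hasDD _).hasMFDerivAt.comp (γ t)
        (h3.mdifferentiableAt (by simp)).hasMFDerivAt).hasFDerivAt
    have h5 := (h4.comp_hasDerivAt t h2).congr_of_eventuallyEq (f₁ := γ)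
      (h1.mono fun r hr => hr.symm)
    rw [h2.unique h5]
    exact D.τ_f _ _
  have h1 := (hT.comp_hasDerivAt 0 hγ.self_of_nhds).clm_apply hγ'
  have h2 := hγ'.unique (h1.congr_of_eventuallyEq (htan.mono fun t ht => ht.symm))
  rw [hdτ, ContinuousLinearMap.comp_apply, hX, eq_sub_iff_add_eq]
  simp only [Function.comp_apply, hP0] at h2
  exact h2.symm

/-- A Ribaucour transform has `η` as principal normal only if `β = b - φη` with `b` a section of the
nullity. -/
theorem DupinFields.normal_combescure [IsManifold 𝓘(ℝ, Euc n) ∞ M]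
    (D : DupinFields n f η τ π H) {c : ℝ → M} (hc : ContinuousAt c 0) {φ : ℝ} (hφ : φ ≠ 0)
    {F e : Euc q} (he : ‖e‖ = 1) (hπe : π (c 0) e = e)
    (hcγ : ∀ᶠ t in 𝓝 (0 : ℝ), f (c t) =
      f (c 0) - (2 * φ * t * (‖e + t • F‖ ^ 2)⁻¹) • (e + t • F)) :
    F - τ (c 0) F = -(φ • η (c 0)) := by
  -- The curve is `f (c 0) + k(t)(e + tF)` with `k(0) = 0` and `k'(0) = -2φ`; the value of `k''(0)`
  -- is immaterial, because it multiplies the tangent vector `e`.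
  set k : ℝ → ℝ := fun t => -(2 * φ * t * (‖e + t • F‖ ^ 2)⁻¹) with hk
  have hks : ContDiffAt ℝ ∞ k 0 := by
    have h1 : ContDiff ℝ ∞ (fun t : ℝ => e + t • F) :=
      contDiff_const.add (contDiff_id.smul contDiff_const)
    exact ((contDiffAt_const.mul contDiffAt_id).mul
      ((h1.norm_sq ℝ).contDiffAt.inv (by simp [he]))).neg
  have hk1 : ∀ᶠ t in 𝓝 0, HasDerivAt k (deriv k t) t := by
    have h1 := (hks.of_le (show (1 : WithTop ℕ∞) ≤ ∞ from ENat.LEInfty.out)).eventually (by simp)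
    filter_upwards [h1] with t ht using (ht.differentiableAt (by simp)).hasDerivAt
  have hk2 : HasDerivAt (deriv k) (deriv (deriv k) 0) 0 := by
    have h1 : ContDiffAt ℝ ∞ (deriv k) 0 := by
      have h2 := (hks.fderiv_right (m := ∞) (by simp)).clm_apply (contDiffAt_const (c := (1 : ℝ)))
      simpa only [fderiv_apply_one_eq_deriv] using h2
    exact (h1.differentiableAt (by simp)).hasDerivAt
  have hk0 : k 0 = 0 := by simp [hk]
  have hk0' : deriv k 0 = -(2 * φ) := by
    have h1 : HasDerivAt (fun t : ℝ => e + t • F) F 0 := by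
      simpa using ((hasDerivAt_id (0 : ℝ)).smul_const F).const_add e
    have h2 := h1.norm_sq
    have h3 := ((((hasDerivAt_id (0 : ℝ)).const_mul (2 * φ)).mul
      (h2.inv (by simp [he])))).neg
    refine h3.deriv.trans ?_
    simp [he]
  have hG : ∀ t : ℝ, HasDerivAt (fun t : ℝ => e + t • F) F t := fun t => by
    simpa using ((hasDerivAt_id t).smul_const F).const_add e
  have hπH : ∀ X, dd n τ (c 0) X e = ⟪e, dd n f (c 0) X⟫ • η (c 0) := by
    intro X
    have h1 := D.null (c 0) e X
    rwa [hπe] at h1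
  obtain ⟨X₀, hX₀⟩ := D.exists_dd_eq_π (c 0) e
  rw [hπe] at hX₀
  have hτe : τ (c 0) e = e := by rw [← hπe, D.τ_π]
  -- The velocity at `0` is `-2φe` and the acceleration is `k''(0)e - 4φF`. As `e` is a unit vector
  -- of the nullity, the normal parts give `4φ²η = -4φ(F - τF)`.
  have key := D.normal_part_second_deriv hc (γ := fun t => f (c 0) + k t • (e + t • F))
    (γ' := fun t => deriv k t • (e + t • F) + k t • F)
    (γ'' := (deriv (deriv k) 0 • e + deriv k 0 • F) + deriv k 0 • F) (X := -(2 * φ) • X₀)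
    (by
      filter_upwards [hk1] with t ht
      exact ((ht.smul (hG t)).const_add (f (c 0))).congr_deriv (add_comm _ _))
    (by
      refine ((hk2.smul (hG 0)).add (hk1.self_of_nhds.smul_const F)).congr_deriv ?_
      rw [zero_smul, add_zero]
      abel)
    (by
      filter_upwards [hcγ] with t ht
      rw [ht, hk, neg_smul, sub_eq_add_neg])
    (by simp [hX₀, hk0, hk0'])
  simp only [zero_smul, add_zero, hk0, hk0', map_add, map_smul, smul_apply, hπH, hX₀,
    real_inner_self_eq_norm_sq, he, hτe] at key
  have h1 : (-(4 * φ)) • (F - τ (c 0) F + φ • η (c 0)) = 0 := by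
    have h2 := sub_eq_zero.2 key
    rw [← neg_eq_zero, ← h2]
    module
  rw [smul_eq_zero, or_iff_right (by simpa using hφ)] at h1
  exact eq_neg_of_add_eq_zero_left h1

end Uniqueness

end Submfd

end

noncomputable section
namespace Submfd
open Filter Topology Set

/-! ### All determining pairs lie in one class. -/

section Classes

variable {m q s : ℕ} {L : Type*} [TopologicalSpace L] [ChartedSpace (Euc m) L]
  [IsManifold 𝓘(ℝ, Euc m) ∞ L] {h η : L → Euc q} {τ π : L → Euc q →L[ℝ] Euc q} {H : L → Euc q}

namespace LeafFields

/-- Write `β = b - φη` with `b = πβ`. The part of the Ribaucour equation normal to `f` determines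
`∇φ`, hence `dφ`, and its component in `N` is the equation for `db`. -/
theorem isSolAt_of_pair (D : LeafFields m h η τ π H) (r : RibaucourPair m h)
    (hr : ∀ u, r.β u - τ u (r.β u) = -(r.φ u • η u)) (u : L) :
    IsSolAt m h π H r.φ (fun u => π u (r.β u)) u := by
  have hβ : ∀ u, r.β u = π u (r.β u) - r.φ u • η u := fun u => by
    have h1 := (D.mem_normalSpace u _).1 (r.isSection_β.mem u)
    rw [← h1, sub_eq_add_neg, ← hr]
    abel
  have hbs : ContMDiff 𝓘(ℝ, Euc m) 𝓘(ℝ, Euc q) ∞ (fun u => π u (r.β u)) :=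
    D.smooth_π.clm_apply r.isSection_β.smooth
  have hβd : HasDD r.β _ u := ((hbs.hasDD u).sub ((r.smooth_φ.hasDD u).smul (D.smooth_η.hasDD u))).congr
    (Eventually.of_forall hβ)
  have hτb := D.τ_dd_section (hbs.hasDD u) (Eventually.of_forall fun y => D.π_π y _)
  set v := dd m h u (gradient m h r.φ u) with hv
  have hdφ : ∀ X, dd m r.φ u X = ⟪v, dd m h u X⟫ := fun X =>
    (metric_gradient h r.φ u (D.inj u) X).symm
  -- Combined with `dτ_H`, the part normal to `f` says that this leaf vector satisfies the nullity
  -- equation, so it vanishes.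
  have hw : v + r.φ u • (H u - η u) = 0 := by
    refine D.eq_zero u _ ?_ ?_ fun X => ?_
    · rw [map_add, map_smul, D.τ_Hη, hv, D.τ_h]
    · rw [map_add, map_smul, map_sub, D.π_H, D.π_η, hv, D.π_h, sub_zero, smul_zero, add_zero]
    · have h1 := r.eqn u X
      have h2 : dd m τ u X v + (normalDeriv h r.β u X - τ u (normalDeriv h r.β u X)) = 0 := by
        rw [hv, ← D.sub_τ_secondFundamentalForm]
        have h3 := congrArg (fun w => w - τ u w) h1
        simp only [map_add, map_zero, sub_zero] at h3
        rw [← h3]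
        abel
      have h4 : normalDeriv h r.β u X - τ u (normalDeriv h r.β u X) =
          -(r.φ u • (dd m η u X - τ u (dd m η u X)) + dd m r.φ u X • η u) := by
        rw [D.normalDeriv_eq, hβd.dd_eq]
        simp only [sub_apply, add_apply, smul_apply, ContinuousLinearMap.smulRight_apply, map_add,
          map_sub, map_smul, hτb, D.τ_η, D.π_η, D.τ_τ, D.τ_π]
        module
      rw [h4] at h2
      have h5 := eq_sub_of_add_eq (D.dτ_H u X)
      rw [map_add, map_smul, map_sub, h5, D.dτ_η, eq_neg_of_add_eq_zero_left h2, inner_add_left,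
        ← hdφ, real_inner_smul_left, inner_sub_left, D.inner_η_h]
      module
  have hdv : v = -(r.φ u • (H u - η u)) := eq_neg_of_add_eq_zero_left hw
  have hdφ' : ∀ X, dd m r.φ u X = -(r.φ u * ⟪H u, dd m h u X⟫) := fun X => by
    rw [hdφ, hdv, inner_neg_left, real_inner_smul_left, inner_sub_left, D.inner_η_h, sub_zero]
  refine ⟨r.smooth_φ u, hbs u, D.π_π u _, hdφ', fun X => ?_⟩
  have hT : HasDD (fun u => -(r.φ u • (H u - η u))) _ u :=
    ((r.smooth_φ.hasDD u).smul ((D.smooth_H.hasDD u).sub (D.smooth_η.hasDD u))).neg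
  have h1 := dd_tproj_apply_of_tangent D.isSmoothImmersion hT (Eventually.of_forall fun y => by
    rw [D.tproj_eq, sub_apply, map_neg, map_smul, D.τ_Hη, map_neg, map_smul,
      map_sub, D.π_H, D.π_η, sub_zero, smul_zero, neg_zero, sub_zero]) X
  have h2 := r.eqn u X
  rw [secondFundamentalForm_symm D.isSmoothImmersion, secondFundamentalForm_eq D.isSmoothImmersion,
    ← hv, hdv, h1, Submfd.normalDeriv_eq, hβd.dd_eq, D.tproj_eq] at h2
  have h3 := congrArg (π u) h2
  simp only [add_apply, sub_apply, neg_apply, smul_apply, ContinuousLinearMap.smulRight_apply,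
    map_add, map_sub, map_neg, map_smul, D.π_τ, D.π_π, D.π_H, D.π_η, map_zero] at h3
  rw [← sub_eq_zero, ← h3]
  module

/-- Two solutions with nonvanishing `φ` have proportional `φ`. After rescaling, their difference is
a solution with `φ = 0`, that is, a parallel section of `N`. -/
theorem class_eq [PreconnectedSpace L] [Nonempty L] (D : LeafFields m h η τ π H)
    {N : L → Submodule ℝ (Euc q)} (hN : ∀ u, (N u).starProjection = π u) {φ : L → ℝ} {b : L → Euc q}
    (hs : ∀ u, IsSolAt m h π H φ b u) (hφ : ∀ u, φ u ≠ 0) (hF : ∀ u, b u - φ u • H u ≠ 0)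
    (r : RibaucourPair m h) (hr : ∀ u, r.β u - τ u (r.β u) = -(r.φ u • η u)) :
    (Quotient.mk (ribaucourSetoid m h N) r : RibaucourClass m h N) =
      Quotient.mk (ribaucourSetoid m h N) (D.ribaucourPair hs hφ hF) := by
  have hs' := D.isSolAt_of_pair r hr
  obtain ⟨u₀⟩ := ‹Nonempty L›
  set c := r.φ u₀ / φ u₀ with hc
  have hc' : ∀ u, r.φ u = c * φ u := fun u => by
    have := eq_of_hasDD_zero (k := m) (F := fun u => r.φ u / φ u)
      (fun u => (hs' u).hasDD_div (hs u) (hφ u)) u u₀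
    rw [hc, ← this, div_mul_cancel₀ _ (hφ u)]
  have hsub : ∀ u, IsSolAt m h π H (fun _ => 0) (fun u => π u (r.β u) - c • b u) u := fun u =>
    ((hs' u).sub ((hs u).smul c)).congr (Eventually.of_forall fun y => by
        simp only [hc', sub_self])
      (Eventually.of_forall fun y => rfl)
  refine (Quotient.sound ?_).symm
  refine ⟨c, div_ne_zero (r.φ_ne_zero u₀) (hφ u₀), funext hc', ?_⟩
  have he : r.β - c • (D.ribaucourPair hs hφ hF).β = fun u => π u (r.β u) - c • b u := by
    funext u
    have h1 := (D.mem_normalSpace u _).1 (r.isSection_β.mem u)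
    have h2 := hr u
    rw [h1, hc'] at h2
    change r.β u - c • (b u - φ u • η u) = _
    rw [← sub_eq_zero, ← sub_eq_zero.2 h2]
    module
  rw [he]
  refine ⟨⟨fun u => (hsub u).smooth_b, fun u => ?_⟩, fun u X => ?_⟩
  · rw [← Submodule.starProjection_eq_self_iff, hN]
    exact (hsub u).mem
  · rw [D.normalDeriv_of_hasDD (hsub u).smooth_b.hasDD (Eventually.of_forall fun y =>
      (hsub y).mem), (hsub u).db, zero_smul]

end LeafFields

end Classes

section Assembly

variable {n m q s : ℕ} {M : Type*} [TopologicalSpace M] [ChartedSpace (Euc n) M]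
  [IsManifold 𝓘(ℝ, Euc n) ∞ M] {f η : M → Euc q} {τ π : M → Euc q →L[ℝ] Euc q} {H : M → Euc q}
  {L : Type*} [TopologicalSpace L] [ChartedSpace (Euc m) L] {j : L → M}

/-- Restrict the parametrization to a coordinate line through `z = 0` in the fibre over `u` and
apply `normal_combescure`; the part of `F` tangent to the leaf does not contribute. -/
theorem DupinFields.normal_part_of_isRibaucourTransformNear (D : DupinFields n f η τ π H)
    (hj : IsLeaf n m f π j) (i₀ : Fin s) {N : L → Submodule ℝ (Euc q)}
    (hN : ∀ u, (N u).starProjection = π (j u)) {r : RibaucourPair m (f ∘ j)}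
    {ξ : Fin s → L → Euc q} {W : Set (L × Euc s)} {Ψ : L × Euc s → M}
    (hξ : IsParallelFrame m (f ∘ j) N ξ) (hW : IsOpen W) (hW0 : ∀ u, (u, 0) ∈ W ∧ Ψ (u, 0) = j u)
    (hΨ : IsLocalDiffeomorphOn (𝓘(ℝ, Euc m).prod 𝓘(ℝ, Euc s)) 𝓘(ℝ, Euc n) ∞ Ψ W)
    (hfΨ : ∀ u z, (u, z) ∈ W → z ≠ 0 → f (Ψ (u, z)) = ribaucourMap r ξ u ((‖z‖ ^ 2)⁻¹ • z)) (u : L) :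
    r.β u - τ (j u) (r.β u) = -(r.φ u • η (j u)) := by
  set z₀ : Euc s := EuclideanSpace.single i₀ 1 with hz₀
  have hz₀n : ‖z₀‖ = 1 := by simp [hz₀]
  have hline : Continuous (fun t : ℝ => (u, t • z₀)) := by fun_prop
  have hc : ContinuousAt (fun t : ℝ => Ψ (u, t • z₀)) 0 := by
    refine ContinuousAt.comp (g := Ψ) ?_ hline.continuousAt
    rw [zero_smul]
    exact (hΨ ⟨_, (hW0 u).1⟩).contMDiffAt.continuousAt
  have hc0 : Ψ (u, (0 : ℝ) • z₀) = j u := by rw [zero_smul]; exact (hW0 u).2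
  have hWe : ∀ᶠ t : ℝ in 𝓝 0, (u, t • z₀) ∈ W := 
    (hW.preimage hline).mem_nhds (by rw [mem_preimage, zero_smul]; exact (hW0 u).1)
  have hsum : ∀ t : ℝ, ∑ i, (t • z₀) i • ξ i u = t • ξ i₀ u := fun t => by
    rw [Finset.sum_eq_single i₀ (fun i _ hi => by simp [hz₀, hi]) (by simp)]
    simp [hz₀]
  have h1 := D.normal_combescure hc (r.φ_ne_zero u) (e := ξ i₀ u)
    (F := combescure m (f ∘ j) r.φ r.β u) ((hξ.orthonormal u).1 i₀)
    (by rw [hc0, ← hN, Submodule.starProjection_eq_self_iff]; exact (hξ.parallel i₀).1.mem u)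
    (by
      filter_upwards [hWe] with t ht
      rw [hc0]
      rcases eq_or_ne t 0 with rfl | h0
      · rw [hc0]; simp
      rw [hfΨ u _ ht (smul_ne_zero h0 (by rw [← norm_ne_zero_iff, hz₀n]; exact one_ne_zero)),
        ribaucourMap]
      -- Since `z₀` is a unit vector, `z = t z₀` corresponds to `y = z₀/t`, so `F_t = F + ξ/t =
      -- t⁻¹(ξ + tF)`.
      have hsc : shiftedCombescure r ξ u ((‖t • z₀‖ ^ 2)⁻¹ • t • z₀) =
          t⁻¹ • (ξ i₀ u + t • combescure m (f ∘ j) r.φ r.β u) := by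
        rw [shiftedCombescure, smul_smul, hsum, norm_smul, hz₀n, mul_one, Real.norm_eq_abs, sq_abs,
          smul_add, smul_smul, inv_mul_cancel₀ h0, one_smul, add_comm]
        congr 2
        field_simp
      rw [hsc, norm_smul, smul_smul, mul_pow, Real.norm_eq_abs, sq_abs, mul_inv, inv_pow, inv_inv]
      congr 2
      generalize (‖ξ i₀ u + t • combescure m (f ∘ j) r.φ r.β u‖ ^ 2)⁻¹ = P
      field_simp)
  simp only [hc0] at h1
  have h2 : τ (j u) (dd m (f ∘ j) u (gradient m (f ∘ j) r.φ u)) =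
    dd m (f ∘ j) u (gradient m (f ∘ j) r.φ u) := (D.leafFields hj).τ_h u _
  rw [combescure, differential_eq_dd, map_add, h2, add_sub_add_left_eq_sub] at h1
  exact h1

end Assembly

end Submfd

end

/-! ### Assembly of the theorem. -/

open Submfd in
theorem mainTheorem1 {n p s : ℕ}
    {M : Type*} [TopologicalSpace M] [T2Space M] [SecondCountableTopology M]
    [ChartedSpace (Euc n) M] [IsManifold 𝓘(ℝ, Euc n) ∞ M]
    (f η : M → Euc (n + p)) (hf : IsSmoothImmersion n f)
    (hη : IsDupinPrincipalNormal n f η s)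
    (hint : IsIntegrable (n - s) (conullity n f η))
    {L : Type*} [TopologicalSpace L] [T2Space L] [SecondCountableTopology L]
    [ChartedSpace (Euc (n - s)) L] [IsManifold 𝓘(ℝ, Euc (n - s)) ∞ L]
    (j : L → M) (hj : IsIntegralManifold (n - s) (conullity n f η) j)
    (N : L → Submodule ℝ (Euc (n + p)))
    (hN : ∀ u, N u = (nullity n f η (j u)).map (differential n f (j u)).toLinearMap) :
    (IsNormalSubbundle (n - s) (f ∘ j) N s ∧ IsParallel (n - s) (f ∘ j) N ∧ IsFlat (n - s) (f ∘ j) N) ∧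
    (SimplyConnectedSpace L →
      ∃ w : RibaucourClass (n - s) (f ∘ j) N,
        (∀ u, classNullity w u = {0}) ∧
        IsRibaucourTransformNear (n - s) n s f j N w ∧
        ∀ w' : RibaucourClass (n - s) (f ∘ j) N, IsRibaucourTransformNear (n - s) n s f j N w' → w' = w) := by
  have D := dupinFields hf hη
  have hl := hj.isLeaf
  have DL := D.leafFields hl
  have hNπ : ∀ u, (N u).starProjection = (nullProj n f η ∘ j) u := fun u => by
    simp only [Function.comp_apply, nullProj, nullImage, hN u]
  have hrk : HasRank (nullProj n f η ∘ j) s := fun u => exists_isometry_nullProj hf hη (j u)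
  -- The subtraction is truncated, and `s ≤ n` is read off at a point; hence the dependence on a
  -- point of `L`, which may be empty in the first assertion.
  have hms : ∀ _ : L, n - s + s = n := fun u => Nat.sub_add_cancel (hη.le (j u))
  have hint' : ∀ x : M, ∃ (U : TopologicalSpace.Opens (Euc (n - s))) (g : U → M) (a : U),
      IsLeaf n (n - s) f (nullProj n f η) g ∧ g a = x := fun x => by
    obtain ⟨U, g, hg, a, ha⟩ := hint x
    exact ⟨U, g, a, hg.isLeaf, ha⟩
  have hloc : ∀ u₀, ∃ (φ : L → ℝ) (b : L → Euc (n + p)) (ξ : Fin s → L → Euc (n + p)),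
      ∀ᶠ u in nhds u₀, IsLocalFrameAt (n - s) (f ∘ j) (nullProj n f η ∘ j)
        (nullMeanCurv n f η ∘ j) φ b ξ u := by
    intro u₀
    obtain ⟨ι, hι⟩ := hrk u₀
    exact DL.exists_localFrame hη.one_le u₀ ι (fun z => (hι _).2 ⟨z, rfl⟩)
      (D.exists_leaf_section hl (hms u₀) hint' u₀ ι hι)
  refine ⟨⟨DL.isNormalSubbundle hNπ fun u => ?_, DL.isParallel hNπ, DL.isFlat hrk hloc hNπ⟩, ?_⟩
  · rw [hN u]
    exact finrank_nullImage hf hη (j u)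
  intro hsc
  let i₀ : Fin s := ⟨0, hη.one_le⟩
  obtain ⟨u₀⟩ : Nonempty L := inferInstance
  obtain ⟨φ, b₀, ξ, hfr₀⟩ := exists_global_frame DL.π_symm hrk hloc
  -- Altering `b` by a parallel section of `N` respects the equivalence and ensures that the
  -- Combescure transform vanishes nowhere.
  obtain ⟨b, hfr, hF⟩ := DL.exists_ne_zero i₀ hfr₀
  refine ⟨_, DL.classNullity_ribaucourPair hNπ (fun u => (hfr u).sol) (fun u => (hfr u).ne_zero) hF,
    D.isRibaucourTransformNear hl (hms u₀) hNπ hfr hF, ?_⟩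
  rintro w' ⟨r, ξ', W, Ψ, rfl, hξ', hW, hW0, hΨ, hfΨ⟩
  have : Nonempty L := ⟨u₀⟩
  exact DL.class_eq hNπ _ _ hF r (D.normal_part_of_isRibaucourTransformNear hl i₀ hNπ hξ' hW hW0 hΨ
    fun u z hz h0 => (hfΨ u z hz h0).2)
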